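/- Let $(M,L)$ be a $4$-dimensional Finsler spacetime: $M$ is a connected smooth $4$-manifold, $A\subset TM\setminus\mathbf 0$ is a connected open conic set with smooth boundary and nonempty fibres $A_p$, $\bar A$ is its closure in $TM\setminus\mathbf 0$, and $L\colon\bar A\to[0,\infty)$ is smooth, positively homogeneous of degree $2$ on fibres, with fundamental tensor $g_v(u,w)=\frac12\frac{\partial^2}{\partial s\,\partial t}L(v+tu+sw)|_{t=s=0}$ of signature $(+,-,-,-)$ for every $v\in\bar A$, and with $\partial\bar A=L^{-1}(0)$. Let $\nabla$ be its Levi-Civita--Chern connection and $R$ its Chern curvature, $R(X,Y)=[\nabla_X,\nabla_Y]-\nabla_{[X,Y]}$. Let $f$ be a smooth function on an open set $\mathscr U\subseteq M$ whose gradient $N=\nabla f$ (that is, $g_N(N,\cdot)=df$) is lightlike ($N\in\bar A$, $L(N)=0$), and let $(x^0,x^1,x^2,x^3)$ be lightlike coordinates on $\mathscr U$: $N=\partial_0$ and $$(g_{ij}(N))=\begin{pmatrix}0&1&0&0\\1&g_{11}&g_{12}&g_{13}\\0&g_{21}&h_{22}&h_{23}\\0&g_{31}&h_{32}&h_{33}\end{pmatrix}.$$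 (The block $(h_{ij})$ is then definite.) Let $\Lambda_{b,c}=\{q\in\mathscr U: x^0(q)=b,\ x^1(q)=c\}$. Suppose that the inverse $\Phi$ of the coordinate map is continued to a smooth map $\Phi\colon W\to M$ on an open set $W\subseteq\mathbb R^4$ containing the range of the coordinates, such that at the points of $W$ outside this range the $x^0$-lines $s\mapsto\Phi(s,x^1,x^2,x^3)$ satisfy the geodesic equation with velocity in $\bar A$; no nondegeneracy of $\Phi$ is required there, and the case where $W$ is the range of the coordinates is included. On $W$ put $\partial_i=\partial\Phi/\partial x^i$, $N=\partial_0$, $h_{ij}=g_N(\partial_i,\partial_j)$ for $i,j\in\{2,3\}$, and $$\Delta=\sqrt{h_{22}h_{33}-h_{23}h_{32}}.$$ Let $I$ be an open interval and $\gamma(s)=\Phi(s,c,y^2,y^3)$, $s\in I$, an integral curve of $N$ with $(s,c,y^2,y^3)\in W$ for all $s\in I$, where $b\in I$ and $(b,c,y^2,y^3)$ lies in the range of the coordinates. Then for every $t\in I$, the point $p=\gamma(t)$ is a focal point of $\Lambda_{b,c}$ along the geodesic $\gamma$ if and only if $\Delta(t,c,y^2,y^3)=0$. Here $\gamma(t)$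 is a focal point of $\Lambda=\Lambda_{b,c}$ along $\gamma$ if $\gamma$ is a geodesic on $I$ which meets $\Lambda$ orthogonally at time $b$ with velocity $N$, $t\neq b$, and there is a smooth vector field $J\not\equiv0$ along $\gamma$ on $I$ with $J''=-R_{\gamma'}(J,\gamma')\gamma'$, $J(b)\in T_{\gamma(b)}\Lambda$, $\tan_\Lambda J'(b)=\tan_\Lambda(\nabla^N_{J(b)}N)$, and $J(t)=0$; primes on $J$ denote the covariant derivative along $\gamma$ with reference vector $\gamma'$. -/

import Mathlib

open scoped Manifold ContDiff Topology

noncomputable section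

/-- The model space of a four-dimensional manifold. -/
abbrev E4 : Type := EuclideanSpace ℝ (Fin 4)

/-- The `i`-th coordinate vector of `ℝ⁴`. -/
def basisVec (i : Fin 4) : E4 := EuclideanSpace.single i 1

/-! ### Fundamental tensor and Cartan tensor of a function on a vector space -/

section Fibre

variable {V : Type*} [AddCommGroup V] [Module ℝ V]

/-- `g_v(u,w) = (1/2) ∂²/∂s∂t F(v + t u + s w)` at `t = s = 0`. -/
def fundTensor (F : V → ℝ) (v u w : V) : ℝ :=
  (1 / 2) * deriv (fun s : ℝ => deriv (fun t : ℝ => F (v + t • u + s • w)) 0) 0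

/-- `C_v(u,w,z) = (1/4) ∂³/∂r∂s∂t F(v + t u + s w + r z)` at `t = s = r = 0`. -/
def cartanTensor (F : V → ℝ) (v u w z : V) : ℝ :=
  (1 / 4) * deriv (fun r : ℝ => deriv (fun s : ℝ =>
    deriv (fun t : ℝ => F (v + t • u + s • w + r • z)) 0) 0) 0

end Fibre

/-! ### The Levi-Civita--Chern connection and its curvature in coordinates

`ℓ x v` is the expression of the Finsler function in a chart: `x` is the position, `v` the
direction. -/

namespace LocalFinsler

/-- The matrix `g_ij(x,v)`. -/
def metric (ℓ : E4 → E4 → ℝ) (x v : E4) : Matrix (Fin 4) (Fin 4) ℝ :=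
  Matrix.of fun i j => fundTensor (ℓ x) v (basisVec i) (basisVec j)

/-- The components `C_ijk(x,v)` of the Cartan tensor. -/
def cartan (ℓ : E4 → E4 → ℝ) (x v : E4) (i j k : Fin 4) : ℝ :=
  cartanTensor (ℓ x) v (basisVec i) (basisVec j) (basisVec k)

/-- Partial derivative `∂F/∂xʲ` in the position. -/
def dPos (F : E4 → E4 → ℝ) (x v : E4) (j : Fin 4) : ℝ :=
  lineDeriv ℝ (fun y => F y v) x (basisVec j)

/-- Partial derivative `∂F/∂vʲ` in the direction. -/
def dDir (F : E4 → E4 → ℝ) (x v : E4) (j : Fin 4) : ℝ :=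
  lineDeriv ℝ (fun y => F x y) v (basisVec j)

/-- The formal Christoffel symbols
`γ^i_jk = (1/2) g^il (∂_j g_lk + ∂_k g_jl - ∂_l g_jk)`. -/
def formalChristoffel (ℓ : E4 → E4 → ℝ) (x v : E4) (i j k : Fin 4) : ℝ :=
  (1 / 2) * ∑ l, (metric ℓ x v)⁻¹ i l *
    (dPos (fun y u => metric ℓ y u l k) x v j + dPos (fun y u => metric ℓ y u j l) x v k
      - dPos (fun y u => metric ℓ y u j k) x v l)

/-- The nonlinear connection `N^i_j = γ^i_jk v^k - g^il C_ljk γ^k_rs v^r v^s`. -/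
def nonlinearConn (ℓ : E4 → E4 → ℝ) (x v : E4) (i j : Fin 4) : ℝ :=
  (∑ k, formalChristoffel ℓ x v i j k * v k)
    - ∑ l, ∑ k, ∑ r, ∑ s, (metric ℓ x v)⁻¹ i l * cartan ℓ x v l j k
        * formalChristoffel ℓ x v k r s * v r * v s

/-- The horizontal derivative `δ_j F = ∂F/∂x^j - N^m_j ∂F/∂v^m`, that is, the derivative in the
direction `∂_j` of `F` evaluated on a pointwise parallel extension of `v`. -/
def dHor (ℓ : E4 → E4 → ℝ) (F : E4 → E4 → ℝ) (x v : E4) (j : Fin 4) : ℝ :=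
  dPos F x v j - ∑ m, nonlinearConn ℓ x v m j * dDir F x v m

/-- The Christoffel symbols of the Levi-Civita--Chern anisotropic connection,
`Γ^i_jk = (1/2) g^il (δ_j g_lk + δ_k g_jl - δ_l g_jk)`: the solution of the Koszul formula of the
torsion-free, almost `g`-compatible anisotropic connection. One has `Γ^i_jk v^k = N^i_j`. -/
def christoffel (ℓ : E4 → E4 → ℝ) (x v : E4) (i j k : Fin 4) : ℝ :=
  (1 / 2) * ∑ l, (metric ℓ x v)⁻¹ i l *
    (dHor ℓ (fun y u => metric ℓ y u l k) x v j + dHor ℓ (fun y u => metric ℓ y u j l) x v k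
      - dHor ℓ (fun y u => metric ℓ y u j k) x v l)

/-- The Chern curvature tensor: `R_v(∂_k, ∂_l) ∂_j = chernCurvature ℓ x v i j k l • ∂_i`
(sum over `i`), with the convention `R(X,Y) = [∇_X, ∇_Y] - ∇_[X,Y]`. -/
def chernCurvature (ℓ : E4 → E4 → ℝ) (x v : E4) (i j k l : Fin 4) : ℝ :=
  dHor ℓ (fun y u => christoffel ℓ y u i l j) x v k
    - dHor ℓ (fun y u => christoffel ℓ y u i k j) x v l
    + ∑ m, (christoffel ℓ x v i k m * christoffel ℓ x v m l j
        - christoffel ℓ x v i l m * christoffel ℓ x v m k j)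

/-- The vector `R_v(X,Y)Z`. -/
def curvVec (ℓ : E4 → E4 → ℝ) (x v X Y Z : E4) : E4 :=
  WithLp.toLp 2 fun i => ∑ j, ∑ k, ∑ l, chernCurvature ℓ x v i j k l * Z j * X k * Y l

/-- Covariant derivative at time `s` of the vector field `X` along the curve `x`, with reference
vector field `V` along `x`:
`(D X)^i = dX^i/ds + Γ^i_jk(x,V) (dx^j/ds) X^k`. -/
def covDeriv (ℓ : E4 → E4 → ℝ) (x V X : ℝ → E4) (s : ℝ) : E4 :=
  WithLp.toLp 2 fun i => deriv X s i
    + ∑ j, ∑ k, christoffel ℓ (x s) (V s) i j k * deriv x s j * X s k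

end LocalFinsler

/-! ### Finsler spacetimes -/

section Manifold

variable {M : Type*} [TopologicalSpace M] [ChartedSpace E4 M]

/-- The velocity of a curve in `M`. -/
def velocity (γ : ℝ → M) (s : ℝ) : TangentSpace (𝓡 4) (γ s) :=
  mfderiv 𝓘(ℝ, ℝ) (𝓡 4) γ s (1 : ℝ)

variable (M) in
/-- A four-dimensional Finsler spacetime `(M, L)`, with cone domain `A`. -/
structure FinslerSpacetime [IsManifold (𝓡 4) ∞ M] where
  /-- the conic domain of timelike vectors -/
  A : Set (TangentBundle (𝓡 4) M)
  /-- The Finsler function; only its restriction to the closure of `A` in `TM ∖ 0` matters. -/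
  L : TangentBundle (𝓡 4) M → ℝ
  isOpen_A : IsOpen A
  isConnected_A : IsConnected A
  ne_zero : ∀ (p : M) (v : TangentSpace (𝓡 4) p), (⟨p, v⟩ : TangentBundle (𝓡 4) M) ∈ A → v ≠ 0
  conic : ∀ (p : M) (v : TangentSpace (𝓡 4) p), (⟨p, v⟩ : TangentBundle (𝓡 4) M) ∈ A →
    ∀ r : ℝ, 0 < r → (⟨p, r • v⟩ : TangentBundle (𝓡 4) M) ∈ A
  nonempty_fibre : ∀ p : M, ∃ v : TangentSpace (𝓡 4) p, (⟨p, v⟩ : TangentBundle (𝓡 4) M) ∈ A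
  /-- `L` is smooth on the closure of `A` in `TM ∖ 0`, as a function on a closed set: it is the
  restriction of a smooth function on an open neighbourhood. All derivatives of `L` at points of
  this closure are determined by `L` on `A`. -/
  smooth_L : ∃ O : Set (TangentBundle (𝓡 4) M), IsOpen O ∧ closure A ∩ {z | z.2 ≠ 0} ⊆ O ∧
    ContMDiffOn (𝓡 4).tangent 𝓘(ℝ, ℝ) ∞ L O
  nonneg : ∀ z ∈ closure A ∩ {z | z.2 ≠ 0}, 0 ≤ L z
  homogeneous : ∀ (p : M) (v : TangentSpace (𝓡 4) p),
    (⟨p, v⟩ : TangentBundle (𝓡 4) M) ∈ closure A ∩ {z | z.2 ≠ 0} →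
    ∀ r : ℝ, 0 < r → L ⟨p, r • v⟩ = r ^ 2 * L ⟨p, v⟩
  /-- the fundamental tensor has signature `(+,-,-,-)` -/
  signature : ∀ (p : M) (v : TangentSpace (𝓡 4) p),
    (⟨p, v⟩ : TangentBundle (𝓡 4) M) ∈ closure A ∩ {z | z.2 ≠ 0} →
    ∃ B : Module.Basis (Fin 4) ℝ (TangentSpace (𝓡 4) p), ∀ i j,
      fundTensor (fun u : TangentSpace (𝓡 4) p => L ⟨p, u⟩) v (B i) (B j)
        = if i = j then (if i = 0 then 1 else -1) else 0
  /-- The boundary of `A` in `TM ∖ 0` is the light cone `L⁻¹(0)`. It is then a smooth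
  hypersurface, because `dL(u) = 2 g_v(v,u)` on vertical vectors `u` and `g_v` is nondegenerate. -/
  boundary : (closure A ∩ {z | z.2 ≠ 0}) \ A = {z ∈ closure A ∩ {z | z.2 ≠ 0} | L z = 0}

namespace FinslerSpacetime

variable [IsManifold (𝓡 4) ∞ M] (S : FinslerSpacetime M)

/-- The closure of `A` in `TM ∖ 0`. -/
def Abar : Set (TangentBundle (𝓡 4) M) := closure S.A ∩ {z | z.2 ≠ 0}

/-- The fundamental tensor `g_v(u,w)` of the spacetime. -/
def g {p : M} (v u w : TangentSpace (𝓡 4) p) : ℝ :=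
  fundTensor (fun y : TangentSpace (𝓡 4) p => S.L ⟨p, y⟩) v u w

/-- The expression of `L` in the chart `e`. -/
def coordL (e : OpenPartialHomeomorph M E4) (x v : E4) : ℝ :=
  S.L ⟨e.symm x, mfderiv (𝓡 4) (𝓡 4) e.symm x v⟩

/-- The curve `γ` is an (admissible) geodesic at time `s`: its velocity lies in the closure of `A`
in `TM ∖ 0`, and the covariant derivative of `γ'` along `γ`, with reference `γ'`, vanishes at `s`
(as read in any chart). -/
def IsGeodesicAt (γ : ℝ → M) (s : ℝ) : Prop :=
  (⟨γ s, velocity γ s⟩ : TangentBundle (𝓡 4) M) ∈ S.Abar ∧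
  ∀ e ∈ IsManifold.maximalAtlas (𝓡 4) ∞ M, γ s ∈ e.source →
    LocalFinsler.covDeriv (S.coordL e) (fun r => e (γ r)) (deriv fun r => e (γ r))
      (deriv fun r => e (γ r)) s = 0

/-- `J` is a Jacobi field along `γ` on `I`: a smooth vector field along `γ` with
`J'' = - R_{γ'}(J, γ') γ'` (as read in any chart). -/
def IsJacobiField (γ : ℝ → M) (I : Set ℝ) (J : ∀ s, TangentSpace (𝓡 4) (γ s)) : Prop :=
  ContMDiffOn 𝓘(ℝ, ℝ) (𝓡 4).tangent ∞ (fun s => (⟨γ s, J s⟩ : TangentBundle (𝓡 4) M)) I ∧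
  ∀ e ∈ IsManifold.maximalAtlas (𝓡 4) ∞ M, ∀ s ∈ I, γ s ∈ e.source →
    LocalFinsler.covDeriv (S.coordL e) (fun r => e (γ r)) (deriv fun r => e (γ r))
      (LocalFinsler.covDeriv (S.coordL e) (fun r => e (γ r)) (deriv fun r => e (γ r))
        (fun r => mfderiv (𝓡 4) (𝓡 4) e (γ r) (J r))) s
    = - LocalFinsler.curvVec (S.coordL e) (e (γ s)) (deriv (fun r => e (γ r)) s)
        (mfderiv (𝓡 4) (𝓡 4) e (γ s) (J s)) (deriv (fun r => e (γ r)) s)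
        (deriv (fun r => e (γ r)) s)

/-- `α` is (near time `0`) a smooth curve in `P` which starts at `q` with velocity `u`. -/
def IsCurveIn (P : Set M) (q : M) (u : TangentSpace (𝓡 4) q) (α : ℝ → M) : Prop :=
  ContMDiffAt 𝓘(ℝ, ℝ) (𝓡 4) ∞ α 0 ∧ (∀ᶠ r in 𝓝 (0 : ℝ), α r ∈ P) ∧
  (⟨α 0, velocity α 0⟩ : TangentBundle (𝓡 4) M) = ⟨q, u⟩

/-- The tangent space at `q` of a submanifold `P` of `M`. -/
def tangentTo (P : Set M) (q : M) : Set (TangentSpace (𝓡 4) q) :=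
  {u | ∃ α : ℝ → M, IsCurveIn P q u α}

/-- `J` is a `P`-Jacobi field along `γ`, where `γ` starts at time `b` at a point of `P` with velocity
`ν (γ b)`, and `ν` is a normal vector field of `P`: `J` is a Jacobi field, `J(b)` is tangent to `P`,
and `J'(b)` and `∇^ν_{J(b)} ν` have the same tangential part. The latter says
`g_ν(J'(b), w) = g_ν(∇^ν_{J(b)} ν, w)` for all `w` tangent to `P`. -/
def IsSubmanifoldJacobiField (P : Set M) (ν : ∀ q : M, TangentSpace (𝓡 4) q) (γ : ℝ → M)
    (I : Set ℝ) (b : ℝ) (J : ∀ s, TangentSpace (𝓡 4) (γ s)) : Prop :=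
  S.IsJacobiField γ I J ∧ J b ∈ tangentTo P (γ b) ∧
  ∀ e ∈ IsManifold.maximalAtlas (𝓡 4) ∞ M, γ b ∈ e.source →
    ∀ α : ℝ → M, IsCurveIn P (γ b) (J b) α →
    ∀ w ∈ tangentTo P (γ b),
      fundTensor (S.coordL e (e (γ b))) (deriv (fun r => e (γ r)) b)
        (LocalFinsler.covDeriv (S.coordL e) (fun r => e (γ r)) (deriv fun r => e (γ r))
          (fun r => mfderiv (𝓡 4) (𝓡 4) e (γ r) (J r)) b)
        (mfderiv (𝓡 4) (𝓡 4) e (γ b) w)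
      = fundTensor (S.coordL e (e (γ b))) (deriv (fun r => e (γ r)) b)
        (LocalFinsler.covDeriv (S.coordL e) (fun r => e (α r))
          (fun r => mfderiv (𝓡 4) (𝓡 4) e (α r) (ν (α r)))
          (fun r => mfderiv (𝓡 4) (𝓡 4) e (α r) (ν (α r))) 0)
        (mfderiv (𝓡 4) (𝓡 4) e (γ b) w)

/-- `γ(t)` is a focal point of the submanifold `P` along `γ`: on `I` the curve `γ` is a geodesic,
it starts at time `b` in `P`, orthogonally to `P` and with velocity the value of the normal field
`ν`, and there is a nontrivial `P`-Jacobi field along it which vanishes at the time `t ≠ b`. -/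
def IsFocalPoint (P : Set M) (ν : ∀ q : M, TangentSpace (𝓡 4) q) (γ : ℝ → M)
    (I : Set ℝ) (b t : ℝ) : Prop :=
  (∀ s ∈ I, S.IsGeodesicAt γ s) ∧ γ b ∈ P ∧ velocity γ b = ν (γ b) ∧
  (∀ q ∈ P, ∀ w ∈ tangentTo P q, S.g (ν q) (ν q) w = 0) ∧ t ≠ b ∧
  ∃ J : ∀ s, TangentSpace (𝓡 4) (γ s),
    S.IsSubmanifoldJacobiField P ν γ I b J ∧ (∃ s ∈ I, J s ≠ 0) ∧ J t = 0

/-! ### Lightlike coordinates -/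

/-- The vector `∂_i` at the point of `M` with (possibly degenerate) coordinates `x`. -/
def coordVec (Φ : E4 → M) (x : E4) (i : Fin 4) : TangentSpace (𝓡 4) (Φ x) :=
  mfderiv (𝓡 4) (𝓡 4) Φ x (basisVec i)

/-- The components `g_ij(∂_0)`, i.e. `g_ij(N)` for `N = ∂_0`. -/
def gram (Φ : E4 → M) (x : E4) (i j : Fin 4) : ℝ :=
  S.g (coordVec Φ x 0) (coordVec Φ x i) (coordVec Φ x j)

/-- `Δ = (h_22 h_33 - h_23 h_32)^(1/2)`, with `h_ij = g_ij(N)`. -/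
def Delta (Φ : E4 → M) (x : E4) : ℝ :=
  Real.sqrt (!![S.gram Φ x 2 2, S.gram Φ x 2 3; S.gram Φ x 3 2, S.gram Φ x 3 3] :
    Matrix (Fin 2) (Fin 2) ℝ).det

/-- `φ` is a system of lightlike coordinates on its domain, for the lightlike gradient field
`N = ∇f`: in these coordinates `N = ∂_0` and the matrix `g_ij(N)` has first row `(0,1,0,0)`. The
block `h_ij`, `i,j = 2,3`, is then definite because of the signature of `g_N`. -/
structure IsLightlikeChart (f : M → ℝ) (N : ∀ q : M, TangentSpace (𝓡 4) q)
    (φ : OpenPartialHomeomorph M E4) : Prop where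
  mem_atlas : φ ∈ IsManifold.maximalAtlas (𝓡 4) ∞ M
  smooth_f : ContMDiffOn (𝓡 4) 𝓘(ℝ, ℝ) ∞ f φ.source
  admissible : ∀ q ∈ φ.source, (⟨q, N q⟩ : TangentBundle (𝓡 4) M) ∈ S.Abar
  lightlike : ∀ q ∈ φ.source, S.L ⟨q, N q⟩ = 0
  gradient : ∀ q ∈ φ.source, ∀ u : TangentSpace (𝓡 4) q,
    S.g (N q) (N q) u = mfderiv (𝓡 4) 𝓘(ℝ, ℝ) f q u
  N_eq : ∀ x ∈ φ.target, N (φ.symm x) = coordVec φ.symm x 0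
  gram_00 : ∀ x ∈ φ.target, S.gram φ.symm x 0 0 = 0
  gram_01 : ∀ x ∈ φ.target, S.gram φ.symm x 0 1 = 1
  gram_02 : ∀ x ∈ φ.target, S.gram φ.symm x 0 2 = 0
  gram_03 : ∀ x ∈ φ.target, S.gram φ.symm x 0 3 = 0

/-- The coordinate slice `Λ_{b,c}` of the chart `φ`. -/
def slice (φ : OpenPartialHomeomorph M E4) (b c : ℝ) : Set M :=
  {q ∈ φ.source | φ q 0 = b ∧ φ q 1 = c}

/-- The `x⁰`-coordinate line through `z`, parametrized by `x⁰`. -/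
def line (z : E4) (s : ℝ) : E4 := z + (s - z 0) • basisVec 0

/-- `Φ`, defined on the open set `W` of `ℝ⁴`, continues the coordinates `φ` along the integral
curves of `N = ∂_0`: it is smooth, it is the inverse of `φ` on the range of `φ`, and outside that
range the `x⁰`-lines are still geodesics. The coordinate vectors may become linearly dependent
outside the range of `φ`. The case `W = φ.target`, `Φ = φ.symm` is that of the coordinates `φ`
themselves. -/
structure IsContinuation (φ : OpenPartialHomeomorph M E4) (W : Set E4) (Φ : E4 → M) : Prop where
  isOpen : IsOpen W
  target_subset : φ.target ⊆ W
  smooth : ContMDiffOn (𝓡 4) (𝓡 4) ∞ Φ W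
  eq_symm : ∀ x ∈ φ.target, Φ x = φ.symm x
  geodesic : ∀ x ∈ W \ φ.target, S.IsGeodesicAt (fun s => Φ (line x s)) (x 0)

end FinslerSpacetime

end Manifold

end

/-! The coordinate lines of `Φ` are geodesics, and so are their affine reparametrizations; hence
the fields `Φ_* (w + c (s - b) e₀)` along `γ` are Jacobi fields, whatever the rank of `Φ`.
Conversely, let `J` be a `Λ`-Jacobi field which vanishes at `t`. The momentum `g(γ', J)` is affine
in the parameter and vanishes at `b` and at `t`, so it vanishes identically. At `b`, together with
the tangential condition, this makes `J' - ∇_J N` orthogonal to `N` and to `Λ`, hence a multiple of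
`N`. By uniqueness `J = Φ_* (w + c (s - b) e₀)` with `w` tangent to the slice, and therefore `γ t`
is a focal point exactly if `Φ_*` has a kernel there.

The function `g(∂₀, Φ_* w)` is constant along `γ`, equal to the component `w¹` as in the range of
the coordinates. So `∂₀`, `∂₂`, `∂₃` remain in the degenerate hyperplane `∂₀^⊥`, on which `g` is
semidefinite with radical spanned by `∂₀`. There the Gram determinant of `∂₂`, `∂₃` vanishes
exactly if some combination of these two vectors is a multiple of `∂₀`, that is, if `Φ_*` has a
kernel.

At lightlike vectors homogeneity of `L` is known on one side of the cone only; all identities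
derived from it are extended to the boundary by continuity. -/

noncomputable section

section Calculus

variable {E F G : Type*} [NormedAddCommGroup E] [NormedSpace ℝ E]
  [NormedAddCommGroup F] [NormedSpace ℝ F] [NormedAddCommGroup G] [NormedSpace ℝ G]

lemma fderiv_fderiv_apply_comm {f : E → G} {x : E} (hf : ContDiffAt ℝ 2 f x) (a b : E) :
    fderiv ℝ (fun y => fderiv ℝ f y a) x b = fderiv ℝ (fun y => fderiv ℝ f y b) x a := by
  have hf' : DifferentiableAt ℝ (fderiv ℝ f) x :=
    (hf.fderiv_right (m := 1) (by norm_num)).differentiableAt one_ne_zero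
  have hsymm : IsSymmSndFDerivAt ℝ f x := hf.isSymmSndFDerivAt (by simp)
  have hsnd (c d : E) : fderiv ℝ (fun y => fderiv ℝ f y c) x d = fderiv ℝ (fderiv ℝ f) x d c := by
    rw [fderiv_clm_apply hf' (by fun_prop)]
    simp
  rw [hsnd, hsnd, hsymm.eq]

lemma hasLineDerivAt_uncurry_left {f : E → F → G} {x : E} {v : F}
    (hf : DifferentiableAt ℝ (Function.uncurry f) (x, v)) (w : E) :
    HasLineDerivAt ℝ (fun y => f y v) (fderiv ℝ (Function.uncurry f) (x, v) (w, 0)) x w :=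
  (hf.hasFDerivAt.comp (f := fun y : E => (y, v)) x
    ((hasFDerivAt_id x).prodMk (hasFDerivAt_const v x))).hasLineDerivAt w

lemma hasLineDerivAt_uncurry_right {f : E → F → G} {x : E} {v : F}
    (hf : DifferentiableAt ℝ (Function.uncurry f) (x, v)) (w : F) :
    HasLineDerivAt ℝ (fun y => f x y) (fderiv ℝ (Function.uncurry f) (x, v) (0, w)) v w :=
  (hf.hasFDerivAt.comp (f := fun y : F => (x, y)) v
    ((hasFDerivAt_const x v).prodMk (hasFDerivAt_id v))).hasLineDerivAt w

variable {n : WithTop ℕ∞} {m : Type*} [Fintype m] [DecidableEq m] {s : Set E}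

lemma contDiffOn_matrix_det {f : E → Matrix m m ℝ} (hf : ∀ i j, ContDiffOn ℝ n (f · i j) s) :
    ContDiffOn ℝ n (fun x => (f x).det) s := by
  simp only [Matrix.det_apply']
  exact ContDiffOn.sum fun σ _ => contDiffOn_const.mul (contDiffOn_prod fun i _ => hf _ _)

lemma contDiffOn_matrix_inv {f : E → Matrix m m ℝ} (hf : ∀ i j, ContDiffOn ℝ n (f · i j) s)
    (hdet : ∀ x ∈ s, (f x).det ≠ 0) (i j : m) : ContDiffOn ℝ n (fun x => (f x)⁻¹ i j) s := by
  simp only [Matrix.inv_def, Ring.inverse_eq_inv', Matrix.smul_apply, smul_eq_mul,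
    Matrix.adjugate_apply]
  refine ((contDiffOn_matrix_det hf).inv hdet).mul (contDiffOn_matrix_det fun k l => ?_)
  rcases eq_or_ne k j with rfl | hkj
  · simpa only [Matrix.updateRow_self] using contDiffOn_const
  · simpa only [Matrix.updateRow_ne hkj] using hf k l

end Calculus

lemma sum_mul_sum_mul {m n : Type*} [Fintype m] [Fintype n] (a : m → ℝ) (T : m → n → ℝ)
    (w : n → ℝ) : ∑ i, a i * ∑ j, T i j * w j = ∑ j, (∑ i, a i * T i j) * w j :=
  Matrix.dotProduct_mulVec a (Matrix.of T) w

lemma sum_smul_basisVec (v : E4) : ∑ i, v i • basisVec i = v := by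
  ext j
  simp [basisVec, Pi.single_apply]

lemma basisVec_apply (i j : Fin 4) : basisVec i j = if j = i then 1 else 0 := by
  simp [basisVec, PiLp.single_apply]

lemma map_eq_sum_basisVec {G : Type*} [AddCommGroup G] [Module ℝ G] (T : E4 →ₗ[ℝ] G) (v : E4) :
    T v = ∑ i, v i • T (basisVec i) := by
  conv_lhs => rw [← sum_smul_basisVec v]
  simp

lemma hasDerivAt_coord_add_smul (v : E4) (k j : Fin 4) :
    HasDerivAt (fun t : ℝ => (v + t • basisVec j) k) (if k = j then 1 else 0) 0 := by
  have : HasDerivAt (fun t : ℝ => v k + t * basisVec j k) (1 * basisVec j k) 0 :=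
    ((hasDerivAt_id (0 : ℝ)).mul_const _).const_add _
  simpa [basisVec_apply] using this

section Fibre

variable {V : Type*} [AddCommGroup V] [Module ℝ V] (F : V → ℝ) (v u w : V)

lemma fundTensor_eq_lineDeriv :
    fundTensor F v u w = (1 / 2) * lineDeriv ℝ (fun y => lineDeriv ℝ F y u) v w := by
  simp only [fundTensor, lineDeriv, add_right_comm]

lemma cartanTensor_eq_lineDeriv (z : V) : cartanTensor F v u w z =
    (1 / 4) * lineDeriv ℝ (fun x => lineDeriv ℝ (fun y => lineDeriv ℝ F y u) x w) v z := by
  have hcomm (r s t : ℝ) : v + t • u + s • w + r • z = v + r • z + s • w + t • u := by abel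
  simp only [cartanTensor, lineDeriv, hcomm]

end Fibre

/-! ### Smooth functions of position and direction -/

namespace LocalFinsler

/-- Smoothness of a function of position and direction on a set of such pairs. -/
abbrev SmoothOn (U : Set (E4 × E4)) (F : E4 → E4 → ℝ) : Prop :=
  ContDiffOn ℝ ∞ (Function.uncurry F) U

section Derivatives

variable {U : Set (E4 × E4)} {F G : E4 → E4 → ℝ} {x v : E4}

lemma SmoothOn.differentiableAt (hF : SmoothOn U F) (hU : IsOpen U) (h : (x, v) ∈ U) :
    DifferentiableAt ℝ (Function.uncurry F) (x, v) :=
  (hF.contDiffAt (hU.mem_nhds h)).differentiableAt (by simp)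

lemma SmoothOn.dPos_eq (hF : SmoothOn U F) (hU : IsOpen U) (h : (x, v) ∈ U) (j : Fin 4) :
    dPos F x v j = fderiv ℝ (Function.uncurry F) (x, v) (basisVec j, 0) :=
  (hasLineDerivAt_uncurry_left (hF.differentiableAt hU h) _).lineDeriv

lemma SmoothOn.dDir_eq (hF : SmoothOn U F) (hU : IsOpen U) (h : (x, v) ∈ U) (j : Fin 4) :
    dDir F x v j = fderiv ℝ (Function.uncurry F) (x, v) (0, basisVec j) :=
  (hasLineDerivAt_uncurry_right (hF.differentiableAt hU h) _).lineDeriv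

lemma SmoothOn.fderiv_apply (hF : SmoothOn U F) (hU : IsOpen U) (h : (x, v) ∈ U) (X Y : E4) :
    fderiv ℝ (Function.uncurry F) (x, v) (X, Y) =
      ∑ m, dPos F x v m * X m + ∑ m, dDir F x v m * Y m := by
  set T := fderiv ℝ (Function.uncurry F) (x, v) with hT
  have hX := map_eq_sum_basisVec (T.comp (ContinuousLinearMap.inl ℝ E4 E4)).toLinearMap X
  have hY := map_eq_sum_basisVec (T.comp (ContinuousLinearMap.inr ℝ E4 E4)).toLinearMap Y
  simp only [ContinuousLinearMap.coe_coe, ContinuousLinearMap.comp_apply,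
    ContinuousLinearMap.inl_apply, ContinuousLinearMap.inr_apply, smul_eq_mul] at hX hY
  have hXY : (X, Y) = (X, (0 : E4)) + ((0 : E4), Y) := by simp
  rw [hXY, map_add, hX, hY]
  simp only [hF.dPos_eq hU h, hF.dDir_eq hU h, ← hT, mul_comm]

lemma SmoothOn.fderiv_clm (hF : SmoothOn U F) (hU : IsOpen U) (w : E4 × E4) :
    ContDiffOn ℝ ∞ (fun p => fderiv ℝ (Function.uncurry F) p w) U :=
  (hF.fderiv_of_isOpen hU (m := ∞) (by simp)).clm_apply contDiffOn_const

lemma smoothOn_dPos (hF : SmoothOn U F) (hU : IsOpen U) (j : Fin 4) :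
    SmoothOn U (fun x v => dPos F x v j) :=
  (hF.fderiv_clm hU (basisVec j, 0)).congr fun p hp => hF.dPos_eq hU (x := p.1) (v := p.2) hp j

lemma smoothOn_dDir (hF : SmoothOn U F) (hU : IsOpen U) (j : Fin 4) :
    SmoothOn U (fun x v => dDir F x v j) :=
  (hF.fderiv_clm hU (0, basisVec j)).congr fun p hp => hF.dDir_eq hU (x := p.1) (v := p.2) hp j

lemma dPos_congr (hU : IsOpen U) (h : (x, v) ∈ U) (hFG : ∀ y u, (y, u) ∈ U → F y u = G y u)
    (j : Fin 4) : dPos F x v j = dPos G x v j := by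
  refine Filter.EventuallyEq.lineDeriv_eq ?_
  filter_upwards [(Continuous.prodMk_left v).tendsto x (hU.mem_nhds h)] with y hy
  exact hFG y v hy

lemma dDir_congr (hU : IsOpen U) (h : (x, v) ∈ U) (hFG : ∀ y u, (y, u) ∈ U → F y u = G y u)
    (j : Fin 4) : dDir F x v j = dDir G x v j := by
  refine Filter.EventuallyEq.lineDeriv_eq ?_
  filter_upwards [(Continuous.prodMk_right x).tendsto v (hU.mem_nhds h)] with u hu
  exact hFG x u hu

lemma dDir_dPos_comm (hF : SmoothOn U F) (hU : IsOpen U) (h : (x, v) ∈ U) (i j : Fin 4) :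
    dDir (fun y u => dPos F y u i) x v j = dPos (fun y u => dDir F y u j) x v i := by
  have hpos : Function.uncurry (fun y u => dPos F y u i) =ᶠ[𝓝 (x, v)]
      fun p => fderiv ℝ (Function.uncurry F) p (basisVec i, 0) := by
    filter_upwards [hU.mem_nhds h] with p hp using hF.dPos_eq hU (x := p.1) (v := p.2) hp i
  have hdir : Function.uncurry (fun y u => dDir F y u j) =ᶠ[𝓝 (x, v)]
      fun p => fderiv ℝ (Function.uncurry F) p (0, basisVec j) := by
    filter_upwards [hU.mem_nhds h] with p hp using hF.dDir_eq hU (x := p.1) (v := p.2) hp j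
  rw [(smoothOn_dPos hF hU i).dDir_eq hU h, (smoothOn_dDir hF hU j).dPos_eq hU h,
    hpos.fderiv_eq, hdir.fderiv_eq, fderiv_fderiv_apply_comm]
  exact (hF.contDiffAt (hU.mem_nhds h)).of_le (by norm_cast)

lemma dDir_dDir_comm (hF : SmoothOn U F) (hU : IsOpen U) (h : (x, v) ∈ U) (i j : Fin 4) :
    dDir (fun y u => dDir F y u i) x v j = dDir (fun y u => dDir F y u j) x v i := by
  have hdir (i : Fin 4) : Function.uncurry (fun y u => dDir F y u i) =ᶠ[𝓝 (x, v)]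
      fun p => fderiv ℝ (Function.uncurry F) p (0, basisVec i) := by
    filter_upwards [hU.mem_nhds h] with p hp using hF.dDir_eq hU (x := p.1) (v := p.2) hp i
  rw [(smoothOn_dDir hF hU i).dDir_eq hU h, (smoothOn_dDir hF hU j).dDir_eq hU h,
    (hdir i).fderiv_eq, (hdir j).fderiv_eq, fderiv_fderiv_apply_comm]
  exact (hF.contDiffAt (hU.mem_nhds h)).of_le (by norm_cast)

lemma SmoothOn.hasDerivAt_comp (hF : SmoothOn U F) (hU : IsOpen U) {y u : ℝ → E4} {s : ℝ}
    {y' u' : E4} (h : (y s, u s) ∈ U) (hy : HasDerivAt y y' s) (hu : HasDerivAt u u' s) :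
    HasDerivAt (fun r => F (y r) (u r))
      (∑ m, dPos F (y s) (u s) m * y' m + ∑ m, dDir F (y s) (u s) m * u' m) s := by
  rw [← hF.fderiv_apply hU h]
  exact (hF.differentiableAt hU h).hasFDerivAt.comp_hasDerivAt s (hy.prodMk hu)

lemma SmoothOn.hasDerivAt_dPos (hF : SmoothOn U F) (hU : IsOpen U) (h : (x, v) ∈ U) (j : Fin 4) :
    HasDerivAt (fun t : ℝ => F (x + t • basisVec j) v) (dPos F x v j) 0 := by
  rw [hF.dPos_eq hU h]
  exact hasLineDerivAt_uncurry_left (hF.differentiableAt hU h) _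

lemma SmoothOn.hasDerivAt_dDir (hF : SmoothOn U F) (hU : IsOpen U) (h : (x, v) ∈ U) (j : Fin 4) :
    HasDerivAt (fun t : ℝ => F x (v + t • basisVec j)) (dDir F x v j) 0 := by
  rw [hF.dDir_eq hU h]
  exact hasLineDerivAt_uncurry_right (hF.differentiableAt hU h) _

lemma SmoothOn.eq_zero_of_closure {A : Set (E4 × E4)} (hF : SmoothOn U F) (hU : IsOpen U)
    (h0 : ∀ y u, (y, u) ∈ A → F y u = 0) (h : (x, v) ∈ U ∩ closure A) : F x v = 0 := by
  have hcont : ContinuousAt (Function.uncurry F) (x, v) := hF.continuousOn.continuousAt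
    (hU.mem_nhds h.1)
  have hfreq : ∃ᶠ p in 𝓝 (x, v), Function.uncurry F p ∈ ({0} : Set ℝ) :=
    (mem_closure_iff_frequently.1 h.2).mono fun p hp => h0 p.1 p.2 hp
  exact isClosed_singleton.mem_of_frequently_of_tendsto hfreq hcont.tendsto

lemma SmoothOn.fderiv_eq_zero_of_closure {A : Set (E4 × E4)} (hF : SmoothOn U F) (hU : IsOpen U)
    (hA : IsOpen A) (h0 : ∀ y u, (y, u) ∈ A → F y u = 0) (h : (x, v) ∈ U ∩ closure A)
    (w : E4 × E4) : fderiv ℝ (Function.uncurry F) (x, v) w = 0 := by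
  refine SmoothOn.eq_zero_of_closure (F := fun y u => fderiv ℝ (Function.uncurry F) (y, u) w)
    (hF.fderiv_clm hU w) hU (fun y u hyu => ?_) h
  have hzero : Function.uncurry F =ᶠ[𝓝 (y, u)] fun _ => 0 := by
    filter_upwards [hA.mem_nhds hyu] with p hp using h0 p.1 p.2 hp
  rw [hzero.fderiv_eq, fderiv_fun_const]
  rfl

end Derivatives

section Rules

variable {U : Set (E4 × E4)} {F G : E4 → E4 → ℝ} {x v : E4}

lemma smoothOn_coord (U : Set (E4 × E4)) (k : Fin 4) : SmoothOn U (fun _ v => v k) :=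
  ((EuclideanSpace.proj k : E4 →L[ℝ] ℝ).contDiff.comp contDiff_snd).contDiffOn

lemma SmoothOn.mul (hF : SmoothOn U F) (hG : SmoothOn U G) :
    SmoothOn U (fun x v => F x v * G x v) := ContDiffOn.mul hF hG

lemma SmoothOn.add (hF : SmoothOn U F) (hG : SmoothOn U G) :
    SmoothOn U (fun x v => F x v + G x v) := ContDiffOn.add hF hG

lemma SmoothOn.sub (hF : SmoothOn U F) (hG : SmoothOn U G) :
    SmoothOn U (fun x v => F x v - G x v) := ContDiffOn.sub hF hG

lemma SmoothOn.const_mul (c : ℝ) (hF : SmoothOn U F) :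
    SmoothOn U (fun x v => c * F x v) := ContDiffOn.mul contDiffOn_const hF

lemma SmoothOn.sum {ι : Type*} [Fintype ι] {F : ι → E4 → E4 → ℝ}
    (hF : ∀ i, SmoothOn U (F i)) : SmoothOn U (fun x v => ∑ i, F i x v) :=
  ContDiffOn.sum fun i _ => hF i

lemma dPos_const_mul (c : ℝ) (F : E4 → E4 → ℝ) (x v : E4) (m : Fin 4) :
    dPos (fun y u => c * F y u) x v m = c * dPos F x v m :=
  deriv_const_mul_field _

lemma dDir_const_mul (c : ℝ) (F : E4 → E4 → ℝ) (x v : E4) (m : Fin 4) :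
    dDir (fun y u => c * F y u) x v m = c * dDir F x v m :=
  deriv_const_mul_field _

lemma dDir_sub (hU : IsOpen U) (h : (x, v) ∈ U) (hF : SmoothOn U F) (hG : SmoothOn U G)
    (m : Fin 4) : dDir (fun y u => F y u - G y u) x v m = dDir F x v m - dDir G x v m :=
  ((hF.hasDerivAt_dDir hU h m).sub (hG.hasDerivAt_dDir hU h m)).deriv

lemma dDir_mul (hU : IsOpen U) (h : (x, v) ∈ U) (hF : SmoothOn U F) (hG : SmoothOn U G)
    (m : Fin 4) : dDir (fun y u => F y u * G y u) x v m
      = dDir F x v m * G x v + F x v * dDir G x v m := by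
  simpa using! ((hF.hasDerivAt_dDir hU h m).mul (hG.hasDerivAt_dDir hU h m)).deriv

lemma dDir_sum {ι : Type*} [Fintype ι] (hU : IsOpen U) (h : (x, v) ∈ U) {F : ι → E4 → E4 → ℝ}
    (hF : ∀ i, SmoothOn U (F i)) (m : Fin 4) :
    dDir (fun y u => ∑ i, F i y u) x v m = ∑ i, dDir (F i) x v m :=
  (HasDerivAt.fun_sum fun i _ => (hF i).hasDerivAt_dDir hU h m).deriv

lemma dDir_coord (x v : E4) (k m : Fin 4) :
    dDir (fun _ u => u k) x v m = if k = m then 1 else 0 :=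
  (hasDerivAt_coord_add_smul v k m).deriv

lemma dPos_sum_mul_coord (hU : IsOpen U) (h : (x, v) ∈ U) {F : Fin 4 → E4 → E4 → ℝ}
    (hF : ∀ i, SmoothOn U (F i)) (m : Fin 4) :
    dPos (fun y u => ∑ i, F i y u * u i) x v m = ∑ i, dPos (F i) x v m * v i :=
  (HasDerivAt.fun_sum fun i _ => ((hF i).hasDerivAt_dPos hU h m).mul_const (v i)).deriv

lemma dDir_sum_mul_coord (hU : IsOpen U) (h : (x, v) ∈ U) {F : Fin 4 → E4 → E4 → ℝ}
    (hF : ∀ i, SmoothOn U (F i)) (m : Fin 4) :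
    dDir (fun y u => ∑ i, F i y u * u i) x v m
      = ∑ i, dDir (F i) x v m * v i + F m x v := by
  rw [dDir_sum hU h fun i => (hF i).mul (smoothOn_coord U i)]
  simp only [dDir_mul hU h (hF _) (smoothOn_coord U _), dDir_coord, Finset.sum_add_distrib]
  simp

end Rules

end LocalFinsler

/-! ### The Chern connection of a homogeneous function -/

namespace LocalFinsler

/-- A Finsler function read in a chart: `ℓ` is smooth with nondegenerate fundamental tensor on the
open set `U`, but positively homogeneous of degree two only on the open set `A ⊆ U`. By continuity
the identities coming from homogeneity extend from `A` to `U ∩ closure A`, which contains the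
lightlike directions. -/
structure IsChartFinsler (ℓ : E4 → E4 → ℝ) (U A : Set (E4 × E4)) : Prop where
  isOpen_dom : IsOpen U
  isOpen_cone : IsOpen A
  subset : A ⊆ U
  smooth : SmoothOn U ℓ
  nondeg : ∀ x v, (x, v) ∈ U → (metric ℓ x v).det ≠ 0
  homogeneous : ∀ x v, (x, v) ∈ A → ∀ r : ℝ, 0 < r → ℓ x (r • v) = r ^ 2 * ℓ x v

/-- The formal Christoffel symbols `γ_ljk = g_li γ^i_jk` with the first index lowered. -/
def lowChristoffel (ℓ : E4 → E4 → ℝ) (x v : E4) (l j k : Fin 4) : ℝ :=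
  (1 / 2) * (dPos (metric ℓ · · l k) x v j + dPos (metric ℓ · · j l) x v k
    - dPos (metric ℓ · · j k) x v l)

/-- The quadratic expression `Γ^i_jk v^k v^j`; geodesics satisfy `x'' + spray x x' = 0`. -/
def spray (ℓ : E4 → E4 → ℝ) (x v : E4) (i : Fin 4) : ℝ :=
  ∑ j, (∑ k, christoffel ℓ x v i j k * v k) * v j

/-- The quadratic expression `γ^i_jk v^k v^j` in the formal Christoffel symbols. -/
def formalSpray (ℓ : E4 → E4 → ℝ) (x v : E4) (i : Fin 4) : ℝ :=
  ∑ j, (∑ k, formalChristoffel ℓ x v i j k * v k) * v j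

/-- The derivative of `ℓ` along the geodesic flow. -/
def flowDeriv (ℓ : E4 → E4 → ℝ) (x v : E4) : ℝ :=
  ∑ j, dPos ℓ x v j * v j - ∑ l, dDir ℓ x v l * spray ℓ x v l

lemma metric_eq (ℓ : E4 → E4 → ℝ) (x v : E4) (i j : Fin 4) :
    metric ℓ x v i j = (1 / 2) * dDir (dDir ℓ · · i) x v j :=
  fundTensor_eq_lineDeriv _ _ _ _

lemma cartan_eq (ℓ : E4 → E4 → ℝ) (x v : E4) (i j k : Fin 4) :
    cartan ℓ x v i j k = (1 / 2) * dDir (metric ℓ · · i j) x v k := by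
  have hC : cartan ℓ x v i j k = (1 / 4) * dDir (fun y u => dDir (dDir ℓ · · i) y u j) x v k :=
    cartanTensor_eq_lineDeriv _ _ _ _ _
  simp only [hC, metric_eq, dDir_const_mul]
  ring

lemma formalChristoffel_eq (ℓ : E4 → E4 → ℝ) (x v : E4) (i j k : Fin 4) :
    formalChristoffel ℓ x v i j k = ∑ l, (metric ℓ x v)⁻¹ i l * lowChristoffel ℓ x v l j k := by
  simp only [formalChristoffel, lowChristoffel, Finset.mul_sum, mul_left_comm]

lemma christoffel_eq (ℓ : E4 → E4 → ℝ) (x v : E4) (i j k : Fin 4) :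
    christoffel ℓ x v i j k = ∑ l, (metric ℓ x v)⁻¹ i l *
      ((1 / 2) * (dHor ℓ (metric ℓ · · l k) x v j + dHor ℓ (metric ℓ · · j l) x v k
        - dHor ℓ (metric ℓ · · j k) x v l)) := by
  simp only [christoffel, Finset.mul_sum, mul_left_comm]

lemma nonlinearConn_eq (ℓ : E4 → E4 → ℝ) (x v : E4) (i j : Fin 4) :
    nonlinearConn ℓ x v i j = ∑ k, formalChristoffel ℓ x v i j k * v k
      - ∑ l, (metric ℓ x v)⁻¹ i l * ∑ k, cartan ℓ x v l j k * formalSpray ℓ x v k := by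
  simp only [nonlinearConn, formalSpray, Finset.mul_sum, Finset.sum_mul, mul_assoc,
    mul_comm (v _) (v _)]

lemma sum_lowChristoffel_mul (ℓ : E4 → E4 → ℝ) (x v : E4) (l j : Fin 4) (w : E4) :
    ∑ k, lowChristoffel ℓ x v l j k * w k = (1 / 2) * (∑ k, dPos (metric ℓ · · l k) x v j * w k
      + ∑ k, dPos (metric ℓ · · j l) x v k * w k - ∑ k, dPos (metric ℓ · · j k) x v l * w k) := by
  simp only [lowChristoffel, mul_assoc, add_mul, sub_mul, ← Finset.mul_sum, Finset.sum_add_distrib,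
    Finset.sum_sub_distrib]

namespace IsChartFinsler

variable {ℓ : E4 → E4 → ℝ} {U A : Set (E4 × E4)} {x v : E4}

section Smoothness

lemma smooth_metric (H : IsChartFinsler ℓ U A) (i j : Fin 4) : SmoothOn U (metric ℓ · · i j) := by
  simp only [metric_eq]
  exact (smoothOn_dDir (smoothOn_dDir H.smooth H.isOpen_dom i) H.isOpen_dom j).const_mul _

lemma smooth_inv (H : IsChartFinsler ℓ U A) (i j : Fin 4) :
    SmoothOn U (fun x v => (metric ℓ x v)⁻¹ i j) :=
  contDiffOn_matrix_inv (f := fun p : E4 × E4 => metric ℓ p.1 p.2)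
    (fun i j => H.smooth_metric i j) (fun p hp => H.nondeg p.1 p.2 hp) i j

lemma smooth_formalChristoffel (H : IsChartFinsler ℓ U A) (i j k : Fin 4) :
    SmoothOn U (formalChristoffel ℓ · · i j k) := by
  have hdPos (a b c : Fin 4) := smoothOn_dPos (H.smooth_metric a b) H.isOpen_dom c
  exact SmoothOn.const_mul _ (SmoothOn.sum fun l => (H.smooth_inv i l).mul
    (((hdPos l k j).add (hdPos j l k)).sub (hdPos j k l)))

lemma smooth_nonlinearConn (H : IsChartFinsler ℓ U A) (i j : Fin 4) :
    SmoothOn U (nonlinearConn ℓ · · i j) := by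
  have hC (l k : Fin 4) : SmoothOn U (cartan ℓ · · l j k) := by
    simp only [cartan_eq]
    exact (smoothOn_dDir (H.smooth_metric l j) H.isOpen_dom k).const_mul _
  exact (SmoothOn.sum fun k => (H.smooth_formalChristoffel i j k).mul (smoothOn_coord U k)).sub
    (SmoothOn.sum fun l => SmoothOn.sum fun k => SmoothOn.sum fun r => SmoothOn.sum fun s =>
      ((((H.smooth_inv i l).mul (hC l k)).mul (H.smooth_formalChristoffel k r s)).mul
        (smoothOn_coord U r)).mul (smoothOn_coord U s))

lemma smooth_dHor (H : IsChartFinsler ℓ U A) {F : E4 → E4 → ℝ} (hF : SmoothOn U F) (j : Fin 4) :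
    SmoothOn U (dHor ℓ F · · j) :=
  (smoothOn_dPos hF H.isOpen_dom j).sub (SmoothOn.sum fun m =>
    (H.smooth_nonlinearConn m j).mul (smoothOn_dDir hF H.isOpen_dom m))

lemma smooth_christoffel (H : IsChartFinsler ℓ U A) (i j k : Fin 4) :
    SmoothOn U (christoffel ℓ · · i j k) := by
  have hdHor (a b c : Fin 4) := H.smooth_dHor (H.smooth_metric a b) c
  exact SmoothOn.const_mul _ (SmoothOn.sum fun l => (H.smooth_inv i l).mul
    (((hdHor l k j).add (hdHor j l k)).sub (hdHor j k l)))

lemma smooth_sum_christoffel (H : IsChartFinsler ℓ U A) (i j : Fin 4) :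
    SmoothOn U (fun x v => ∑ k, christoffel ℓ x v i j k * v k) :=
  SmoothOn.sum fun k => (H.smooth_christoffel i j k).mul (smoothOn_coord U k)

lemma smooth_spray (H : IsChartFinsler ℓ U A) (i : Fin 4) : SmoothOn U (spray ℓ · · i) :=
  SmoothOn.sum fun j => (H.smooth_sum_christoffel i j).mul (smoothOn_coord U j)

lemma smooth_flowDeriv (H : IsChartFinsler ℓ U A) : SmoothOn U (flowDeriv ℓ) :=
  (SmoothOn.sum fun j => (smoothOn_dPos H.smooth H.isOpen_dom j).mul (smoothOn_coord U j)).sub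
    (SmoothOn.sum fun l => (smoothOn_dDir H.smooth H.isOpen_dom l).mul (H.smooth_spray l))

end Smoothness

section Symmetry

lemma metric_symm (H : IsChartFinsler ℓ U A) (h : (x, v) ∈ U) (i j : Fin 4) :
    metric ℓ x v i j = metric ℓ x v j i := by
  rw [metric_eq, metric_eq, dDir_dDir_comm H.smooth H.isOpen_dom h]

lemma dPos_metric_symm (H : IsChartFinsler ℓ U A) (h : (x, v) ∈ U) (l k j : Fin 4) :
    dPos (metric ℓ · · l k) x v j = dPos (metric ℓ · · k l) x v j :=
  dPos_congr H.isOpen_dom h (fun _ _ hyu => H.metric_symm hyu l k) j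

lemma dDir_metric_symm (H : IsChartFinsler ℓ U A) (h : (x, v) ∈ U) (l k m : Fin 4) :
    dDir (metric ℓ · · l k) x v m = dDir (metric ℓ · · k l) x v m :=
  dDir_congr H.isOpen_dom h (fun _ _ hyu => H.metric_symm hyu l k) m

lemma dDir_metric_comm (H : IsChartFinsler ℓ U A) (h : (x, v) ∈ U) (l k m : Fin 4) :
    dDir (metric ℓ · · l k) x v m = dDir (metric ℓ · · l m) x v k := by
  simp only [metric_eq, dDir_const_mul]
  rw [dDir_dDir_comm (smoothOn_dDir H.smooth H.isOpen_dom l) H.isOpen_dom h]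

lemma dHor_metric_symm (H : IsChartFinsler ℓ U A) (h : (x, v) ∈ U) (i j m : Fin 4) :
    dHor ℓ (metric ℓ · · i j) x v m = dHor ℓ (metric ℓ · · j i) x v m := by
  simp only [dHor, H.dPos_metric_symm h i j, H.dDir_metric_symm h i j]

lemma christoffel_symm (H : IsChartFinsler ℓ U A) (h : (x, v) ∈ U) (i j k : Fin 4) :
    christoffel ℓ x v i j k = christoffel ℓ x v i k j := by
  simp only [christoffel]
  congr! 3 with l
  rw [H.dHor_metric_symm h l k, H.dHor_metric_symm h j l, H.dHor_metric_symm h j k]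
  ring

end Symmetry

section LoweringIndices

lemma metric_mul_inv (H : IsChartFinsler ℓ U A) (h : (x, v) ∈ U) (l : Fin 4) (q : Fin 4 → ℝ) :
    ∑ i, metric ℓ x v l i * ∑ k, (metric ℓ x v)⁻¹ i k * q k = q l := by
  have hinv := Matrix.mul_nonsing_inv _ (isUnit_iff_ne_zero.2 (H.nondeg x v h))
  have hmul := congrFun (Matrix.mulVec_mulVec q (metric ℓ x v) (metric ℓ x v)⁻¹) l
  rwa [hinv, Matrix.one_mulVec] at hmul

lemma metric_injective (H : IsChartFinsler ℓ U A) (h : (x, v) ∈ U) {p q : Fin 4 → ℝ}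
    (hpq : ∀ l, ∑ i, metric ℓ x v l i * p i = ∑ i, metric ℓ x v l i * q i) : p = q :=
  Matrix.mulVec_injective_of_isUnit
    ((Matrix.isUnit_iff_isUnit_det _).2 (isUnit_iff_ne_zero.2 (H.nondeg x v h))) (funext hpq)

lemma metric_mul_formalChristoffel (H : IsChartFinsler ℓ U A) (h : (x, v) ∈ U) (l j k : Fin 4) :
    ∑ i, metric ℓ x v l i * formalChristoffel ℓ x v i j k = lowChristoffel ℓ x v l j k := by
  simp only [formalChristoffel_eq]
  exact H.metric_mul_inv h l _

lemma metric_mul_christoffel (H : IsChartFinsler ℓ U A) (h : (x, v) ∈ U) (l j k : Fin 4) :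
    ∑ i, metric ℓ x v l i * christoffel ℓ x v i j k =
      (1 / 2) * (dHor ℓ (metric ℓ · · l k) x v j + dHor ℓ (metric ℓ · · j l) x v k
        - dHor ℓ (metric ℓ · · j k) x v l) := by
  simp only [christoffel_eq]
  exact H.metric_mul_inv h l fun l => (1 / 2) * (dHor ℓ (metric ℓ · · l k) x v j
    + dHor ℓ (metric ℓ · · j l) x v k - dHor ℓ (metric ℓ · · j k) x v l)

lemma metric_mul_nonlinearConn (H : IsChartFinsler ℓ U A) (h : (x, v) ∈ U) (l j : Fin 4) :
    ∑ i, metric ℓ x v l i * nonlinearConn ℓ x v i j = ∑ k, lowChristoffel ℓ x v l j k * v k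
      - ∑ k, cartan ℓ x v l j k * formalSpray ℓ x v k := by
  simp only [nonlinearConn_eq, mul_sub, Finset.sum_sub_distrib]
  rw [H.metric_mul_inv h l fun l => ∑ k, cartan ℓ x v l j k * formalSpray ℓ x v k, sum_mul_sum_mul]
  simp only [H.metric_mul_formalChristoffel h]

lemma metric_mul_formalSpray (H : IsChartFinsler ℓ U A) (h : (x, v) ∈ U) (l : Fin 4) :
    ∑ i, metric ℓ x v l i * formalSpray ℓ x v i
      = ∑ j, (∑ k, lowChristoffel ℓ x v l j k * v k) * v j := by
  simp only [formalSpray, sum_mul_sum_mul, H.metric_mul_formalChristoffel h]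

end LoweringIndices

section Euler

lemma euler (H : IsChartFinsler ℓ U A) (h : (x, v) ∈ A) : ∑ k, dDir ℓ x v k * v k = 2 * ℓ x v := by
  have hchain : HasDerivAt (fun r : ℝ => ℓ x (r • v))
      (∑ m, dPos ℓ x ((1 : ℝ) • v) m * (0 : E4) m + ∑ m, dDir ℓ x ((1 : ℝ) • v) m * v m) 1 := by
    refine H.smooth.hasDerivAt_comp H.isOpen_dom (y := fun _ => x) (u := fun r : ℝ => r • v)
      (by simpa only [one_smul] using H.subset h) (hasDerivAt_const _ _) ?_
    simpa using (hasDerivAt_id (1 : ℝ)).smul_const v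
  have hpow : HasDerivAt (fun r : ℝ => ℓ x (r • v)) (2 * ℓ x v) 1 := by
    have hsq : HasDerivAt (fun r : ℝ => r ^ 2 * ℓ x v) (2 * ℓ x v) 1 := by
      simpa using (hasDerivAt_pow 2 (1 : ℝ)).mul_const (ℓ x v)
    refine hsq.congr_of_eventuallyEq ?_
    filter_upwards [lt_mem_nhds (zero_lt_one (α := ℝ))] with r hr using H.homogeneous x v h r hr
  simpa using hchain.unique hpow

lemma euler_dDir (H : IsChartFinsler ℓ U A) (h : (x, v) ∈ A) (i : Fin 4) :
    ∑ k, dDir (dDir ℓ · · i) x v k * v k = dDir ℓ x v i := by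
  have hd := dDir_congr H.isOpen_cone h (fun y u hyu => H.euler hyu) i
  rw [dDir_sum_mul_coord H.isOpen_dom (H.subset h) (smoothOn_dDir H.smooth H.isOpen_dom),
    dDir_const_mul] at hd
  simp only [dDir_dDir_comm H.smooth H.isOpen_dom (H.subset h) _ i] at hd
  linarith

lemma euler_dPos (H : IsChartFinsler ℓ U A) (h : (x, v) ∈ A) (l : Fin 4) :
    ∑ k, dPos (dDir ℓ · · k) x v l * v k = 2 * dPos ℓ x v l := by
  rw [← dPos_sum_mul_coord H.isOpen_dom (H.subset h) (smoothOn_dDir H.smooth H.isOpen_dom),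
    ← dPos_const_mul]
  exact dPos_congr H.isOpen_cone h (fun y u hyu => H.euler hyu) l

lemma metric_mul_self_of_cone (H : IsChartFinsler ℓ U A) (h : (x, v) ∈ A) (l : Fin 4) :
    ∑ k, metric ℓ x v l k * v k = (1 / 2) * dDir ℓ x v l := by
  simp only [metric_eq, mul_assoc, ← Finset.mul_sum, H.euler_dDir h]

lemma dPos_metric_mul_self (H : IsChartFinsler ℓ U A) (h : (x, v) ∈ A) (l j : Fin 4) :
    ∑ k, dPos (metric ℓ · · l k) x v j * v k = (1 / 2) * dPos (dDir ℓ · · l) x v j := by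
  rw [← dPos_sum_mul_coord H.isOpen_dom (H.subset h) (H.smooth_metric l), ← dPos_const_mul]
  exact dPos_congr H.isOpen_cone h (fun y u hyu => H.metric_mul_self_of_cone hyu l) j

lemma dDir_metric_mul_self (H : IsChartFinsler ℓ U A) (h : (x, v) ∈ A) (l m : Fin 4) :
    ∑ k, dDir (metric ℓ · · l k) x v m * v k = 0 := by
  have hd := dDir_congr H.isOpen_cone h (fun y u hyu => H.metric_mul_self_of_cone hyu l) m
  rw [dDir_sum_mul_coord H.isOpen_dom (H.subset h) (H.smooth_metric l), dDir_const_mul,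
    metric_eq] at hd
  linarith

lemma cartan_mul_self (H : IsChartFinsler ℓ U A) (h : (x, v) ∈ A) (l k : Fin 4) :
    ∑ j, cartan ℓ x v l j k * v j = 0 := by
  simp only [cartan_eq, mul_assoc, ← Finset.mul_sum, H.dDir_metric_mul_self h, mul_zero]

end Euler

section Cone

lemma sum_lowChristoffel_mul_self (H : IsChartFinsler ℓ U A) (h : (x, v) ∈ A) (l j : Fin 4) :
    ∑ k, lowChristoffel ℓ x v l j k * v k = (1 / 2) * ((1 / 2) * dPos (dDir ℓ · · l) x v j
      + ∑ k, dPos (metric ℓ · · j l) x v k * v k - (1 / 2) * dPos (dDir ℓ · · j) x v l) := by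
  rw [sum_lowChristoffel_mul, H.dPos_metric_mul_self h, H.dPos_metric_mul_self h]

lemma nonlinearConn_mul_self (H : IsChartFinsler ℓ U A) (h : (x, v) ∈ A) (i : Fin 4) :
    ∑ j, nonlinearConn ℓ x v i j * v j = formalSpray ℓ x v i := by
  refine congrFun (H.metric_injective (H.subset h) (p := fun i =>
    ∑ j, nonlinearConn ℓ x v i j * v j) fun l => ?_) i
  have hcartan : ∑ j, (∑ k, cartan ℓ x v l j k * formalSpray ℓ x v k) * v j = 0 := by
    simp only [Finset.sum_mul, mul_right_comm _ (formalSpray ℓ x v _)]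
    rw [Finset.sum_comm]
    simp only [← Finset.sum_mul, H.cartan_mul_self h, zero_mul, Finset.sum_const_zero]
  simp only [sum_mul_sum_mul, H.metric_mul_nonlinearConn (H.subset h), sub_mul,
    Finset.sum_sub_distrib, hcartan, sub_zero, H.metric_mul_formalSpray (H.subset h)]

lemma sum_dHor_metric_mul_self (H : IsChartFinsler ℓ U A) (h : (x, v) ∈ A) (l j : Fin 4) :
    ∑ k, dHor ℓ (metric ℓ · · l k) x v j * v k = ∑ k, dPos (metric ℓ · · l k) x v j * v k := by
  simp only [dHor, sub_mul, Finset.sum_sub_distrib, sub_eq_self, Finset.sum_mul, mul_assoc]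
  rw [Finset.sum_comm]
  simp only [← Finset.mul_sum, H.dDir_metric_mul_self h, mul_zero, Finset.sum_const_zero]

lemma sum_dHor_metric_dir (H : IsChartFinsler ℓ U A) (h : (x, v) ∈ A) (l j : Fin 4) :
    ∑ k, dHor ℓ (metric ℓ · · j l) x v k * v k = ∑ k, dPos (metric ℓ · · j l) x v k * v k
      - 2 * ∑ k, cartan ℓ x v l j k * formalSpray ℓ x v k := by
  have hvertical : ∑ k, (∑ m, nonlinearConn ℓ x v m k * dDir (metric ℓ · · j l) x v m) * v k
      = ∑ m, dDir (metric ℓ · · j l) x v m * formalSpray ℓ x v m := by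
    simp only [← H.nonlinearConn_mul_self h, sum_mul_sum_mul, mul_comm _ (dDir _ _ _ _)]
  simp only [dHor, sub_mul, Finset.sum_sub_distrib, hvertical, cartan_eq,
    H.dDir_metric_symm (H.subset h) l j, mul_assoc, ← Finset.mul_sum]
  ring

lemma christoffel_mul_self_of_cone (H : IsChartFinsler ℓ U A) (h : (x, v) ∈ A) (i j : Fin 4) :
    ∑ k, christoffel ℓ x v i j k * v k = nonlinearConn ℓ x v i j := by
  refine congrFun (H.metric_injective (H.subset h) (p := fun i =>
    ∑ k, christoffel ℓ x v i j k * v k) (q := (nonlinearConn ℓ x v · j)) fun l => ?_) i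
  simp only [sum_mul_sum_mul, H.metric_mul_christoffel (H.subset h),
    H.metric_mul_nonlinearConn (H.subset h), sum_lowChristoffel_mul, mul_assoc, ← Finset.mul_sum,
    add_mul, sub_mul, Finset.sum_add_distrib, Finset.sum_sub_distrib,
    H.sum_dHor_metric_mul_self h, H.sum_dHor_metric_dir h]
  ring

lemma spray_eq_formalSpray (H : IsChartFinsler ℓ U A) (h : (x, v) ∈ A) (i : Fin 4) :
    spray ℓ x v i = formalSpray ℓ x v i := by
  simp only [← H.nonlinearConn_mul_self h, spray, H.christoffel_mul_self_of_cone h]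

lemma metric_mul_spray_of_cone (H : IsChartFinsler ℓ U A) (h : (x, v) ∈ A) (l : Fin 4) :
    ∑ i, metric ℓ x v l i * spray ℓ x v i
      = (1 / 2) * (∑ j, dPos (dDir ℓ · · l) x v j * v j - dPos ℓ x v l) := by
  have hdiag : ∑ j, (∑ k, dPos (metric ℓ · · j l) x v k * v k) * v j
      = (1 / 2) * ∑ k, dPos (dDir ℓ · · l) x v k * v k := by
    rw [Finset.sum_congr rfl fun j _ => mul_comm _ (v j), sum_mul_sum_mul]
    simp only [mul_comm (v _), H.dPos_metric_symm (H.subset h) _ l, H.dPos_metric_mul_self h,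
      mul_assoc, ← Finset.mul_sum]
  simp only [H.spray_eq_formalSpray h, H.metric_mul_formalSpray (H.subset h),
    H.sum_lowChristoffel_mul_self h, mul_assoc, add_mul, sub_mul, ← Finset.mul_sum,
    Finset.sum_add_distrib, Finset.sum_sub_distrib, hdiag, H.euler_dPos h]
  ring

lemma dDir_spray_of_cone (H : IsChartFinsler ℓ U A) (h : (x, v) ∈ A) (i m : Fin 4) :
    dDir (spray ℓ · · i) x v m = 2 * nonlinearConn ℓ x v i m := by
  have hU := H.subset h
  refine congrFun (H.metric_injective hU (p := fun i => dDir (spray ℓ · · i) x v m)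
    (q := fun i => 2 * nonlinearConn ℓ x v i m) fun l => ?_) i
  have hsmooth (j : Fin 4) : SmoothOn U (dPos (dDir ℓ · · l) · · j) :=
    smoothOn_dPos (smoothOn_dDir H.smooth H.isOpen_dom l) H.isOpen_dom j
  have hd := dDir_congr H.isOpen_cone h (fun y u hyu => H.metric_mul_spray_of_cone hyu l) m
  rw [dDir_sum H.isOpen_dom hU fun i => (H.smooth_metric l i).mul (H.smooth_spray i),
    dDir_const_mul, dDir_sub H.isOpen_dom hU
      (SmoothOn.sum fun j => (hsmooth j).mul (smoothOn_coord U j))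
      (smoothOn_dPos H.smooth H.isOpen_dom l),
    dDir_sum_mul_coord H.isOpen_dom hU hsmooth, dDir_dPos_comm H.smooth H.isOpen_dom hU] at hd
  simp only [dDir_mul H.isOpen_dom hU (H.smooth_metric l _) (H.smooth_spray _),
    Finset.sum_add_distrib,
    dDir_dPos_comm (smoothOn_dDir H.smooth H.isOpen_dom l) H.isOpen_dom hU] at hd
  have hdg (k : Fin 4) : dPos (fun y u => dDir (dDir ℓ · · l) y u m) x v k
      = 2 * dPos (metric ℓ · · m l) x v k := by
    rw [H.dPos_metric_symm hU m l]
    simp only [metric_eq, dPos_const_mul]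
    ring
  have hcartan : ∑ k, cartan ℓ x v l m k * formalSpray ℓ x v k
      = (1 / 2) * ∑ k, dDir (metric ℓ · · l k) x v m * spray ℓ x v k := by
    simp only [cartan_eq, H.dDir_metric_comm hU l m, H.spray_eq_formalSpray h, mul_assoc,
      Finset.mul_sum]
  simp only [mul_left_comm _ (2 : ℝ), ← Finset.mul_sum, H.metric_mul_nonlinearConn hU,
    H.sum_lowChristoffel_mul_self h, hcartan]
  simp only [hdg, mul_assoc, ← Finset.mul_sum] at hd
  linarith

lemma dDir_spray (H : IsChartFinsler ℓ U A) (h : (x, v) ∈ U) (i m : Fin 4) :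
    dDir (spray ℓ · · i) x v m
      = ∑ j, (∑ k, dDir (christoffel ℓ · · i j k) x v m * v k) * v j
        + 2 * ∑ k, christoffel ℓ x v i m k * v k := by
  simp only [spray]
  rw [dDir_sum_mul_coord H.isOpen_dom h (H.smooth_sum_christoffel i), two_mul, ← add_assoc]
  simp only [dDir_sum_mul_coord H.isOpen_dom h (H.smooth_christoffel i _), add_mul,
    Finset.sum_add_distrib, H.christoffel_symm h i m]

lemma vertical_christoffel_of_cone (H : IsChartFinsler ℓ U A) (h : (x, v) ∈ A) (i m : Fin 4) :
    ∑ j, (∑ k, dDir (christoffel ℓ · · i j k) x v m * v k) * v j = 0 := by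
  have hd := H.dDir_spray (H.subset h) i m
  rw [H.dDir_spray_of_cone h, H.christoffel_mul_self_of_cone h] at hd
  linarith

lemma flowDeriv_eq_zero_of_cone (H : IsChartFinsler ℓ U A) (h : (x, v) ∈ A) :
    flowDeriv ℓ x v = 0 := by
  have hspray : ∑ l, dDir ℓ x v l * spray ℓ x v l
      = 2 * ∑ l, v l * ∑ k, metric ℓ x v l k * spray ℓ x v k := by
    have hdDir (k : Fin 4) : dDir ℓ x v k = 2 * ∑ l, v l * metric ℓ x v l k := by
      simp only [mul_comm (v _), H.metric_symm (H.subset h) _ k, H.metric_mul_self_of_cone h]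
      ring
    rw [sum_mul_sum_mul v fun l k => metric ℓ x v l k]
    simp only [hdDir, mul_assoc, ← Finset.mul_sum]
  have hmixed : ∑ l, v l * ∑ j, dPos (dDir ℓ · · l) x v j * v j
      = 2 * ∑ j, dPos ℓ x v j * v j := by
    rw [sum_mul_sum_mul]
    simp only [mul_comm (v _) (dPos _ _ _ _), H.euler_dPos h, mul_assoc, ← Finset.mul_sum]
  simp only [flowDeriv, hspray, H.metric_mul_spray_of_cone h, mul_left_comm _ (1 / 2 : ℝ), mul_sub,
    Finset.sum_sub_distrib, ← Finset.mul_sum, hmixed, mul_comm (v _) (dPos _ _ _ _)]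
  ring

end Cone

section Closure

lemma christoffel_mul_self (H : IsChartFinsler ℓ U A) (h : (x, v) ∈ U ∩ closure A)
    (i j : Fin 4) : ∑ k, christoffel ℓ x v i j k * v k = nonlinearConn ℓ x v i j :=
  sub_eq_zero.1 (((H.smooth_sum_christoffel i j).sub
    (H.smooth_nonlinearConn i j)).eq_zero_of_closure H.isOpen_dom
      (fun _ _ hyu => sub_eq_zero.2 (H.christoffel_mul_self_of_cone hyu i j)) h)

lemma vertical_christoffel (H : IsChartFinsler ℓ U A) (h : (x, v) ∈ U ∩ closure A)
    (i m : Fin 4) : ∑ j, (∑ k, dDir (christoffel ℓ · · i j k) x v m * v k) * v j = 0 := by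
  have hsmooth : SmoothOn U fun x v =>
      ∑ j, (∑ k, dDir (christoffel ℓ · · i j k) x v m * v k) * v j :=
    SmoothOn.sum fun j => (SmoothOn.sum fun k =>
      (smoothOn_dDir (H.smooth_christoffel i j k) H.isOpen_dom m).mul (smoothOn_coord U k)).mul
        (smoothOn_coord U j)
  exact hsmooth.eq_zero_of_closure H.isOpen_dom
    (fun _ _ hyu => H.vertical_christoffel_of_cone hyu i m) h

lemma metric_mul_spray (H : IsChartFinsler ℓ U A) (h : (x, v) ∈ U ∩ closure A) (l : Fin 4) :
    ∑ i, metric ℓ x v l i * spray ℓ x v i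
      = (1 / 2) * (∑ j, dPos (dDir ℓ · · l) x v j * v j - dPos ℓ x v l) := by
  have hleft : SmoothOn U fun x v => ∑ i, metric ℓ x v l i * spray ℓ x v i :=
    SmoothOn.sum fun k => (H.smooth_metric l k).mul (H.smooth_spray k)
  have hright : SmoothOn U fun x v => (1 / 2) *
      (∑ j, dPos (dDir ℓ · · l) x v j * v j - dPos ℓ x v l) :=
    SmoothOn.const_mul _ ((SmoothOn.sum fun j =>
      (smoothOn_dPos (smoothOn_dDir H.smooth H.isOpen_dom l) H.isOpen_dom j).mul
        (smoothOn_coord U j)).sub (smoothOn_dPos H.smooth H.isOpen_dom l))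
  exact sub_eq_zero.1 ((hleft.sub hright).eq_zero_of_closure H.isOpen_dom
    (fun _ _ hyu => sub_eq_zero.2 (H.metric_mul_spray_of_cone hyu l)) h)

lemma metric_mul_self (H : IsChartFinsler ℓ U A) (h : (x, v) ∈ U ∩ closure A) (l : Fin 4) :
    ∑ k, metric ℓ x v l k * v k = (1 / 2) * dDir ℓ x v l := by
  have hleft : SmoothOn U fun x v => ∑ k, metric ℓ x v l k * v k :=
    SmoothOn.sum fun k => (H.smooth_metric l k).mul (smoothOn_coord U k)
  exact sub_eq_zero.1 ((hleft.sub
    (SmoothOn.const_mul _ (smoothOn_dDir H.smooth H.isOpen_dom l))).eq_zero_of_closure H.isOpen_dom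
      (fun _ _ hyu => sub_eq_zero.2 (H.metric_mul_self_of_cone hyu l)) h)

lemma fderiv_flowDeriv (H : IsChartFinsler ℓ U A) (h : (x, v) ∈ U ∩ closure A) (w : E4 × E4) :
    fderiv ℝ (Function.uncurry (flowDeriv ℓ)) (x, v) w = 0 :=
  H.smooth_flowDeriv.fderiv_eq_zero_of_closure H.isOpen_dom H.isOpen_cone
    (fun _ _ hyu => H.flowDeriv_eq_zero_of_cone hyu) h w

end Closure

end IsChartFinsler

end LocalFinsler

/-! ### Jacobi fields as linearized geodesics -/

section Curves

variable {V : Type*} [NormedAddCommGroup V] [NormedSpace ℝ V]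

lemma hasDerivAt_euclidean {f : ℝ → E4} {f' : E4} {s : ℝ} :
    HasDerivAt f f' s ↔ ∀ i, HasDerivAt (fun r => f r i) (f' i) s :=
  ⟨fun h i => (EuclideanSpace.proj i : E4 →L[ℝ] ℝ).hasFDerivAt.comp_hasDerivAt s h, fun h =>
    (EuclideanSpace.equiv (Fin 4) ℝ).symm.toContinuousLinearMap.hasFDerivAt.comp_hasDerivAt s
      (f := fun r i => f r i) (f' := fun i => f' i) (hasDerivAt_pi.2 h)⟩

lemma eventually_hasDerivAt_of_smooth {f : ℝ → V} {s : ℝ} (hf : ContDiffAt ℝ ∞ f s) :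
    ∀ᶠ r in 𝓝 s, HasDerivAt f (deriv f r) r := by
  filter_upwards [(hf.of_le (m := 1) (by simp)).eventually (by simp)] with r hr
  exact (hr.differentiableAt (by simp)).hasDerivAt

lemma hasDerivAt_of_smooth {f : ℝ → V} {s : ℝ} (hf : ContDiffAt ℝ ∞ f s) :
    HasDerivAt f (deriv f s) s :=
  (hf.differentiableAt (by simp)).hasDerivAt

lemma contDiffAt_deriv_of_smooth {f : ℝ → V} {s : ℝ} (hf : ContDiffAt ℝ ∞ f s) :
    ContDiffAt ℝ ∞ (deriv f) s :=
  (hf.fderiv_right (m := ∞) (by simp)).clm_apply (contDiffAt_const (c := (1 : ℝ)))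

lemma hasDerivAt_deriv_of_smooth {f : ℝ → V} {s : ℝ} (hf : ContDiffAt ℝ ∞ f s) :
    HasDerivAt (deriv f) (deriv (deriv f) s) s :=
  hasDerivAt_of_smooth (contDiffAt_deriv_of_smooth hf)

lemma hasDerivAt_fderiv_of_invariant {f : V → ℝ} {T : V → V} {T' : V →L[ℝ] V} {c Y : ℝ → V}
    {s : ℝ} (hf : ContDiffAt ℝ 2 f (c s)) (hT : HasFDerivAt T T' (c s))
    (hc : HasDerivAt c (T (c s)) s) (hY : HasDerivAt Y (T' (Y s)) s)
    (h0 : fderiv ℝ (fun q => fderiv ℝ f q (T q)) (c s) (Y s) = 0) :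
    HasDerivAt (fun r => fderiv ℝ f (c r) (Y r)) 0 s := by
  have hdf : HasFDerivAt (fderiv ℝ f) (fderiv ℝ (fderiv ℝ f) (c s)) (c s) :=
    ((hf.fderiv_right (m := 1) (by norm_cast)).differentiableAt (by simp)).hasFDerivAt
  have hsymm : IsSymmSndFDerivAt ℝ f (c s) := hf.isSymmSndFDerivAt (by simp)
  rw [(hdf.clm_apply hT).fderiv] at h0
  refine ((hdf.comp_hasDerivAt s hc).clm_apply hY).congr_deriv ?_
  rw [← h0, hsymm.eq]
  simp [add_comm]

end Curves

namespace LocalFinsler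

/-- The matrix `Γ^i_jk v^k`. It is defined without homogeneity, and equals the nonlinear
connection where `ℓ` is homogeneous. -/
def conn (ℓ : E4 → E4 → ℝ) (x v : E4) (i j : Fin 4) : ℝ := ∑ k, christoffel ℓ x v i j k * v k

/-- The vector with the components `Γ^i_jk v^j v^k`, as a function of position and direction. -/
def sprayVec (ℓ : E4 → E4 → ℝ) (p : E4 × E4) : E4 := WithLp.toLp 2 (spray ℓ p.1 p.2)

lemma spray_eq_sum_conn (ℓ : E4 → E4 → ℝ) (x v : E4) (i : Fin 4) :
    spray ℓ x v i = ∑ j, conn ℓ x v i j * v j := rfl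

lemma covDeriv_velocity (ℓ : E4 → E4 → ℝ) (x : ℝ → E4) (s : ℝ) :
    covDeriv ℓ x (deriv x) (deriv x) s = deriv (deriv x) s + sprayVec ℓ (x s, deriv x s) := by
  ext i
  simp only [covDeriv, sprayVec, spray, Finset.sum_mul, PiLp.add_apply]
  congr! 3
  ring

/-- The linearization of the geodesic equation `x'' + sprayVec ℓ (x, x') = 0` along `x`, for the
variation vector field `X`, at time `s`. -/
def LinearizedGeodesicEq (ℓ : E4 → E4 → ℝ) (x X : ℝ → E4) (s : ℝ) : Prop :=
  deriv (deriv X) s = -fderiv ℝ (sprayVec ℓ) (x s, deriv x s) (X s, deriv X s)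

namespace LinearizedGeodesicEq

variable {ℓ : E4 → E4 → ℝ} {x X Y : ℝ → E4} {s : ℝ}

lemma congr (h : LinearizedGeodesicEq ℓ x X s) (hXY : Y =ᶠ[𝓝 s] X) :
    LinearizedGeodesicEq ℓ x Y s := by
  rw [LinearizedGeodesicEq, hXY.deriv.deriv_eq, hXY.deriv_eq, hXY.eq_of_nhds]
  exact h

lemma add (hX : ContDiffAt ℝ ∞ X s) (hY : ContDiffAt ℝ ∞ Y s) (h : LinearizedGeodesicEq ℓ x X s)
    (h' : LinearizedGeodesicEq ℓ x Y s) : LinearizedGeodesicEq ℓ x (fun r => X r + Y r) s := by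
  have hderiv : deriv (fun r => X r + Y r) =ᶠ[𝓝 s] fun r => deriv X r + deriv Y r := by
    filter_upwards [eventually_hasDerivAt_of_smooth hX, eventually_hasDerivAt_of_smooth hY]
      with r hr hr' using (hr.add hr').deriv
  have hderiv2 : deriv (fun r => deriv X r + deriv Y r) s = deriv (deriv X) s + deriv (deriv Y) s :=
    ((hasDerivAt_deriv_of_smooth hX).add (hasDerivAt_deriv_of_smooth hY)).deriv
  rw [LinearizedGeodesicEq, hderiv.deriv_eq, hderiv.eq_of_nhds, hderiv2, h, h',
    ← Prod.mk_add_mk, map_add, neg_add]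

lemma const_smul (c : ℝ) (hX : ContDiffAt ℝ ∞ X s) (h : LinearizedGeodesicEq ℓ x X s) :
    LinearizedGeodesicEq ℓ x (fun r => c • X r) s := by
  have hderiv : deriv (fun r => c • X r) =ᶠ[𝓝 s] fun r => c • deriv X r :=
    (eventually_hasDerivAt_of_smooth hX).mono fun r hr => (hr.const_smul c).deriv
  have hderiv2 : deriv (fun r => c • deriv X r) s = c • deriv (deriv X) s :=
    ((hasDerivAt_deriv_of_smooth hX).const_smul c).deriv
  rw [LinearizedGeodesicEq, hderiv.deriv_eq, hderiv.eq_of_nhds, hderiv2, h, ← Prod.smul_mk,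
    map_smul, smul_neg]

end LinearizedGeodesicEq

namespace IsChartFinsler

variable {ℓ : E4 → E4 → ℝ} {U A : Set (E4 × E4)} {x X Y : ℝ → E4} {y v : E4} {s : ℝ}

section Curvature

lemma smooth_conn (H : IsChartFinsler ℓ U A) (i j : Fin 4) : SmoothOn U (conn ℓ · · i j) :=
  H.smooth_sum_christoffel i j

lemma sum_dPos_conn (H : IsChartFinsler ℓ U A) (h : (y, v) ∈ U) (i m : Fin 4) :
    ∑ j, dPos (conn ℓ · · i j) y v m * v j = dPos (spray ℓ · · i) y v m :=
  (dPos_sum_mul_coord H.isOpen_dom h (H.smooth_conn i) m).symm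

lemma dDir_conn (H : IsChartFinsler ℓ U A) (h : (y, v) ∈ U) (i j m : Fin 4) :
    dDir (conn ℓ · · i j) y v m
      = ∑ k, dDir (christoffel ℓ · · i j k) y v m * v k + christoffel ℓ y v i j m :=
  dDir_sum_mul_coord H.isOpen_dom h (H.smooth_christoffel i j) m

lemma sum_dHor_christoffel (H : IsChartFinsler ℓ U A) (h : (y, v) ∈ U ∩ closure A)
    (i k l : Fin 4) : ∑ j, dHor ℓ (christoffel ℓ · · i k j) y v l * v j
      = dPos (conn ℓ · · i k) y v l
        - ∑ m, conn ℓ y v m l * (∑ j, dDir (christoffel ℓ · · i k j) y v m * v j) := by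
  have hpos := dPos_sum_mul_coord H.isOpen_dom h.1 (H.smooth_christoffel i k) l
  simp only [dHor, sub_mul, Finset.sum_sub_distrib, ← hpos, ← H.christoffel_mul_self h,
    sum_mul_sum_mul, conn]

lemma sum_chernCurvature (H : IsChartFinsler ℓ U A) (h : (y, v) ∈ U ∩ closure A) (i k : Fin 4) :
    ∑ l, (∑ j, chernCurvature ℓ y v i j k l * v j) * v l
      = dPos (spray ℓ · · i) y v k
        - (∑ l, dPos (conn ℓ · · i k) y v l * v l
          - ∑ m, dDir (conn ℓ · · i k) y v m * spray ℓ y v m)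
        - ∑ m, conn ℓ y v i m * conn ℓ y v m k := by
  have hfirst : ∑ l, (∑ j, dHor ℓ (christoffel ℓ · · i l j) y v k * v j) * v l
      = dPos (spray ℓ · · i) y v k := by
    simp only [H.sum_dHor_christoffel h, sub_mul, Finset.sum_sub_distrib, H.sum_dPos_conn h.1,
      ← sum_mul_sum_mul (conn ℓ y v · k), H.vertical_christoffel h, mul_zero,
      Finset.sum_const_zero, sub_zero]
  have hsecond : ∑ l, (∑ j, dHor ℓ (christoffel ℓ · · i k j) y v l * v j) * v l
      = ∑ l, dPos (conn ℓ · · i k) y v l * v l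
        - ∑ m, (dDir (conn ℓ · · i k) y v m - christoffel ℓ y v i k m) * spray ℓ y v m := by
    simp only [H.sum_dHor_christoffel h, sub_mul, Finset.sum_sub_distrib, H.dDir_conn h.1,
      add_sub_cancel_right, mul_comm (conn ℓ y v _ _)]
    simp only [spray_eq_sum_conn, sum_mul_sum_mul]
  have hthird : ∑ l, (∑ j, (∑ m, christoffel ℓ y v i k m * christoffel ℓ y v m l j) * v j) * v l
      = ∑ m, christoffel ℓ y v i k m * spray ℓ y v m := by
    simp only [spray, sum_mul_sum_mul]
  have hfourth : ∑ l, (∑ j, (∑ m, christoffel ℓ y v i l m * christoffel ℓ y v m k j) * v j) * v l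
      = ∑ m, conn ℓ y v i m * conn ℓ y v m k := by
    have hconn (m : Fin 4) : conn ℓ y v i m = ∑ l, v l * christoffel ℓ y v i l m := by
      simp only [conn, H.christoffel_symm h.1 i m, mul_comm]
    simp only [hconn, ← sum_mul_sum_mul v]
    simp only [conn, sum_mul_sum_mul, mul_comm (v _)]
  simp only [chernCurvature, add_mul, sub_mul, Finset.sum_add_distrib, Finset.sum_sub_distrib]
    at hfirst hsecond hthird hfourth ⊢
  rw [hfirst, hsecond, hthird, hfourth]
  ring

lemma curvVec_apply (H : IsChartFinsler ℓ U A) (h : (y, v) ∈ U ∩ closure A) (X : E4) (i : Fin 4) :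
    curvVec ℓ y v X v v i = ∑ k, (dPos (spray ℓ · · i) y v k
        - (∑ l, dPos (conn ℓ · · i k) y v l * v l
          - ∑ m, dDir (conn ℓ · · i k) y v m * spray ℓ y v m)
        - ∑ m, conn ℓ y v i m * conn ℓ y v m k) * X k := by
  simp only [← H.sum_chernCurvature h, curvVec, Finset.sum_mul]
  rw [Finset.sum_comm]
  refine Finset.sum_congr rfl fun k _ => ?_
  rw [Finset.sum_comm]
  congr! 2
  ring

end Curvature

section JacobiEquation

lemma contDiffOn_sprayVec (H : IsChartFinsler ℓ U A) : ContDiffOn ℝ ∞ (sprayVec ℓ) U :=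
  contDiffOn_euclidean.2 fun i => H.smooth_spray i

lemma hasFDerivAt_sprayVec (H : IsChartFinsler ℓ U A) (h : (y, v) ∈ U) :
    HasFDerivAt (sprayVec ℓ) (fderiv ℝ (sprayVec ℓ) (y, v)) (y, v) :=
  ((H.contDiffOn_sprayVec.contDiffAt (H.isOpen_dom.mem_nhds h)).differentiableAt
    (by simp)).hasFDerivAt

lemma fderiv_sprayVec_apply (H : IsChartFinsler ℓ U A) (h : (y, v) ∈ U ∩ closure A) (X Y : E4)
    (i : Fin 4) : fderiv ℝ (sprayVec ℓ) (y, v) (X, Y) i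
      = ∑ m, dPos (spray ℓ · · i) y v m * X m + 2 * ∑ m, conn ℓ y v i m * Y m := by
  have hdir (m : Fin 4) : dDir (spray ℓ · · i) y v m = 2 * conn ℓ y v i m := by
    rw [H.dDir_spray h.1, H.vertical_christoffel h, zero_add]
    rfl
  have hproj : HasFDerivAt (Function.uncurry (spray ℓ · · i))
      ((EuclideanSpace.proj i : E4 →L[ℝ] ℝ).comp (fderiv ℝ (sprayVec ℓ) (y, v))) (y, v) :=
    (EuclideanSpace.proj i : E4 →L[ℝ] ℝ).hasFDerivAt.comp (y, v) (H.hasFDerivAt_sprayVec h.1)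
  have happly := (H.smooth_spray i).fderiv_apply H.isOpen_dom h.1 X Y
  simp only [hproj.fderiv, hdir, mul_assoc, ← Finset.mul_sum] at happly
  exact happly

lemma covDeriv_apply (H : IsChartFinsler ℓ U A) (h : (x s, deriv x s) ∈ U) (i : Fin 4) :
    covDeriv ℓ x (deriv x) X s i
      = deriv X s i + ∑ k, conn ℓ (x s) (deriv x s) i k * X s k := by
  simp only [covDeriv, conn, Finset.sum_mul]
  rw [Finset.sum_comm]
  simp only [H.christoffel_symm h i]

lemma covDeriv_covDeriv_apply (H : IsChartFinsler ℓ U A) (hx : ContDiffAt ℝ ∞ x s)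
    (hX : ContDiffAt ℝ ∞ X s) (h : (x s, deriv x s) ∈ U) (i : Fin 4) :
    covDeriv ℓ x (deriv x) (covDeriv ℓ x (deriv x) X) s i
      = deriv (deriv X) s i + 2 * ∑ k, conn ℓ (x s) (deriv x s) i k * deriv X s k
        + ∑ k, (∑ m, dPos (conn ℓ · · i k) (x s) (deriv x s) m * deriv x s m
          + ∑ m, dDir (conn ℓ · · i k) (x s) (deriv x s) m * deriv (deriv x) s m
          + ∑ m, conn ℓ (x s) (deriv x s) i m * conn ℓ (x s) (deriv x s) m k) * X s k := by
  have hlift : ∀ᶠ r in 𝓝 s, (x r, deriv x r) ∈ U :=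
    (hx.continuousAt.prodMk (contDiffAt_deriv_of_smooth hx).continuousAt) (H.isOpen_dom.mem_nhds h)
  have hD : HasDerivAt (covDeriv ℓ x (deriv x) X) (WithLp.toLp 2 fun i => deriv (deriv X) s i
      + ∑ k, ((∑ m, dPos (conn ℓ · · i k) (x s) (deriv x s) m * deriv x s m
          + ∑ m, dDir (conn ℓ · · i k) (x s) (deriv x s) m * deriv (deriv x) s m) * X s k
        + conn ℓ (x s) (deriv x s) i k * deriv X s k)) s := by
    refine hasDerivAt_euclidean.2 fun i => HasDerivAt.congr_of_eventuallyEq ?_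
      (hlift.mono fun r hr => H.covDeriv_apply hr i)
    exact (hasDerivAt_euclidean.1 (hasDerivAt_deriv_of_smooth hX) i).add
      (HasDerivAt.fun_sum fun k _ => ((H.smooth_conn i k).hasDerivAt_comp H.isOpen_dom h
        (hasDerivAt_of_smooth hx) (hasDerivAt_deriv_of_smooth hx)).mul
          (hasDerivAt_euclidean.1 (hasDerivAt_of_smooth hX) k))
  simp only [H.covDeriv_apply h, hD.deriv, mul_add, add_mul, Finset.sum_add_distrib,
    sum_mul_sum_mul]
  ring

lemma jacobi_iff (H : IsChartFinsler ℓ U A) (hx : ContDiffAt ℝ ∞ x s)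
    (hX : ContDiffAt ℝ ∞ X s) (h : (x s, deriv x s) ∈ U ∩ closure A)
    (hgeo : deriv (deriv x) s = -sprayVec ℓ (x s, deriv x s)) :
    covDeriv ℓ x (deriv x) (covDeriv ℓ x (deriv x) X) s
        = - curvVec ℓ (x s) (deriv x s) (X s) (deriv x s) (deriv x s) ↔
      LinearizedGeodesicEq ℓ x X s := by
  have key : covDeriv ℓ x (deriv x) (covDeriv ℓ x (deriv x) X) s
      + curvVec ℓ (x s) (deriv x s) (X s) (deriv x s) (deriv x s)
      = deriv (deriv X) s + fderiv ℝ (sprayVec ℓ) (x s, deriv x s) (X s, deriv X s) := by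
    ext i
    have ha (m : Fin 4) : deriv (deriv x) s m = - spray ℓ (x s) (deriv x s) m := by
      rw [hgeo, sprayVec, PiLp.neg_apply]
    simp only [PiLp.add_apply, H.covDeriv_covDeriv_apply hx hX h.1, H.curvVec_apply h,
      H.fderiv_sprayVec_apply h, ha, mul_neg, Finset.sum_neg_distrib, add_mul, sub_mul, neg_mul,
      Finset.sum_add_distrib, Finset.sum_sub_distrib]
    ring
  rw [LinearizedGeodesicEq, eq_neg_iff_add_eq_zero, eq_neg_iff_add_eq_zero, key]

end JacobiEquation

section Momentum

lemma hasDerivAt_dDir (H : IsChartFinsler ℓ U A) (hx : ContDiffAt ℝ ∞ x s)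
    (h : (x s, deriv x s) ∈ U ∩ closure A) (l : Fin 4) :
    HasDerivAt (fun r => dDir ℓ (x r) (deriv x r) l) (dPos ℓ (x s) (deriv x s) l
      + 2 * ∑ i, metric ℓ (x s) (deriv x s) l i
        * (deriv (deriv x) s i + spray ℓ (x s) (deriv x s) i)) s := by
  refine ((smoothOn_dDir H.smooth H.isOpen_dom l).hasDerivAt_comp H.isOpen_dom h.1
    (hasDerivAt_of_smooth hx) (hasDerivAt_deriv_of_smooth hx)).congr_deriv ?_
  simp only [mul_add, Finset.sum_add_distrib, H.metric_mul_spray h l]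
  simp only [metric_eq, mul_assoc, ← Finset.mul_sum]
  ring

lemma geodesic_of_euler_lagrange (H : IsChartFinsler ℓ U A) (hx : ContDiffAt ℝ ∞ x s)
    (h : (x s, deriv x s) ∈ U ∩ closure A)
    (hEL : ∀ l, deriv (fun r => dDir ℓ (x r) (deriv x r) l) s = dPos ℓ (x s) (deriv x s) l) :
    deriv (deriv x) s = -sprayVec ℓ (x s, deriv x s) := by
  have hzero : (fun i => deriv (deriv x) s i + spray ℓ (x s) (deriv x s) i) = 0 := by
    refine H.metric_injective h.1 fun l => ?_
    simp only [Pi.zero_apply, mul_zero, Finset.sum_const_zero]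
    linarith [hEL l, (H.hasDerivAt_dDir hx h l).deriv]
  ext i
  exact eq_neg_of_add_eq_zero_left (congrFun hzero i)

lemma hasDerivAt_momentum (H : IsChartFinsler ℓ U A) (hx : ContDiffAt ℝ ∞ x s)
    (hX : DifferentiableAt ℝ X s) (h : (x s, deriv x s) ∈ U ∩ closure A)
    (hgeo : deriv (deriv x) s = -sprayVec ℓ (x s, deriv x s)) :
    HasDerivAt (fun r => ∑ l, dDir ℓ (x r) (deriv x r) l * X r l)
      (fderiv ℝ (Function.uncurry ℓ) (x s, deriv x s) (X s, deriv X s)) s := by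
  rw [H.smooth.fderiv_apply H.isOpen_dom h.1, ← Finset.sum_add_distrib]
  refine HasDerivAt.fun_sum fun l _ => ((H.hasDerivAt_dDir hx h l).mul
    (hasDerivAt_euclidean.1 hX.hasDerivAt l)).congr_deriv ?_
  simp [hgeo, sprayVec]

lemma flowDeriv_eq_fderiv (H : IsChartFinsler ℓ U A) {p : E4 × E4} (h : p ∈ U) :
    Function.uncurry (flowDeriv ℓ) p
      = fderiv ℝ (Function.uncurry ℓ) p (p.2, -sprayVec ℓ p) := by
  rw [H.smooth.fderiv_apply H.isOpen_dom (x := p.1) (v := p.2) h]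
  simp [flowDeriv, sprayVec, Function.uncurry, sub_eq_add_neg]

/-- The reason is that `ℓ` is a first integral of the geodesic flow. -/
lemma hasDerivAt_fderiv_zero (H : IsChartFinsler ℓ U A) (hx : ContDiffAt ℝ ∞ x s)
    (hX : ContDiffAt ℝ ∞ X s) (h : (x s, deriv x s) ∈ U ∩ closure A)
    (hgeo : deriv (deriv x) s = -sprayVec ℓ (x s, deriv x s))
    (hJ : LinearizedGeodesicEq ℓ x X s) :
    HasDerivAt (fun r => fderiv ℝ (Function.uncurry ℓ) (x r, deriv x r) (X r, deriv X r)) 0 s := by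
  have hsmooth : ContDiffAt ℝ ∞ (Function.uncurry ℓ) (x s, deriv x s) :=
    H.smooth.contDiffAt (H.isOpen_dom.mem_nhds h.1)
  have hlift : HasDerivAt (fun r => (x r, deriv x r)) (deriv x s, deriv (deriv x) s) s :=
    (hasDerivAt_of_smooth hx).prodMk (hasDerivAt_deriv_of_smooth hx)
  have hfield : HasDerivAt (fun r => (X r, deriv X r)) (deriv X s, deriv (deriv X) s) s :=
    (hasDerivAt_of_smooth hX).prodMk (hasDerivAt_deriv_of_smooth hX)
  have hflow : Function.uncurry (flowDeriv ℓ) =ᶠ[𝓝 (x s, deriv x s)]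
      fun p : E4 × E4 => fderiv ℝ (Function.uncurry ℓ) p (p.2, -sprayVec ℓ p) := by
    filter_upwards [H.isOpen_dom.mem_nhds h.1] with p hp using H.flowDeriv_eq_fderiv hp
  rw [hgeo] at hlift
  rw [hJ] at hfield
  have hgeodesicField : HasFDerivAt (fun p : E4 × E4 => (p.2, -sprayVec ℓ p))
      ((ContinuousLinearMap.snd ℝ E4 E4).prod (-fderiv ℝ (sprayVec ℓ) (x s, deriv x s)))
      (x s, deriv x s) := hasFDerivAt_snd.prodMk (H.hasFDerivAt_sprayVec h.1).neg
  exact hasDerivAt_fderiv_of_invariant (hsmooth.of_le (by norm_cast)) hgeodesicField hlift hfield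
    (by rw [← hflow.fderiv_eq, H.fderiv_flowDeriv h])

end Momentum

lemma linearizedGeodesicEq_unique (H : IsChartFinsler ℓ U A) (hx : ContDiffAt ℝ ∞ x s)
    (hX : ContDiffAt ℝ ∞ X s) (hY : ContDiffAt ℝ ∞ Y s) (h : (x s, deriv x s) ∈ U)
    (hJX : ∀ᶠ r in 𝓝 s, LinearizedGeodesicEq ℓ x X r)
    (hJY : ∀ᶠ r in 𝓝 s, LinearizedGeodesicEq ℓ x Y r)
    (h0 : X s = Y s) (h1 : deriv X s = deriv Y s) : X =ᶠ[𝓝 s] Y := by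
  let B (r : ℝ) : (E4 × E4) →L[ℝ] (E4 × E4) :=
    (ContinuousLinearMap.snd ℝ E4 E4).prod (-fderiv ℝ (sprayVec ℓ) (x r, deriv x r))
  have hlift : ContinuousAt (fun r => (x r, deriv x r)) s :=
    hx.continuousAt.prodMk (contDiffAt_deriv_of_smooth hx).continuousAt
  have hS : ContinuousAt (fun r => fderiv ℝ (sprayVec ℓ) (x r, deriv x r)) s :=
    ContinuousAt.comp (f := fun r => (x r, deriv x r))
      ((H.contDiffOn_sprayVec.contDiffAt (H.isOpen_dom.mem_nhds h)).fderiv_right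
        (m := 0) (by simp)).continuousAt hlift
  have hB : ContinuousAt B s :=
    (ContinuousLinearMap.prodₗᵢ ℝ).continuous.continuousAt.comp (continuousAt_const.prodMk hS.neg)
  have hbound : ∀ᶠ r in 𝓝 s, ‖B r‖₊ < ‖B s‖₊ + 1 :=
    hB.nnnorm.tendsto.eventually_lt_const (lt_add_one _)
  have hsol {Z : ℝ → E4} (hZ : ContDiffAt ℝ ∞ Z s)
      (hJ : ∀ᶠ r in 𝓝 s, LinearizedGeodesicEq ℓ x Z r) :
      ∀ᶠ r in 𝓝 s, HasDerivAt (fun r => (Z r, deriv Z r)) (B r (Z r, deriv Z r)) r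
        ∧ (Z r, deriv Z r) ∈ Set.univ := by
    filter_upwards [eventually_hasDerivAt_of_smooth hZ,
      eventually_hasDerivAt_of_smooth (contDiffAt_deriv_of_smooth hZ), hJ] with r hr hr' hJr
    rw [hJr] at hr'
    exact ⟨hr.prodMk hr', Set.mem_univ _⟩
  have heq : (fun r => (X r, deriv X r)) =ᶠ[𝓝 s] fun r => (Y r, deriv Y r) :=
    ODE_solution_unique_of_eventually (v := fun r Y => B r Y) (s := fun _ => Set.univ)
      (hbound.mono fun r hr => ((B r).lipschitz.weaken hr.le).lipschitzOnWith) (hsol hX hJX)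
      (hsol hY hJY) (by rw [h0, h1])
  exact heq.mono fun r hr => congrArg Prod.fst hr

end IsChartFinsler

end LocalFinsler

/-! ### Lifts to tangent bundles -/

section TangentMaps

variable {M N : Type*} [TopologicalSpace M] [ChartedSpace E4 M] [TopologicalSpace N]
  [ChartedSpace E4 N]

/-- The lift to tangent bundles of a map from `ℝ⁴`, with `Tℝ⁴` read as `ℝ⁴ × ℝ⁴`. -/
def liftFrom (Φ : E4 → M) (p : E4 × E4) : TangentBundle (𝓡 4) M :=
  ⟨Φ p.1, mfderiv (𝓡 4) (𝓡 4) Φ p.1 p.2⟩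

/-- The lift to tangent bundles of a map to `ℝ⁴`, with `Tℝ⁴` read as `ℝ⁴ × ℝ⁴`. -/
def liftTo (e : M → E4) (z : TangentBundle (𝓡 4) M) : E4 × E4 :=
  (e z.1, mfderiv (𝓡 4) (𝓡 4) e z.1 z.2)

lemma tangentBundle_ext {q q' : M} {u : TangentSpace (𝓡 4) q} {u' : TangentSpace (𝓡 4) q'}
    (h : q = q') (hu : (u : E4) = u') : (⟨q, u⟩ : TangentBundle (𝓡 4) M) = ⟨q', u'⟩ := by
  subst h
  exact congrArg _ hu

variable {e : OpenPartialHomeomorph M E4}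

lemma mdifferentiable_of_mem_maximalAtlas (he : e ∈ IsManifold.maximalAtlas (𝓡 4) ∞ M) :
    e.MDifferentiable (𝓡 4) (𝓡 4) :=
  ⟨(contMDiffOn_of_mem_maximalAtlas he).mdifferentiableOn (by simp),
    (contMDiffOn_symm_of_mem_maximalAtlas he).mdifferentiableOn (by simp)⟩

lemma liftFrom_liftTo (he : e ∈ IsManifold.maximalAtlas (𝓡 4) ∞ M) {z : TangentBundle (𝓡 4) M}
    (hz : z.1 ∈ e.source) : liftFrom e.symm (liftTo e z) = z :=
  tangentBundle_ext (e.left_inv hz)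
    (congrArg (· z.2) ((mdifferentiable_of_mem_maximalAtlas he).symm_comp_deriv hz))

lemma liftTo_liftFrom (he : e ∈ IsManifold.maximalAtlas (𝓡 4) ∞ M) {p : E4 × E4}
    (hp : p.1 ∈ e.target) : liftTo e (liftFrom e.symm p) = p :=
  Prod.ext (e.right_inv hp)
    (congrArg (· p.2) ((mdifferentiable_of_mem_maximalAtlas he).comp_symm_deriv hp))

lemma contMDiff_toTangent : ContMDiff 𝓘(ℝ, E4 × E4) (𝓡 4).tangent ∞
    (fun p : E4 × E4 => (⟨p.1, p.2⟩ : TangentBundle (𝓡 4) E4)) := by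
  rw [modelWithCornersSelf_prod]
  exact contMDiff_tangentBundleModelSpaceHomeomorph_symm (I := 𝓡 4)

lemma contMDiff_ofTangent : ContMDiff (𝓡 4).tangent 𝓘(ℝ, E4 × E4) ∞
    (fun z : TangentBundle (𝓡 4) E4 => ((z.1, z.2) : E4 × E4)) := by
  rw [modelWithCornersSelf_prod]
  exact contMDiff_tangentBundleModelSpaceHomeomorph (I := 𝓡 4)

variable [IsManifold (𝓡 4) ∞ M]

lemma isOpen_proj_preimage {s : Set M} (hs : IsOpen s) :
    IsOpen {z : TangentBundle (𝓡 4) M | z.1 ∈ s} :=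
  have : IsManifold (𝓡 4) 1 M := .of_le (n := ∞) (by simp)
  hs.preimage (FiberBundle.continuous_proj E4 (TangentSpace (𝓡 4)))

lemma contMDiffOn_tangentMap_of_isOpen [IsManifold (𝓡 4) ∞ N] {f : M → N} {s : Set M}
    (hf : ContMDiffOn (𝓡 4) (𝓡 4) ∞ f s) (hs : IsOpen s) :
    ContMDiffOn (𝓡 4).tangent (𝓡 4).tangent ∞ (tangentMap (𝓡 4) (𝓡 4) f)
      {z : TangentBundle (𝓡 4) M | z.1 ∈ s} := by
  have : IsManifold (𝓡 4) 1 M := .of_le (n := ∞) (by simp)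
  have : IsManifold (𝓡 4) 1 N := .of_le (n := ∞) (by simp)
  refine (hf.contMDiffOn_tangentMapWithin (m := ∞) (by simp) hs.uniqueMDiffOn).congr fun z hz => ?_
  simp only [tangentMap, tangentMapWithin, mfderivWithin_of_isOpen hs hz]

lemma contMDiffOn_liftFrom {Φ : E4 → M} {W : Set E4} (hW : IsOpen W)
    (hΦ : ContMDiffOn (𝓡 4) (𝓡 4) ∞ Φ W) :
    ContMDiffOn 𝓘(ℝ, E4 × E4) (𝓡 4).tangent ∞ (liftFrom Φ) {p | p.1 ∈ W} :=
  (contMDiffOn_tangentMap_of_isOpen hΦ hW).comp (t := {z : TangentBundle (𝓡 4) E4 | z.1 ∈ W})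
    contMDiff_toTangent.contMDiffOn fun _ hp => hp

lemma contMDiffOn_liftTo {e : M → E4} {s : Set M} (hs : IsOpen s)
    (he : ContMDiffOn (𝓡 4) (𝓡 4) ∞ e s) :
    ContMDiffOn (𝓡 4).tangent 𝓘(ℝ, E4 × E4) ∞ (liftTo e) {z | z.1 ∈ s} :=
  contMDiff_ofTangent.comp_contMDiffOn (contMDiffOn_tangentMap_of_isOpen he hs)

end TangentMaps

/-! ### Lorentzian forms -/

section Lorentz

variable {V : Type*} [AddCommGroup V] [Module ℝ V] {n : ℕ}

/-- `B` is orthonormal for the form `g` of signature `(+,-,…,-)`. -/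
def IsLorentzBasis (g : LinearMap.BilinForm ℝ V) (B : Module.Basis (Fin (n + 1)) ℝ V) : Prop :=
  ∀ i j, g (B i) (B j) = if i = j then (if i = 0 then 1 else -1) else 0

namespace IsLorentzBasis

variable {g : LinearMap.BilinForm ℝ V} {B : Module.Basis (Fin (n + 1)) ℝ V}

lemma apply_basis (hB : IsLorentzBasis g B) (X : V) (j : Fin (n + 1)) :
    g X (B j) = if j = 0 then B.repr X 0 else -B.repr X j := by
  conv_lhs => rw [← B.sum_repr X]
  simp only [map_sum, map_smul, LinearMap.sum_apply, LinearMap.smul_apply, hB _ j, smul_eq_mul,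
    mul_ite, mul_one, mul_neg, mul_zero, Finset.sum_ite_eq', Finset.mem_univ, if_true]
  split_ifs with h <;> simp [h]

lemma apply (hB : IsLorentzBasis g B) (X Y : V) :
    g X Y = B.repr X 0 * B.repr Y 0 - ∑ i : Fin n, B.repr X i.succ * B.repr Y i.succ := by
  conv_lhs => rw [← B.sum_repr Y]
  simp only [map_sum, map_smul, hB.apply_basis, smul_eq_mul]
  rw [Fin.sum_univ_succ]
  simp [mul_comm, sub_eq_add_neg]

lemma symm (hB : IsLorentzBasis g B) (X Y : V) : g X Y = g Y X := by
  simp only [hB.apply, mul_comm]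

lemma eq_zero_of_forall (hB : IsLorentzBasis g B) {X : V} (h : ∀ Y, g X Y = 0) : X = 0 := by
  refine B.ext_elem fun i => ?_
  have hi := h (B i)
  rw [hB.apply_basis] at hi
  split_ifs at hi with h0 <;> simpa [h0] using hi

lemma apply_self_of_repr_zero (hB : IsLorentzBasis g B) {X : V} (h : B.repr X 0 = 0) :
    g X X = -∑ i : Fin n, B.repr X i.succ ^ 2 := by
  simp only [hB.apply, h, sq]
  ring

lemma eq_zero_of_repr_zero (hB : IsLorentzBasis g B) {X : V} (h : B.repr X 0 = 0)
    (hX : g X X = 0) : X = 0 := by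
  rw [hB.apply_self_of_repr_zero h, neg_eq_zero,
    Finset.sum_eq_zero_iff_of_nonneg fun _ _ => sq_nonneg _] at hX
  refine B.ext_elem (Fin.cases (by simpa using h) fun i => ?_)
  simpa using hX i (Finset.mem_univ i)

lemma exists_sub_smul (hB : IsLorentzBasis g B) {m X : V} (hm : m ≠ 0) (hmm : g m m = 0)
    (hX : g m X = 0) : ∃ μ : ℝ, B.repr (X - μ • m) 0 = 0 ∧ g (X - μ • m) (X - μ • m) = g X X := by
  have hm0 : B.repr m 0 ≠ 0 := fun h => hm (hB.eq_zero_of_repr_zero h hmm)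
  refine ⟨B.repr X 0 / B.repr m 0, by simp [hm0], ?_⟩
  simp [hX, hmm, hB.symm X m]

lemma nonpos_of_null_orthogonal (hB : IsLorentzBasis g B) {m X : V} (hm : m ≠ 0)
    (hmm : g m m = 0) (hX : g m X = 0) : g X X ≤ 0 := by
  obtain ⟨μ, h0, hμ⟩ := hB.exists_sub_smul hm hmm hX
  rw [← hμ, hB.apply_self_of_repr_zero h0, neg_nonpos]
  positivity

lemma eq_smul_of_null_orthogonal (hB : IsLorentzBasis g B) {m X : V} (hm : m ≠ 0)
    (hmm : g m m = 0) (hX : g m X = 0) (hXX : g X X = 0) : ∃ μ : ℝ, X = μ • m := by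
  obtain ⟨μ, h0, hμ⟩ := hB.exists_sub_smul hm hmm hX
  exact ⟨μ, sub_eq_zero.1 (hB.eq_zero_of_repr_zero h0 (hμ.trans hXX))⟩

lemma gram_nonneg (hB : IsLorentzBasis g B) {m X Y : V} (hm : m ≠ 0) (hmm : g m m = 0)
    (hX : g m X = 0) (hY : g m Y = 0) : 0 ≤ g X X * g Y Y - g X Y * g Y X := by
  have hquad (t : ℝ) : 0 ≤ -g X X * (t * t) + -(2 * g X Y) * t + -g Y Y := by
    have := hB.nonpos_of_null_orthogonal hm hmm (X := t • X + Y) (by simp [hX, hY])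
    simp only [map_add, map_smul, LinearMap.add_apply, LinearMap.smul_apply, smul_eq_mul,
      hB.symm Y X] at this
    linarith
  have := discrim_le_zero hquad
  rw [discrim] at this
  rw [hB.symm Y X]
  linarith

lemma exists_smul_of_gram_eq_zero (hB : IsLorentzBasis g B) {m X Y : V} (hm : m ≠ 0)
    (hmm : g m m = 0) (hX : g m X = 0) (hY : g m Y = 0)
    (h : g X X * g Y Y - g X Y * g Y X = 0) :
    ∃ a b μ : ℝ, (a ≠ 0 ∨ b ≠ 0) ∧ a • X + b • Y = μ • m := by
  obtain ⟨a, b, hab, hnull⟩ : ∃ a b : ℝ, (a ≠ 0 ∨ b ≠ 0) ∧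
      g (a • X + b • Y) (a • X + b • Y) = 0 := by
    by_cases hXX : g X X = 0
    · exact ⟨1, 0, .inl one_ne_zero, by simp [hXX]⟩
    · refine ⟨-g X Y, g X X, .inr hXX, ?_⟩
      simp only [map_add, map_smul, LinearMap.add_apply, LinearMap.smul_apply, smul_eq_mul]
      linear_combination g X X * h
  obtain ⟨μ, hμ⟩ := hB.eq_smul_of_null_orthogonal hm hmm (by simp [hX, hY]) hnull
  exact ⟨a, b, μ, hab, hμ⟩

lemma gram_eq_zero_iff (hB : IsLorentzBasis g B) {m X Y : V} (hm : m ≠ 0) (hmm : g m m = 0)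
    (hX : g m X = 0) (hY : g m Y = 0) :
    g X X * g Y Y - g X Y * g Y X = 0 ↔
      ∃ a b μ : ℝ, (a ≠ 0 ∨ b ≠ 0) ∧ a • X + b • Y = μ • m := by
  refine ⟨hB.exists_smul_of_gram_eq_zero hm hmm hX hY, ?_⟩
  rintro ⟨a, b, μ, hab, h⟩
  have horth (Z : V) (hZ : g m Z = 0) : a * g X Z + b * g Y Z = 0 := by
    simpa [hZ] using congrArg (g · Z) h
  rcases hab with ha | hb
  · refine (mul_eq_zero.1 ?_).resolve_left ha
    linear_combination g Y Y * horth X hX - g Y X * horth Y hY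
  · refine (mul_eq_zero.1 ?_).resolve_left hb
    linear_combination g X X * horth Y hY - g X Y * horth X hX

end IsLorentzBasis

/-- The bilinear form on `ℝ⁴` with a given matrix. -/
def matrixForm (m : Matrix (Fin 4) (Fin 4) ℝ) : LinearMap.BilinForm ℝ E4 :=
  Matrix.toBilin (PiLp.basisFun 2 ℝ (Fin 4)) m

lemma matrixForm_apply (m : Matrix (Fin 4) (Fin 4) ℝ) (u w : E4) :
    matrixForm m u w = ∑ i, u i * ∑ j, m i j * w j := by
  simp [matrixForm, Matrix.toBilin_apply, Finset.mul_sum, mul_assoc]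

lemma IsLorentzBasis.det_ne_zero {m : Matrix (Fin 4) (Fin 4) ℝ} {B : Module.Basis (Fin 4) ℝ E4}
    (hB : IsLorentzBasis (matrixForm m) B) : m.det ≠ 0 := by
  intro h0
  obtain ⟨w, hw0, hw⟩ := Matrix.exists_mulVec_eq_zero_iff.2 h0
  refine hw0 (congrArg WithLp.ofLp (hB.eq_zero_of_forall (X := WithLp.toLp 2 w) fun u => ?_))
  rw [hB.symm, matrixForm_apply]
  exact Finset.sum_eq_zero fun i _ => mul_eq_zero_of_right _ (congrFun hw i)

end Lorentz

lemma fundTensor_comp_linear {V W : Type*} [AddCommGroup V] [Module ℝ V] [AddCommGroup W]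
    [Module ℝ W] (F : W → ℝ) (T : V →ₗ[ℝ] W) (v u w : V) :
    fundTensor (fun y => F (T y)) v u w = fundTensor F (T v) (T u) (T w) := by
  simp [fundTensor]

namespace LocalFinsler

lemma SmoothOn.fundTensor_eq_matrixForm {ℓ : E4 → E4 → ℝ} {U : Set (E4 × E4)}
    (hℓ : SmoothOn U ℓ) (hU : IsOpen U) {x v : E4} (h : (x, v) ∈ U) (u w : E4) :
    fundTensor (ℓ x) v u w = matrixForm (metric ℓ x v) u w := by
  have hcont : Filter.Tendsto (fun y => (x, y)) (𝓝 v) (𝓝 (x, v)) :=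
    (Continuous.prodMk_right x).tendsto v
  have hlin : (fun y => lineDeriv ℝ (ℓ x) y u) =ᶠ[𝓝 v] fun y => ∑ i, dDir ℓ x y i * u i := by
    filter_upwards [hcont (hU.mem_nhds h)] with y hy
    rw [(hasLineDerivAt_uncurry_right (hℓ.differentiableAt hU hy) u).lineDeriv,
      hℓ.fderiv_apply hU hy]
    simp
  have hquad : HasLineDerivAt ℝ (fun y => ∑ i, dDir ℓ x y i * u i)
      (∑ i, (∑ j, dDir (dDir ℓ · · i) x v j * w j) * u i) v w := by
    refine HasDerivAt.fun_sum fun i _ => HasDerivAt.mul_const ?_ _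
    have hi := hasLineDerivAt_uncurry_right ((smoothOn_dDir hℓ hU i).differentiableAt hU h) w
    rw [(smoothOn_dDir hℓ hU i).fderiv_apply hU h] at hi
    simp only [PiLp.zero_apply, mul_zero, Finset.sum_const_zero, zero_add] at hi
    exact hi
  rw [fundTensor_eq_lineDeriv, hlin.lineDeriv_eq, hquad.lineDeriv, matrixForm_apply,
    Finset.mul_sum]
  refine Finset.sum_congr rfl fun i _ => ?_
  simp only [metric_eq, Finset.mul_sum, Finset.sum_mul]
  exact Finset.sum_congr rfl fun j _ => by ring

namespace IsChartFinsler

lemma matrixForm_self {ℓ : E4 → E4 → ℝ} {U A : Set (E4 × E4)} (H : IsChartFinsler ℓ U A)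
    {x v : E4} (h : (x, v) ∈ U ∩ closure A) (w : E4) :
    matrixForm (metric ℓ x v) v w = (1 / 2) * ∑ l, dDir ℓ x v l * w l := by
  rw [matrixForm_apply, sum_mul_sum_mul v (metric ℓ x v) w, Finset.mul_sum]
  refine Finset.sum_congr rfl fun l _ => ?_
  simp only [← mul_assoc, ← H.metric_mul_self h, H.metric_symm h.1 l, mul_comm]

end IsChartFinsler

end LocalFinsler

/-! ### Finsler spacetimes in charts -/

open LocalFinsler

section ChartSet

variable {M : Type*} [TopologicalSpace M] [ChartedSpace E4 M] {e : OpenPartialHomeomorph M E4}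
  {Z : Set (TangentBundle (𝓡 4) M)} {z : TangentBundle (𝓡 4) M}

/-- The subset `Z` of `TM` read in the chart `e`. -/
def chartSet (e : OpenPartialHomeomorph M E4) (Z : Set (TangentBundle (𝓡 4) M)) :
    Set (E4 × E4) :=
  {p | p.1 ∈ e.target} ∩ liftFrom e.symm ⁻¹' Z

lemma liftTo_mem_chartSet (he : e ∈ IsManifold.maximalAtlas (𝓡 4) ∞ M) (hz : z.1 ∈ e.source)
    (hZ : z ∈ Z) : liftTo e z ∈ chartSet e Z :=
  ⟨e.map_source hz, by rwa [Set.mem_preimage, liftFrom_liftTo he hz]⟩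

variable [IsManifold (𝓡 4) ∞ M]

lemma isOpen_chartSet (he : e ∈ IsManifold.maximalAtlas (𝓡 4) ∞ M) (hZ : IsOpen Z) :
    IsOpen (chartSet e Z) :=
  (contMDiffOn_liftFrom e.open_target (contMDiffOn_symm_of_mem_maximalAtlas he)).continuousOn
    |>.isOpen_inter_preimage (e.open_target.preimage continuous_fst) hZ

lemma liftTo_mem_closure_chartSet (he : e ∈ IsManifold.maximalAtlas (𝓡 4) ∞ M)
    (hz : z.1 ∈ e.source) (hZ : z ∈ closure Z) : liftTo e z ∈ closure (chartSet e Z) := by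
  have hsource := (isOpen_proj_preimage e.open_source).mem_nhds hz
  have hcont : ContinuousAt (liftTo e) z :=
    (contMDiffOn_liftTo e.open_source (contMDiffOn_of_mem_maximalAtlas he)).continuousOn
      |>.continuousAt hsource
  exact mem_closure_iff_frequently.2 <| hcont.frequently <|
    ((mem_closure_iff_frequently.1 hZ).and_eventually hsource).mono fun y hy =>
      liftTo_mem_chartSet he hy.2 hy.1

end ChartSet

namespace FinslerSpacetime

variable {M : Type*} [TopologicalSpace M] [ChartedSpace E4 M] [IsManifold (𝓡 4) ∞ M]
  (S : FinslerSpacetime M) {e : OpenPartialHomeomorph M E4}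

lemma subset_Abar : S.A ⊆ S.Abar := fun z hz => ⟨subset_closure hz, S.ne_zero z.1 z.2 hz⟩

lemma coordL_mfderiv (he : e ∈ IsManifold.maximalAtlas (𝓡 4) ∞ M) {q : M} (hq : q ∈ e.source)
    (u : TangentSpace (𝓡 4) q) :
    S.coordL e (e q) (mfderiv (𝓡 4) (𝓡 4) e q u) = S.L ⟨q, u⟩ :=
  congrArg S.L (liftFrom_liftTo he (z := ⟨q, u⟩) hq)

lemma g_eq_fundTensor_coordL (he : e ∈ IsManifold.maximalAtlas (𝓡 4) ∞ M) {q : M}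
    (hq : q ∈ e.source) (v u w : TangentSpace (𝓡 4) q) :
    S.g v u w = fundTensor (S.coordL e (e q)) (mfderiv (𝓡 4) (𝓡 4) e q v)
      (mfderiv (𝓡 4) (𝓡 4) e q u) (mfderiv (𝓡 4) (𝓡 4) e q w) := by
  simp only [g, ← S.coordL_mfderiv he hq]
  exact fundTensor_comp_linear (S.coordL e (e q)) (mfderiv (𝓡 4) (𝓡 4) e q).toLinearMap v u w

lemma smoothOn_coordL (he : e ∈ IsManifold.maximalAtlas (𝓡 4) ∞ M)
    {O : Set (TangentBundle (𝓡 4) M)} (hL : ContMDiffOn (𝓡 4).tangent 𝓘(ℝ, ℝ) ∞ S.L O) :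
    SmoothOn (chartSet e O) (S.coordL e) :=
  contMDiffOn_iff_contDiffOn.1 <| hL.comp
    ((contMDiffOn_liftFrom e.open_target (contMDiffOn_symm_of_mem_maximalAtlas he)).mono
      Set.inter_subset_left) fun _ hp => hp.2

lemma exists_isLorentzBasis (he : e ∈ IsManifold.maximalAtlas (𝓡 4) ∞ M)
    {z : TangentBundle (𝓡 4) M} (hz : z.1 ∈ e.source) (hA : z ∈ S.Abar) {U : Set (E4 × E4)}
    (hU : IsOpen U) (hs : SmoothOn U (S.coordL e)) (hzU : liftTo e z ∈ U) :
    ∃ B : Module.Basis (Fin 4) ℝ E4,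
      IsLorentzBasis (matrixForm (metric (S.coordL e) (liftTo e z).1 (liftTo e z).2)) B := by
  obtain ⟨q, v⟩ := z
  obtain ⟨B, hB⟩ := S.signature q v hA
  let T : TangentSpace (𝓡 4) q ≃L[ℝ] TangentSpace (𝓡 4) (e q) :=
    (mdifferentiable_of_mem_maximalAtlas he).mfderiv hz
  refine ⟨B.map T.toLinearEquiv, fun i j => ?_⟩
  exact (hs.fundTensor_eq_matrixForm hU hzU _ _).symm.trans
    ((S.g_eq_fundTensor_coordL he hz v (B i) (B j)).symm.trans (hB i j))

lemma coordL_smul {x v : E4} (h : (x, v) ∈ chartSet e S.A) {r : ℝ} (hr : 0 < r) :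
    S.coordL e x (r • v) = r ^ 2 * S.coordL e x v := by
  refine Eq.trans (congrArg S.L (tangentBundle_ext rfl ?_))
    (S.homogeneous _ _ (S.subset_Abar h.2) r hr)
  exact (mfderiv (𝓡 4) (𝓡 4) e.symm x).map_smul r v

theorem exists_isChartFinsler (he : e ∈ IsManifold.maximalAtlas (𝓡 4) ∞ M) :
    ∃ U A : Set (E4 × E4), IsChartFinsler (S.coordL e) U A ∧
      ∀ z : TangentBundle (𝓡 4) M, z.1 ∈ e.source → z ∈ S.Abar → liftTo e z ∈ U ∩ closure A := by
  obtain ⟨O, hO, hAO, hL⟩ := S.smooth_L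
  have hOo := isOpen_chartSet he hO
  have hs := S.smoothOn_coordL he hL
  have hdet : ContDiffOn ℝ ∞ (fun p : E4 × E4 => (metric (S.coordL e) p.1 p.2).det)
      (chartSet e O) := contDiffOn_matrix_det fun i j => by
    simp only [metric_eq]
    exact (smoothOn_dDir (smoothOn_dDir hs hOo i) hOo j).const_mul _
  let U := chartSet e O ∩ (fun p : E4 × E4 => (metric (S.coordL e) p.1 p.2).det) ⁻¹' {0}ᶜ
  have hmem (z : TangentBundle (𝓡 4) M) (hz : z.1 ∈ e.source) (hA : z ∈ S.Abar) :
      liftTo e z ∈ U := by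
    have hzO := liftTo_mem_chartSet he hz (hAO hA)
    obtain ⟨B, hB⟩ := S.exists_isLorentzBasis he hz hA hOo hs hzO
    exact ⟨hzO, hB.det_ne_zero⟩
  refine ⟨U, chartSet e S.A, ⟨?_, isOpen_chartSet he S.isOpen_A, fun p hp => ?_, ?_,
    fun x v hxv => hxv.2, fun x v hxv r hr => S.coordL_smul hxv hr⟩,
    fun z hz hA => ⟨hmem z hz hA, liftTo_mem_closure_chartSet he hz hA.1⟩⟩
  · exact hdet.continuousOn.isOpen_inter_preimage hOo isOpen_compl_singleton
  · simpa only [liftTo_liftFrom he hp.1] using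
      hmem _ (e.map_target hp.1) (S.subset_Abar hp.2)
  · exact hs.mono Set.inter_subset_left

lemma exists_bilinForm {q : M} {v : TangentSpace (𝓡 4) q}
    (hA : (⟨q, v⟩ : TangentBundle (𝓡 4) M) ∈ S.Abar) :
    ∃ (G : LinearMap.BilinForm ℝ (TangentSpace (𝓡 4) q))
      (B : Module.Basis (Fin 4) ℝ (TangentSpace (𝓡 4) q)),
      IsLorentzBasis G B ∧ ∀ u w, S.g v u w = G u w := by
  have he := IsManifold.chart_mem_maximalAtlas (I := 𝓡 4) (n := ∞) q
  have hq := mem_chart_source E4 q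
  obtain ⟨U, A, H, hmem⟩ := S.exists_isChartFinsler he
  obtain ⟨B, hB⟩ := S.signature q v hA
  have hG (u w : TangentSpace (𝓡 4) q) := (S.g_eq_fundTensor_coordL he hq v u w).trans
    (H.smooth.fundTensor_eq_matrixForm H.isOpen_dom (hmem ⟨q, v⟩ hq hA).1 _ _)
  let T := (mfderiv (𝓡 4) (𝓡 4) (chartAt E4 q) q).toLinearMap
  exact ⟨(matrixForm _).compl₁₂ T T, B, fun i j => (hG _ _).symm.trans (hB i j), hG⟩

end FinslerSpacetime

/-! ### Calculus along coordinate lines -/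

lemma contDiffAt_fderiv_apply_const {E G : Type*} [NormedAddCommGroup E] [NormedSpace ℝ E]
    [NormedAddCommGroup G] [NormedSpace ℝ G] {F : E → G} {x : E} (hF : ContDiffAt ℝ ∞ F x) (a : E) :
    ContDiffAt ℝ ∞ (fun y => fderiv ℝ F y a) x :=
  (hF.fderiv_right (m := ∞) (by simp)).clm_apply contDiffAt_const

namespace FinslerSpacetime

section LineCalculus

variable {G : Type*} [NormedAddCommGroup G] [NormedSpace ℝ G] {F : E4 → G} {V : Set E4} {z : E4}
  {s : ℝ}

lemma line_apply_zero (z : E4) (s : ℝ) : line z s 0 = s := by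
  simp [line, basisVec_apply]

lemma line_self (z : E4) : line z (z 0) = z := by simp [line]

lemma contDiff_line (z : E4) : ContDiff ℝ ∞ (line z) := by
  unfold line
  fun_prop

lemma hasDerivAt_line (z : E4) (s : ℝ) : HasDerivAt (line z) (basisVec 0) s := by
  have hline : HasDerivAt (line z) ((1 : ℝ) • basisVec 0) s :=
    (((hasDerivAt_id s).sub_const (z 0)).smul_const (basisVec 0)).const_add z
  rwa [one_smul] at hline

lemma hasDerivAt_comp_line (hF : ContDiffAt ℝ ∞ F (line z s)) :
    HasDerivAt (fun r => F (line z r)) (fderiv ℝ F (line z s) (basisVec 0)) s :=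
  (hF.differentiableAt (by simp)).hasFDerivAt.comp_hasDerivAt s (hasDerivAt_line z s)

lemma contDiffAt_comp_line (hF : ContDiffAt ℝ ∞ F (line z s)) :
    ContDiffAt ℝ ∞ (fun r => F (line z r)) s :=
  ContDiffAt.comp s hF (contDiff_line z).contDiffAt

lemma eventually_line_mem (hV : IsOpen V) (hs : line z s ∈ V) : ∀ᶠ r in 𝓝 s, line z r ∈ V :=
  (contDiff_line z).continuous.continuousAt.eventually (hV.mem_nhds hs)

lemma deriv_comp_line (hV : IsOpen V) (hF : ContDiffOn ℝ ∞ F V) (hs : line z s ∈ V) :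
    deriv (fun r => F (line z r)) s = fderiv ℝ F (line z s) (basisVec 0) :=
  (hasDerivAt_comp_line (hF.contDiffAt (hV.mem_nhds hs))).deriv

lemma deriv_comp_line_eventuallyEq (hV : IsOpen V) (hF : ContDiffOn ℝ ∞ F V)
    (hs : line z s ∈ V) : deriv (fun r => F (line z r)) =ᶠ[𝓝 s]
      fun r => fderiv ℝ F (line z r) (basisVec 0) :=
  (eventually_line_mem hV hs).mono fun _ hr => deriv_comp_line hV hF hr

lemma deriv_deriv_comp_line (hV : IsOpen V) (hF : ContDiffOn ℝ ∞ F V) (hs : line z s ∈ V) :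
    deriv (deriv (fun r => F (line z r))) s
      = fderiv ℝ (fun y => fderiv ℝ F y (basisVec 0)) (line z s) (basisVec 0) := by
  rw [(deriv_comp_line_eventuallyEq hV hF hs).deriv_eq]
  exact (hasDerivAt_comp_line
    (contDiffAt_fderiv_apply_const (hF.contDiffAt (hV.mem_nhds hs)) (basisVec 0))).deriv

end LineCalculus

end FinslerSpacetime

namespace LocalFinsler.IsChartFinsler

open FinslerSpacetime

variable {ℓ : E4 → E4 → ℝ} {U A : Set (E4 × E4)} {ψ : E4 → E4} {V : Set E4} {z : E4} {s : ℝ}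

/-! ### Variations through geodesics -/

lemma linearizedGeodesicEq_of_variation (H : IsChartFinsler ℓ U A) (hV : IsOpen V)
    (hψ : ContDiffOn ℝ ∞ ψ V) (hs : line z s ∈ V)
    (hU : (ψ (line z s), deriv (fun r => ψ (line z r)) s) ∈ U)
    (hgeo : ∀ z s, line z s ∈ V → deriv (deriv (fun r => ψ (line z r))) s
      = -sprayVec ℓ (ψ (line z s), deriv (fun r => ψ (line z r)) s)) (w : E4) :
    LinearizedGeodesicEq ℓ (fun r => ψ (line z r)) (fun r => fderiv ℝ ψ (line z r) w) s := by
  have hat : ∀ y ∈ V, ContDiffAt ℝ ∞ ψ y := fun y hy => hψ.contDiffAt (hV.mem_nhds hy)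
  have hD (a : E4) {y : E4} (hy : y ∈ V) : ContDiffAt ℝ ∞ (fun y => fderiv ℝ ψ y a) y :=
    contDiffAt_fderiv_apply_const (hat y hy) a
  have hDw : ContDiffOn ℝ ∞ (fun y => fderiv ℝ ψ y w) V := fun _ hy => (hD w hy).contDiffWithinAt
  have hcomm {y : E4} (hy : y ∈ V) : fderiv ℝ (fun y => fderiv ℝ ψ y w) y (basisVec 0)
      = fderiv ℝ (fun y => fderiv ℝ ψ y (basisVec 0)) y w :=
    fderiv_fderiv_apply_comm ((hat y hy).of_le (by norm_cast)) _ _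
  have hcomm_ev : (fun y => fderiv ℝ (fun y => fderiv ℝ ψ y w) y (basisVec 0)) =ᶠ[𝓝 (line z s)]
      fun y => fderiv ℝ (fun y => fderiv ℝ ψ y (basisVec 0)) y w :=
    Filter.eventually_of_mem (hV.mem_nhds hs) fun _ => hcomm
  have hgeo_ev : (fun y => fderiv ℝ (fun y => fderiv ℝ ψ y (basisVec 0)) y (basisVec 0))
      =ᶠ[𝓝 (line z s)] fun y => -sprayVec ℓ (ψ y, fderiv ℝ ψ y (basisVec 0)) :=
    Filter.eventually_of_mem (hV.mem_nhds hs) fun y hy => by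
      have hy0 : line y (y 0) ∈ V := by rwa [line_self]
      simpa only [deriv_deriv_comp_line hV hψ hy0, deriv_comp_line hV hψ hy0, line_self]
        using hgeo y (y 0) hy0
  rw [deriv_comp_line hV hψ hs] at hU
  have hspray : HasFDerivAt (fun y => -sprayVec ℓ (ψ y, fderiv ℝ ψ y (basisVec 0))) _ (line z s) :=
    ((H.hasFDerivAt_sprayVec hU).comp (line z s)
      (((hat _ hs).differentiableAt (by simp)).hasFDerivAt.prodMk
        ((hD (basisVec 0) hs).differentiableAt (by simp)).hasFDerivAt)).neg
  rw [LinearizedGeodesicEq, deriv_deriv_comp_line hV hDw hs, deriv_comp_line hV hDw hs,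
    deriv_comp_line hV hψ hs, hcomm_ev.fderiv_eq,
    fderiv_fderiv_apply_comm ((hD _ hs).of_le (by norm_cast)), hgeo_ev.fderiv_eq, hcomm hs,
    hspray.fderiv]
  rfl

lemma fderiv_sprayVec_dir (H : IsChartFinsler ℓ U A) {y v : E4} (h : (y, v) ∈ U ∩ closure A) :
    fderiv ℝ (sprayVec ℓ) (y, v) (0, v) = (2 : ℝ) • sprayVec ℓ (y, v) := by
  ext i
  rw [H.fderiv_sprayVec_apply h]
  simp [sprayVec, spray_eq_sum_conn]

lemma deriv_deriv_deriv_of_geodesic (H : IsChartFinsler ℓ U A) {x : ℝ → E4}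
    (hx : ContDiffAt ℝ ∞ x s) (h : (x s, deriv x s) ∈ U)
    (hgeo : ∀ᶠ r in 𝓝 s, deriv (deriv x) r = -sprayVec ℓ (x r, deriv x r)) :
    deriv (deriv (deriv x)) s
      = -fderiv ℝ (sprayVec ℓ) (x s, deriv x s) (deriv x s, deriv (deriv x) s) := by
  have hspray : HasDerivAt (fun r => -sprayVec ℓ (x r, deriv x r))
      (-fderiv ℝ (sprayVec ℓ) (x s, deriv x s) (deriv x s, deriv (deriv x) s)) s :=
    ((H.hasFDerivAt_sprayVec h).comp_hasDerivAt s
      ((hasDerivAt_of_smooth hx).prodMk (hasDerivAt_deriv_of_smooth hx))).neg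
  rw [Filter.EventuallyEq.deriv_eq hgeo, hspray.deriv]

/-- Since the spray is quadratic, rescaling the affine parameter about `b` maps geodesics to
geodesics. -/
lemma linearizedGeodesicEq_rescaling (H : IsChartFinsler ℓ U A) {x : ℝ → E4} {b : ℝ}
    (hx : ContDiffAt ℝ ∞ x s) (h : (x s, deriv x s) ∈ U ∩ closure A)
    (hgeo : ∀ᶠ r in 𝓝 s, deriv (deriv x) r = -sprayVec ℓ (x r, deriv x r)) :
    LinearizedGeodesicEq ℓ x (fun r => (r - b) • deriv x r) s := by
  have hx' := contDiffAt_deriv_of_smooth hx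
  have hid (r : ℝ) : HasDerivAt (fun r : ℝ => r - b) 1 r := (hasDerivAt_id r).sub_const b
  have hfirst : deriv (fun r => (r - b) • deriv x r) =ᶠ[𝓝 s]
      fun r => (r - b) • deriv (deriv x) r + (1 : ℝ) • deriv x r := by
    filter_upwards [eventually_hasDerivAt_of_smooth hx'] with r hr using ((hid r).smul hr).deriv
  have hsecond : HasDerivAt (fun r => (r - b) • deriv (deriv x) r + (1 : ℝ) • deriv x r)
      (((s - b) • deriv (deriv (deriv x)) s + (1 : ℝ) • deriv (deriv x) s)
        + (1 : ℝ) • deriv (deriv x) s) s :=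
    ((hid s).smul (hasDerivAt_deriv_of_smooth hx')).add
      ((hasDerivAt_of_smooth hx').const_smul (1 : ℝ))
  have hsplit : (((s - b) • deriv x s, (s - b) • deriv (deriv x) s + (1 : ℝ) • deriv x s)
      : E4 × E4) = (s - b) • (deriv x s, deriv (deriv x) s) + (0, deriv x s) := by
    simp
  rw [LinearizedGeodesicEq, hfirst.deriv_eq, hsecond.deriv, hfirst.self_of_nhds, hsplit, map_add,
    map_smul, H.fderiv_sprayVec_dir h, H.deriv_deriv_deriv_of_geodesic hx h.1 hgeo,
    hgeo.self_of_nhds]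
  module

/-! ### Null frames with constant momentum -/

lemma sum_dPos_add_sum_dDir_of_null (H : IsChartFinsler ℓ U A) (hV : IsOpen V)
    (hψ : ContDiffOn ℝ ∞ ψ V) (hnull : ∀ y ∈ V, ℓ (ψ y) (fderiv ℝ ψ y (basisVec 0)) = 0)
    {y : E4} (hy : y ∈ V) (hU : (ψ y, fderiv ℝ ψ y (basisVec 0)) ∈ U) (w : E4) :
    ∑ l, dPos ℓ (ψ y) (fderiv ℝ ψ y (basisVec 0)) l * fderiv ℝ ψ y w l
      + ∑ l, dDir ℓ (ψ y) (fderiv ℝ ψ y (basisVec 0)) l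
        * fderiv ℝ (fun y => fderiv ℝ ψ y (basisVec 0)) y w l = 0 := by
  have hat : ContDiffAt ℝ ∞ ψ y := hψ.contDiffAt (hV.mem_nhds hy)
  have hlift : HasFDerivAt (fun y => (ψ y, fderiv ℝ ψ y (basisVec 0))) _ y :=
    (hat.differentiableAt (by simp)).hasFDerivAt.prodMk
      ((contDiffAt_fderiv_apply_const hat (basisVec 0)).differentiableAt (by simp)).hasFDerivAt
  have hzero : HasFDerivAt (fun y => ℓ (ψ y) (fderiv ℝ ψ y (basisVec 0))) (0 : E4 →L[ℝ] ℝ) y :=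
    (hasFDerivAt_const (0 : ℝ) y).congr_of_eventuallyEq
      (Filter.eventually_of_mem (hV.mem_nhds hy) hnull)
  have hcomp : HasFDerivAt (fun y => ℓ (ψ y) (fderiv ℝ ψ y (basisVec 0))) _ y :=
    HasFDerivAt.comp (g := Function.uncurry ℓ) y
      (H.smooth.differentiableAt H.isOpen_dom hU).hasFDerivAt hlift
  rw [← H.smooth.fderiv_apply H.isOpen_dom hU]
  exact DFunLike.congr_fun (hcomp.unique hzero) w

lemma sum_deriv_dDir_add_sum_dDir_of_const (H : IsChartFinsler ℓ U A) (hV : IsOpen V)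
    (hψ : ContDiffOn ℝ ∞ ψ V) (hs : line z s ∈ V)
    (hU : (ψ (line z s), fderiv ℝ ψ (line z s) (basisVec 0)) ∈ U ∩ closure A) {w : E4} {c : ℝ}
    (hconst : ∀ y ∈ V, ∑ l, dDir ℓ (ψ y) (fderiv ℝ ψ y (basisVec 0)) l * fderiv ℝ ψ y w l = c) :
    ∑ l, deriv (fun r => dDir ℓ (ψ (line z r)) (deriv (fun r => ψ (line z r)) r) l) s
        * fderiv ℝ ψ (line z s) w l
      + ∑ l, dDir ℓ (ψ (line z s)) (fderiv ℝ ψ (line z s) (basisVec 0)) l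
        * fderiv ℝ (fun y => fderiv ℝ ψ y w) (line z s) (basisVec 0) l = 0 := by
  have hat : ContDiffAt ℝ ∞ ψ (line z s) := hψ.contDiffAt (hV.mem_nhds hs)
  have hvel := deriv_comp_line_eventuallyEq hV hψ hs
  have hprod : HasDerivAt (fun r => ∑ l, dDir ℓ (ψ (line z r)) (deriv (fun r => ψ (line z r)) r) l
      * fderiv ℝ ψ (line z r) w l) _ s :=
    HasDerivAt.fun_sum fun l _ =>
      (H.hasDerivAt_dDir (contDiffAt_comp_line hat)
        (by rwa [hvel.self_of_nhds]) l).differentiableAt.hasDerivAt.mul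
      (hasDerivAt_euclidean.1 (hasDerivAt_comp_line (contDiffAt_fderiv_apply_const hat w)) l)
  have hconst_ev : (fun r => ∑ l, dDir ℓ (ψ (line z r)) (deriv (fun r => ψ (line z r)) r) l
      * fderiv ℝ ψ (line z r) w l) =ᶠ[𝓝 s] fun _ => c := by
    filter_upwards [hvel, eventually_line_mem hV hs] with r hr hrV
    rw [hr, hconst _ hrV]
  rw [← Finset.sum_add_distrib, ← deriv_comp_line hV hψ hs, ← hprod.deriv,
    hconst_ev.deriv_eq, deriv_const]

/-- Subtracting the derivatives of `p(∂_w ψ) = c w` along `∂_0` and of `ℓ (ψ, ∂_0 ψ) = 0` along `w`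
leaves the Euler–Lagrange equation tested on `∂_w ψ`. -/
lemma geodesic_of_null_frame (H : IsChartFinsler ℓ U A) (hV : IsOpen V) (hψ : ContDiffOn ℝ ∞ ψ V)
    (hnull : ∀ y ∈ V, ℓ (ψ y) (fderiv ℝ ψ y (basisVec 0)) = 0) {c : E4 → ℝ}
    (hframe : ∀ y ∈ V, ∀ w, ∑ l, dDir ℓ (ψ y) (fderiv ℝ ψ y (basisVec 0)) l * fderiv ℝ ψ y w l
      = c w)
    (hs : line z s ∈ V)
    (hU : (ψ (line z s), fderiv ℝ ψ (line z s) (basisVec 0)) ∈ U ∩ closure A)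
    (hsurj : Function.Surjective (fderiv ℝ ψ (line z s))) :
    deriv (deriv (fun r => ψ (line z r))) s
      = -sprayVec ℓ (ψ (line z s), deriv (fun r => ψ (line z r)) s) := by
  have hat : ContDiffAt ℝ ∞ ψ (line z s) := hψ.contDiffAt (hV.mem_nhds hs)
  have hvel := deriv_comp_line hV hψ hs
  refine H.geodesic_of_euler_lagrange (contDiffAt_comp_line hat) (by rwa [hvel]) fun l => ?_
  obtain ⟨w, hw⟩ := hsurj (basisVec l)
  have hdir := H.sum_deriv_dDir_add_sum_dDir_of_const hV hψ hs hU fun y hy => hframe y hy w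
  have hpos := H.sum_dPos_add_sum_dDir_of_null hV hψ hnull hs hU.1 w
  rw [fderiv_fderiv_apply_comm (hat.of_le (by norm_cast)), hw] at hdir
  rw [hw] at hpos
  simp only [basisVec_apply, mul_ite, mul_one, mul_zero, Finset.sum_ite_eq', Finset.mem_univ,
    if_true] at hdir hpos
  rw [hvel]
  exact add_right_cancel (hdir.trans hpos.symm)

end LocalFinsler.IsChartFinsler

/-! ### Geodesics and Jacobi fields -/

lemma affine_of_deriv_deriv_eq_zero {F : ℝ → ℝ} {I : Set ℝ} (hI : IsOpen I)
    (hI' : I.OrdConnected) (hF : ∀ s ∈ I, DifferentiableAt ℝ F s)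
    (hF' : ∀ s ∈ I, HasDerivAt (deriv F) 0 s) {b s : ℝ} (hb : b ∈ I) (hs : s ∈ I) :
    F s = F b + deriv F b * (s - b) := by
  have hconst {G : ℝ → ℝ} (hG : ∀ r ∈ I, HasDerivAt G 0 r) {r : ℝ} (hr : r ∈ I) : G r = G b :=
    hI.is_const_of_deriv_eq_zero hI'.isPreconnected
      (fun r hr => (hG r hr).differentiableAt.differentiableWithinAt)
      (fun r hr => (hG r hr).deriv) hr hb
  have hlin (r : ℝ) : HasDerivAt (fun r => deriv F b * (r - b)) (deriv F b * 1) r :=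
    ((hasDerivAt_id r).sub_const b).const_mul _
  have heq := hconst (G := fun r => F r - deriv F b * (r - b)) (fun r hr => by
    exact ((hF r hr).hasDerivAt.sub (hlin r)).congr_deriv (by simp [hconst hF' hr])) hs
  linarith

namespace FinslerSpacetime

variable {M : Type*} [TopologicalSpace M] [ChartedSpace E4 M]
  {e : OpenPartialHomeomorph M E4} {γ : ℝ → M} {I : Set ℝ} {s : ℝ}

/-- The vector field `J` along the curve `γ` read in the chart `e`. -/
abbrev chartField (e : OpenPartialHomeomorph M E4) (γ : ℝ → M)
    (J : ∀ s, TangentSpace (𝓡 4) (γ s)) : ℝ → E4 :=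
  fun s => mfderiv (𝓡 4) (𝓡 4) e (γ s) (J s)

lemma mfderiv_chart_velocity (he : e ∈ IsManifold.maximalAtlas (𝓡 4) ∞ M)
    (hγ : MDifferentiableAt 𝓘(ℝ, ℝ) (𝓡 4) γ s) (hse : γ s ∈ e.source) :
    mfderiv (𝓡 4) (𝓡 4) e (γ s) (velocity γ s) = deriv (fun r => e (γ r)) s := by
  have hcomp := mfderiv_comp s ((mdifferentiable_of_mem_maximalAtlas he).mdifferentiableAt hse) hγ
  rw [← fderiv_apply_one_eq_deriv, ← mfderiv_eq_fderiv]
  exact (congrArg (· (1 : ℝ)) hcomp).symm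

lemma contDiffAt_chart_curve (he : e ∈ IsManifold.maximalAtlas (𝓡 4) ∞ M)
    (hγ : ContMDiffAt 𝓘(ℝ, ℝ) (𝓡 4) ∞ γ s) (hse : γ s ∈ e.source) :
    ContDiffAt ℝ ∞ (fun r => e (γ r)) s :=
  (((contMDiffOn_of_mem_maximalAtlas he).contMDiffAt
    (e.open_source.mem_nhds hse)).comp s hγ).contDiffAt

variable [IsManifold (𝓡 4) ∞ M] {S : FinslerSpacetime M}
  {J K : ∀ s, TangentSpace (𝓡 4) (γ s)}

theorem exists_chart_geodesics (S : FinslerSpacetime M)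
    (he : e ∈ IsManifold.maximalAtlas (𝓡 4) ∞ M) :
    ∃ U A : Set (E4 × E4), IsChartFinsler (S.coordL e) U A ∧ ∀ (γ : ℝ → M) (s : ℝ),
      MDifferentiableAt 𝓘(ℝ, ℝ) (𝓡 4) γ s → γ s ∈ e.source → S.IsGeodesicAt γ s →
      (e (γ s), deriv (fun r => e (γ r)) s) ∈ U ∩ closure A ∧
      deriv (deriv fun r => e (γ r)) s
        = -sprayVec (S.coordL e) (e (γ s), deriv (fun r => e (γ r)) s) := by
  obtain ⟨U, A, H, hmem⟩ := S.exists_isChartFinsler he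
  refine ⟨U, A, H, fun γ s hγ hse hgeo => ⟨?_, ?_⟩⟩
  · rw [← mfderiv_chart_velocity he hγ hse]
    exact hmem ⟨γ s, velocity γ s⟩ hse hgeo.1
  · exact eq_neg_of_add_eq_zero_left ((covDeriv_velocity _ _ _).symm.trans (hgeo.2 e he hse))

lemma contMDiffAt_of_field (hI : IsOpen I)
    (hJ : ContMDiffOn 𝓘(ℝ, ℝ) (𝓡 4).tangent ∞ (fun s => (⟨γ s, J s⟩ : TangentBundle (𝓡 4) M)) I)
    (hs : s ∈ I) : ContMDiffAt 𝓘(ℝ, ℝ) (𝓡 4) ∞ γ s :=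
  have : IsManifold (𝓡 4) 1 M := .of_le (n := ∞) (by simp)
  (Bundle.contMDiff_proj (IB := 𝓡 4) (TangentSpace (𝓡 4) (M := M))).contMDiffAt.comp s
    (hJ.contMDiffAt (hI.mem_nhds hs))

lemma contDiffAt_chartField (he : e ∈ IsManifold.maximalAtlas (𝓡 4) ∞ M) (hI : IsOpen I)
    (hJ : ContMDiffOn 𝓘(ℝ, ℝ) (𝓡 4).tangent ∞ (fun s => (⟨γ s, J s⟩ : TangentBundle (𝓡 4) M)) I)
    (hs : s ∈ I) (hse : γ s ∈ e.source) : ContDiffAt ℝ ∞ (chartField e γ J) s :=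
  ((((contMDiffOn_liftTo e.open_source (contMDiffOn_of_mem_maximalAtlas he)).contMDiffAt
    ((isOpen_proj_preimage e.open_source).mem_nhds hse)).comp s
      (hJ.contMDiffAt (hI.mem_nhds hs))).contDiffAt).snd

lemma isJacobiField_iff (hI : IsOpen I) (hgeo : ∀ s ∈ I, S.IsGeodesicAt γ s) :
    S.IsJacobiField γ I J ↔
      ContMDiffOn 𝓘(ℝ, ℝ) (𝓡 4).tangent ∞
        (fun s => (⟨γ s, J s⟩ : TangentBundle (𝓡 4) M)) I ∧
      ∀ e ∈ IsManifold.maximalAtlas (𝓡 4) ∞ M, ∀ s ∈ I, γ s ∈ e.source →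
        LinearizedGeodesicEq (S.coordL e) (fun r => e (γ r)) (chartField e γ J) s := by
  refine and_congr_right fun hJ => forall₅_congr fun e he s hs hse => ?_
  obtain ⟨U, A, H, hchart⟩ := S.exists_chart_geodesics he
  have hγ := contMDiffAt_of_field hI hJ hs
  obtain ⟨hmem, hspray⟩ := hchart γ s (hγ.mdifferentiableAt (by simp)) hse (hgeo s hs)
  exact H.jacobi_iff (contDiffAt_chart_curve he hγ hse)
    (contDiffAt_chartField he hI hJ hs hse) hmem hspray

lemma eventually_mem_source (hI : IsOpen I)
    (hJ : ContMDiffOn 𝓘(ℝ, ℝ) (𝓡 4).tangent ∞ (fun s => (⟨γ s, J s⟩ : TangentBundle (𝓡 4) M)) I)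
    (hs : s ∈ I) (hse : γ s ∈ e.source) : ∀ᶠ r in 𝓝 s, r ∈ I ∧ γ r ∈ e.source :=
  (hI.eventually_mem hs).and ((contMDiffAt_of_field hI hJ hs).continuousAt.eventually
    (e.open_source.mem_nhds hse))

namespace IsJacobiField

lemma eventuallyEq (hJ : S.IsJacobiField γ I J) (hK : S.IsJacobiField γ I K)
    (hI : IsOpen I) (hgeo : ∀ s ∈ I, S.IsGeodesicAt γ s)
    (he : e ∈ IsManifold.maximalAtlas (𝓡 4) ∞ M) (hs : s ∈ I) (hse : γ s ∈ e.source)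
    (h0 : chartField e γ J s = chartField e γ K s)
    (h1 : deriv (chartField e γ J) s = deriv (chartField e γ K) s) :
    ∀ᶠ r in 𝓝 s, J r = K r := by
  obtain ⟨U, A, H, hchart⟩ := S.exists_chart_geodesics he
  have hγ := contMDiffAt_of_field hI hJ.1 hs
  have hev := eventually_mem_source hI hJ.1 hs hse
  have hsol {X : ∀ s, TangentSpace (𝓡 4) (γ s)} (hX : S.IsJacobiField γ I X) : ∀ᶠ r in 𝓝 s,
      LinearizedGeodesicEq (S.coordL e) (fun r => e (γ r)) (chartField e γ X) r :=
    hev.mono fun r hr => ((isJacobiField_iff hI hgeo).1 hX).2 e he r hr.1 hr.2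
  have heq := H.linearizedGeodesicEq_unique (contDiffAt_chart_curve he hγ hse)
    (contDiffAt_chartField he hI hJ.1 hs hse) (contDiffAt_chartField he hI hK.1 hs hse)
    (hchart γ s (hγ.mdifferentiableAt (by simp)) hse (hgeo s hs)).1.1 (hsol hJ) (hsol hK) h0 h1
  filter_upwards [heq, hev] with r hr hr'
  exact (mdifferentiable_of_mem_maximalAtlas he).mfderiv_injective hr'.2 hr

theorem unique (hJ : S.IsJacobiField γ I J) (hK : S.IsJacobiField γ I K)
    (hI : IsOpen I) (hI' : I.OrdConnected) (hgeo : ∀ s ∈ I, S.IsGeodesicAt γ s)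
    (he : e ∈ IsManifold.maximalAtlas (𝓡 4) ∞ M) {b : ℝ} (hb : b ∈ I) (hbe : γ b ∈ e.source)
    (h0 : chartField e γ J b = chartField e γ K b)
    (h1 : deriv (chartField e γ J) b = deriv (chartField e γ K) b) (hs : s ∈ I) :
    J s = K s := by
  have hopen : IsOpen {s | ∀ᶠ r in 𝓝 s, J r = K r} := isOpen_setOfPred_eventually_nhds
  suffices hsub : I ⊆ {s | ∀ᶠ r in 𝓝 s, J r = K r} from (hsub hs).self_of_nhds
  refine hI'.isPreconnected.subset_of_closure_inter_subset hopen
    ⟨b, hb, hJ.eventuallyEq hK hI hgeo he hb hbe h0 h1⟩ ?_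
  rintro s ⟨hsc, hsI⟩
  have he' := IsManifold.chart_mem_maximalAtlas (I := 𝓡 4) (n := ∞) (γ s)
  have hse := mem_chart_source E4 (γ s)
  have hJs := contDiffAt_chartField he' hI hJ.1 hsI hse
  have hKs := contDiffAt_chartField he' hI hK.1 hsI hse
  have hfreq : ∃ᶠ r in 𝓝 s,
      chartField (chartAt E4 (γ s)) γ J =ᶠ[𝓝 r] chartField (chartAt E4 (γ s)) γ K :=
    (mem_closure_iff_frequently.1 hsc).mono fun r hr => hr.mono fun t ht => by
      rw [chartField, chartField, ht]
  exact hJ.eventuallyEq hK hI hgeo he' hsI hse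
    (tendsto_nhds_unique_of_frequently_eq hJs.continuousAt hKs.continuousAt
      (hfreq.mono fun r hr => hr.self_of_nhds))
    (tendsto_nhds_unique_of_frequently_eq (contDiffAt_deriv_of_smooth hJs).continuousAt
      (contDiffAt_deriv_of_smooth hKs).continuousAt (hfreq.mono fun r hr => hr.deriv_eq))

end IsJacobiField

section Momentum

variable {U A : Set (E4 × E4)}

lemma g_velocity_self (he : e ∈ IsManifold.maximalAtlas (𝓡 4) ∞ M)
    (H : IsChartFinsler (S.coordL e) U A) (hγ : MDifferentiableAt 𝓘(ℝ, ℝ) (𝓡 4) γ s)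
    (hse : γ s ∈ e.source) (hmem : (e (γ s), deriv (fun r => e (γ r)) s) ∈ U ∩ closure A) :
    S.g (velocity γ s) (velocity γ s) (J s) = (1 / 2) * ∑ l,
      dDir (S.coordL e) (e (γ s)) (deriv (fun r => e (γ r)) s) l * chartField e γ J s l := by
  rw [S.g_eq_fundTensor_coordL he hse, mfderiv_chart_velocity he hγ hse]
  exact (H.smooth.fundTensor_eq_matrixForm H.isOpen_dom hmem.1 _ _).trans
    (H.matrixForm_self hmem _)

lemma hasDerivAt_g_velocity (he : e ∈ IsManifold.maximalAtlas (𝓡 4) ∞ M)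
    (H : IsChartFinsler (S.coordL e) U A) (hI : IsOpen I)
    (hchart : ∀ r ∈ I, γ r ∈ e.source →
      (e (γ r), deriv (fun r => e (γ r)) r) ∈ U ∩ closure A ∧
      deriv (deriv fun r => e (γ r)) r
        = -sprayVec (S.coordL e) (e (γ r), deriv (fun r => e (γ r)) r))
    (hJ : ContMDiffOn 𝓘(ℝ, ℝ) (𝓡 4).tangent ∞ (fun s => (⟨γ s, J s⟩ : TangentBundle (𝓡 4) M)) I)
    (hs : s ∈ I) (hse : γ s ∈ e.source) :
    HasDerivAt (fun r => S.g (velocity γ r) (velocity γ r) (J r))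
      ((1 / 2) * fderiv ℝ (Function.uncurry (S.coordL e))
        (e (γ s), deriv (fun r => e (γ r)) s)
        (chartField e γ J s, deriv (chartField e γ J) s)) s := by
  obtain ⟨hmem, hspray⟩ := hchart s hs hse
  refine ((H.hasDerivAt_momentum (contDiffAt_chart_curve he (contMDiffAt_of_field hI hJ hs) hse)
    ((contDiffAt_chartField he hI hJ hs hse).differentiableAt (by simp)) hmem hspray).const_mul
      (1 / 2)).congr_of_eventuallyEq ?_
  filter_upwards [eventually_mem_source hI hJ hs hse] with r hr using g_velocity_self he H
    ((contMDiffAt_of_field hI hJ hr.1).mdifferentiableAt (by simp)) hr.2 (hchart r hr.1 hr.2).1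

theorem IsJacobiField.affine (hJ : S.IsJacobiField γ I J) (hI : IsOpen I)
    (hI' : I.OrdConnected) (hgeo : ∀ s ∈ I, S.IsGeodesicAt γ s) {b : ℝ} (hb : b ∈ I)
    (hs : s ∈ I) :
    S.g (velocity γ s) (velocity γ s) (J s) = S.g (velocity γ b) (velocity γ b) (J b)
      + deriv (fun r => S.g (velocity γ r) (velocity γ r) (J r)) b * (s - b) := by
  suffices h : ∀ s ∈ I,
      DifferentiableAt ℝ (fun r => S.g (velocity γ r) (velocity γ r) (J r)) s ∧
      HasDerivAt (deriv fun r => S.g (velocity γ r) (velocity γ r) (J r)) 0 s from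
    affine_of_deriv_deriv_eq_zero hI hI' (fun s hs => (h s hs).1) (fun s hs => (h s hs).2) hb hs
  intro s hs
  have he := IsManifold.chart_mem_maximalAtlas (I := 𝓡 4) (n := ∞) (γ s)
  have hse := mem_chart_source E4 (γ s)
  obtain ⟨U, A, H, hchart⟩ := S.exists_chart_geodesics he
  have hγ (r : ℝ) (hr : r ∈ I) := contMDiffAt_of_field hI hJ.1 hr
  have hchart' := fun r hr hre =>
    hchart γ r ((hγ r hr).mdifferentiableAt (by simp)) hre (hgeo r hr)
  refine ⟨(hasDerivAt_g_velocity he H hI hchart' hJ.1 hs hse).differentiableAt, ?_⟩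
  have hsecond := (H.hasDerivAt_fderiv_zero (contDiffAt_chart_curve he (hγ s hs) hse)
    (contDiffAt_chartField he hI hJ.1 hs hse) (hchart' s hs hse).1 (hchart' s hs hse).2
    (((isJacobiField_iff hI hgeo).1 hJ).2 _ he s hs hse)).const_mul (1 / 2)
  rw [mul_zero] at hsecond
  refine hsecond.congr_of_eventuallyEq ?_
  filter_upwards [eventually_mem_source hI hJ.1 hs hse] with r hr
    using (hasDerivAt_g_velocity he H hI hchart' hJ.1 hr.1 hr.2).deriv

end Momentum

end FinslerSpacetime

/-! ### Coordinate lines and their variations -/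

namespace FinslerSpacetime

section ChartExpression

variable {M : Type*} [TopologicalSpace M] [ChartedSpace E4 M]
  {e : OpenPartialHomeomorph M E4} {W : Set E4} {Φ Ψ : E4 → M} {x z : E4} {s : ℝ}

lemma line_line (z : E4) (s r : ℝ) : line (line z s) r = line z r := by
  rw [line, line_apply_zero, line, line, add_assoc, ← add_smul, add_comm (s - z 0),
    sub_add_sub_cancel]

lemma isOpen_chartDom (hW : IsOpen W) (hΦ : ContMDiffOn (𝓡 4) (𝓡 4) ∞ Φ W) :
    IsOpen (W ∩ Φ ⁻¹' e.source) :=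
  hΦ.continuousOn.isOpen_inter_preimage hW e.open_source

lemma contDiffOn_chart_comp (he : e ∈ IsManifold.maximalAtlas (𝓡 4) ∞ M)
    (hΦ : ContMDiffOn (𝓡 4) (𝓡 4) ∞ Φ W) :
    ContDiffOn ℝ ∞ (fun x => e (Φ x)) (W ∩ Φ ⁻¹' e.source) :=
  contMDiffOn_iff_contDiffOn.1 <| (contMDiffOn_of_mem_maximalAtlas he).comp
    (hΦ.mono Set.inter_subset_left) fun _ hx => hx.2

lemma mdifferentiableAt_of_smooth (hW : IsOpen W) (hΦ : ContMDiffOn (𝓡 4) (𝓡 4) ∞ Φ W)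
    (hx : x ∈ W) : MDifferentiableAt (𝓡 4) (𝓡 4) Φ x :=
  (hΦ.contMDiffAt (hW.mem_nhds hx)).mdifferentiableAt (by simp)

lemma mfderiv_chart_comp (he : e ∈ IsManifold.maximalAtlas (𝓡 4) ∞ M)
    (hΦ : MDifferentiableAt (𝓡 4) (𝓡 4) Φ x) (hxe : Φ x ∈ e.source) (w : E4) :
    mfderiv (𝓡 4) (𝓡 4) e (Φ x) (mfderiv (𝓡 4) (𝓡 4) Φ x w)
      = fderiv ℝ (fun y => e (Φ y)) x w := by
  rw [← mfderiv_eq_fderiv]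
  exact (congrArg (· w) (mfderiv_comp x
    ((mdifferentiable_of_mem_maximalAtlas he).mdifferentiableAt hxe) hΦ)).symm

lemma mdifferentiableAt_comp_line (hΦ : MDifferentiableAt (𝓡 4) (𝓡 4) Φ (line z s)) :
    MDifferentiableAt 𝓘(ℝ, ℝ) (𝓡 4) (fun r => Φ (line z r)) s :=
  hΦ.comp s (hasDerivAt_line z s).differentiableAt.mdifferentiableAt

lemma velocity_comp {α : ℝ → E4} {v : E4} (hα : HasDerivAt α v s)
    (hΦ : MDifferentiableAt (𝓡 4) (𝓡 4) Φ (α s)) :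
    velocity (fun r => Φ (α r)) s = mfderiv (𝓡 4) (𝓡 4) Φ (α s) v := by
  have hvel : mfderiv 𝓘(ℝ, ℝ) (𝓡 4) α s (1 : ℝ) = v := by
    rw [mfderiv_eq_fderiv]
    exact hα.deriv
  have hcomp : velocity (fun r => Φ (α r)) s
      = mfderiv (𝓡 4) (𝓡 4) Φ (α s) (mfderiv 𝓘(ℝ, ℝ) (𝓡 4) α s (1 : ℝ)) :=
    congrArg (fun T => T (1 : ℝ)) (mfderiv_comp s hΦ hα.differentiableAt.mdifferentiableAt)
  rw [hcomp, hvel]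

lemma velocity_comp_line (hΦ : MDifferentiableAt (𝓡 4) (𝓡 4) Φ (line z s)) :
    velocity (fun r => Φ (line z r)) s = coordVec Φ (line z s) 0 :=
  velocity_comp (hasDerivAt_line z s) hΦ

lemma coordVec_congr (h : Φ =ᶠ[𝓝 x] Ψ) (i : Fin 4) :
    (coordVec Φ x i : E4) = coordVec Ψ x i :=
  congrArg (fun T : E4 →L[ℝ] E4 => T (basisVec i)) h.mfderiv_eq

variable [IsManifold (𝓡 4) ∞ M] {S : FinslerSpacetime M}

lemma gram_congr (h : Φ =ᶠ[𝓝 x] Ψ) (i j : Fin 4) : S.gram Φ x i j = S.gram Ψ x i j := by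
  have hg {q q' : M} (hq : q = q') (v u w : E4) :
      S.g (p := q) v u w = S.g (p := q') v u w := by
    subst hq
    rfl
  refine (hg h.self_of_nhds _ _ _).trans ?_
  rw [coordVec_congr h 0, coordVec_congr h i, coordVec_congr h j]
  rfl

end ChartExpression

variable {M : Type*} [TopologicalSpace M] [ChartedSpace E4 M] [IsManifold (𝓡 4) ∞ M]
  {S : FinslerSpacetime M} {e φ : OpenPartialHomeomorph M E4} {W : Set E4} {Φ : E4 → M}
  {f : M → ℝ} {N : ∀ q : M, TangentSpace (𝓡 4) q} {x z : E4} {I : Set ℝ} {s b : ℝ}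

namespace IsContinuation

lemma eventuallyEq_symm (hΦ : S.IsContinuation φ W Φ) (hx : x ∈ φ.target) : Φ =ᶠ[𝓝 x] φ.symm :=
  Filter.eventually_of_mem (φ.open_target.mem_nhds hx) hΦ.eq_symm

lemma mdifferentiableAt (hΦ : S.IsContinuation φ W Φ) (hx : x ∈ W) :
    MDifferentiableAt (𝓡 4) (𝓡 4) Φ x :=
  mdifferentiableAt_of_smooth hΦ.isOpen hΦ.smooth hx

end IsContinuation

lemma map_mem_source_of_target (hΦ : S.IsContinuation φ W Φ) (hx : x ∈ φ.target) :
    Φ x ∈ φ.source := by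
  rw [hΦ.eq_symm x hx]
  exact φ.map_target hx

lemma mfderiv_bijective_of_target (hφ : φ ∈ IsManifold.maximalAtlas (𝓡 4) ∞ M)
    (hΦ : S.IsContinuation φ W Φ) (hx : x ∈ φ.target) :
    Function.Bijective (mfderiv (𝓡 4) (𝓡 4) Φ x) := by
  rw [(hΦ.eventuallyEq_symm hx).mfderiv_eq]
  exact (mdifferentiable_of_mem_maximalAtlas hφ).symm.mfderiv_bijective hx

lemma normal_eq (hφ : S.IsLightlikeChart f N φ) (hΦ : S.IsContinuation φ W Φ)
    (hx : x ∈ φ.target) : N (Φ x) = coordVec Φ x 0 := by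
  have hN {q q' : M} (hq : q = q') : (N q : E4) = N q' := by
    subst hq
    rfl
  exact (hN (hΦ.eq_symm x hx)).trans
    ((hφ.N_eq x hx).trans (coordVec_congr (hΦ.eventuallyEq_symm hx) 0).symm)

lemma coordVec_mem_Abar_of_target (hφ : S.IsLightlikeChart f N φ) (hΦ : S.IsContinuation φ W Φ)
    (hx : x ∈ φ.target) : (⟨Φ x, coordVec Φ x 0⟩ : TangentBundle (𝓡 4) M) ∈ S.Abar := by
  rw [← normal_eq hφ hΦ hx]
  exact hφ.admissible _ (map_mem_source_of_target hΦ hx)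

lemma gram_zero_of_target (hφ : S.IsLightlikeChart f N φ) (hΦ : S.IsContinuation φ W Φ)
    (hx : x ∈ φ.target) (i : Fin 4) : S.gram Φ x 0 i = if i = 1 then 1 else 0 := by
  rw [gram_congr (hΦ.eventuallyEq_symm hx)]
  fin_cases i
  exacts [hφ.gram_00 x hx, hφ.gram_01 x hx, hφ.gram_02 x hx, hφ.gram_03 x hx]

lemma g_mfderiv_of_target (hφ : S.IsLightlikeChart f N φ) (hΦ : S.IsContinuation φ W Φ)
    (hx : x ∈ φ.target) (w : E4) :
    S.g (coordVec Φ x 0) (coordVec Φ x 0) (mfderiv (𝓡 4) (𝓡 4) Φ x w) = w 1 := by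
  obtain ⟨G, B, -, hG⟩ := S.exists_bilinForm (coordVec_mem_Abar_of_target hφ hΦ hx)
  have hframe (i : Fin 4) : G (coordVec Φ x 0) (mfderiv (𝓡 4) (𝓡 4) Φ x (basisVec i))
      = if i = 1 then 1 else 0 := (hG _ _).symm.trans (gram_zero_of_target hφ hΦ hx i)
  calc S.g (coordVec Φ x 0) (coordVec Φ x 0) (mfderiv (𝓡 4) (𝓡 4) Φ x w)
      = G (coordVec Φ x 0) (mfderiv (𝓡 4) (𝓡 4) Φ x w) := hG _ _
    _ = ∑ i, w i • G (coordVec Φ x 0) (mfderiv (𝓡 4) (𝓡 4) Φ x (basisVec i)) :=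
      map_eq_sum_basisVec ((G (coordVec Φ x 0)).comp (mfderiv (𝓡 4) (𝓡 4) Φ x).toLinearMap) w
    _ = w 1 := by simp [hframe]

lemma fderiv_chart_surjective_of_target (hφ : φ ∈ IsManifold.maximalAtlas (𝓡 4) ∞ M)
    (hΦ : S.IsContinuation φ W Φ) (he : e ∈ IsManifold.maximalAtlas (𝓡 4) ∞ M)
    (hx : x ∈ φ.target) (hxe : Φ x ∈ e.source) :
    Function.Surjective (fderiv ℝ (fun y => e (Φ y)) x) := by
  have hsurj := ((mdifferentiable_of_mem_maximalAtlas he).mfderiv_bijective hxe).2.comp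
    (mfderiv_bijective_of_target hφ hΦ hx).2
  intro v
  obtain ⟨w, hw⟩ := hsurj v
  exact ⟨w, (mfderiv_chart_comp he (hΦ.mdifferentiableAt (hΦ.target_subset hx)) hxe w).symm.trans
    hw⟩

lemma isGeodesicAt_line_of_target (hφ : S.IsLightlikeChart f N φ) (hΦ : S.IsContinuation φ W Φ)
    (hs : line z s ∈ φ.target) : S.IsGeodesicAt (fun r => Φ (line z r)) s := by
  have hdiff (y : E4) (hy : y ∈ φ.target) := hΦ.mdifferentiableAt (hΦ.target_subset hy)
  refine ⟨?_, fun e he hse => ?_⟩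
  · rw [velocity_comp_line (hdiff _ hs)]
    exact coordVec_mem_Abar_of_target hφ hΦ hs
  obtain ⟨U, A, H, hlift⟩ := S.exists_isChartFinsler he
  have hsmooth : ContMDiffOn (𝓡 4) (𝓡 4) ∞ Φ φ.target := hΦ.smooth.mono hΦ.target_subset
  have hmem (y : E4) (hy : y ∈ φ.target ∩ Φ ⁻¹' e.source) :
      (e (Φ y), fderiv ℝ (fun y => e (Φ y)) y (basisVec 0)) ∈ U ∩ closure A := by
    rw [← mfderiv_chart_comp he (hdiff y hy.1) hy.2]
    exact hlift ⟨Φ y, coordVec Φ y 0⟩ hy.2 (coordVec_mem_Abar_of_target hφ hΦ hy.1)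
  have hnull (y : E4) (hy : y ∈ φ.target ∩ Φ ⁻¹' e.source) :
      S.coordL e (e (Φ y)) (fderiv ℝ (fun y => e (Φ y)) y (basisVec 0)) = 0 := by
    rw [← mfderiv_chart_comp he (hdiff y hy.1) hy.2, S.coordL_mfderiv he hy.2]
    exact (congrArg (fun v => S.L ⟨Φ y, v⟩) (normal_eq hφ hΦ hy.1)).symm.trans
      (hφ.lightlike _ (map_mem_source_of_target hΦ hy.1))
  have hframe (y : E4) (hy : y ∈ φ.target ∩ Φ ⁻¹' e.source) (w : E4) :
      ∑ l, dDir (S.coordL e) (e (Φ y)) (fderiv ℝ (fun y => e (Φ y)) y (basisVec 0)) l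
        * fderiv ℝ (fun y => e (Φ y)) y w l = 2 * w 1 := by
    have hg := g_mfderiv_of_target hφ hΦ hy.1 w
    rw [S.g_eq_fundTensor_coordL he hy.2, coordVec] at hg
    simp only [mfderiv_chart_comp he (hdiff y hy.1) hy.2] at hg
    rw [H.smooth.fundTensor_eq_matrixForm H.isOpen_dom (hmem y hy).1,
      H.matrixForm_self (hmem y hy)] at hg
    linarith
  have hgeodesic := H.geodesic_of_null_frame (isOpen_chartDom φ.open_target hsmooth)
    (contDiffOn_chart_comp he hsmooth) hnull hframe ⟨hs, hse⟩ (hmem _ ⟨hs, hse⟩)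
    (fderiv_chart_surjective_of_target hφ.mem_atlas hΦ he hs hse)
  rw [covDeriv_velocity, hgeodesic, neg_add_cancel]

lemma isGeodesicAt_line (hφ : S.IsLightlikeChart f N φ) (hΦ : S.IsContinuation φ W Φ)
    (hs : line z s ∈ W) : S.IsGeodesicAt (fun r => Φ (line z r)) s := by
  by_cases hst : line z s ∈ φ.target
  · exact isGeodesicAt_line_of_target hφ hΦ hst
  · simpa only [line_line, line_apply_zero] using hΦ.geodesic (line z s) ⟨hs, hst⟩

lemma coordVec_mem_Abar (hφ : S.IsLightlikeChart f N φ) (hΦ : S.IsContinuation φ W Φ)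
    (hx : x ∈ W) : (⟨Φ x, coordVec Φ x 0⟩ : TangentBundle (𝓡 4) M) ∈ S.Abar := by
  have hx0 : line x (x 0) ∈ W := by rwa [line_self]
  have hvel := (isGeodesicAt_line hφ hΦ hx0).1
  rw [velocity_comp_line (hΦ.mdifferentiableAt hx0)] at hvel
  have hself : (⟨Φ (line x (x 0)), coordVec Φ (line x (x 0)) 0⟩ : TangentBundle (𝓡 4) M)
      = ⟨Φ x, coordVec Φ x 0⟩ := by rw [line_self]
  exact hself ▸ hvel

/-- The variation field of the coordinate lines `r ↦ Φ (line (z + u w) r)` about the line through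
`z`, plus `c` times the field of the reparametrizations which fix the time `b`. -/
def variationField (Φ : E4 → M) (z w : E4) (c b s : ℝ) : TangentSpace (𝓡 4) (Φ (line z s)) :=
  mfderiv (𝓡 4) (𝓡 4) Φ (line z s) (w + (c * (s - b)) • basisVec 0)

lemma chartField_variationField (he : e ∈ IsManifold.maximalAtlas (𝓡 4) ∞ M)
    (hΦ : S.IsContinuation φ W Φ) (hs : line z s ∈ W) (hse : Φ (line z s) ∈ e.source)
    (w : E4) (c b : ℝ) :
    chartField e (fun r => Φ (line z r)) (variationField Φ z w c b) s
      = fderiv ℝ (fun y => e (Φ y)) (line z s) w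
        + c • ((s - b) • deriv (fun r => e (Φ (line z r))) s) := by
  rw [chartField, variationField, mfderiv_chart_comp he (hΦ.mdifferentiableAt hs) hse, map_add,
    map_smul, deriv_comp_line (F := fun y => e (Φ y)) (isOpen_chartDom hΦ.isOpen hΦ.smooth)
      (contDiffOn_chart_comp he hΦ.smooth) ⟨hs, hse⟩, mul_smul]

lemma contMDiffOn_variationField (hΦ : S.IsContinuation φ W Φ) (hI : ∀ s ∈ I, line z s ∈ W)
    (w : E4) (c b : ℝ) : ContMDiffOn 𝓘(ℝ, ℝ) (𝓡 4).tangent ∞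
      (fun s => (⟨Φ (line z s), variationField Φ z w c b s⟩ : TangentBundle (𝓡 4) M)) I := by
  have hlift : ContDiff ℝ ∞ (fun s : ℝ => (line z s, w + (c * (s - b)) • basisVec 0)) :=
    (contDiff_line z).prodMk (by fun_prop)
  exact (contMDiffOn_liftFrom hΦ.isOpen hΦ.smooth).comp hlift.contMDiff.contMDiffOn hI

lemma linearizedGeodesicEq_variationField (hφ : S.IsLightlikeChart f N φ)
    (hΦ : S.IsContinuation φ W Φ) (he : e ∈ IsManifold.maximalAtlas (𝓡 4) ∞ M)
    (hs : line z s ∈ W) (hse : Φ (line z s) ∈ e.source) (w : E4) (c b : ℝ) :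
    LinearizedGeodesicEq (S.coordL e) (fun r => e (Φ (line z r)))
      (chartField e (fun r => Φ (line z r)) (variationField Φ z w c b)) s := by
  obtain ⟨U, A, H, hchart⟩ := S.exists_chart_geodesics he
  have hV := isOpen_chartDom (e := e) hΦ.isOpen hΦ.smooth
  have hψ := contDiffOn_chart_comp he hΦ.smooth
  have hψs : ContDiffAt ℝ ∞ (fun y => e (Φ y)) (line z s) := hψ.contDiffAt (hV.mem_nhds ⟨hs, hse⟩)
  have hgeo (z : E4) (r : ℝ) (hr : line z r ∈ W ∩ Φ ⁻¹' e.source) :=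
    hchart (fun r => Φ (line z r)) r (mdifferentiableAt_comp_line (hΦ.mdifferentiableAt hr.1)) hr.2
      (isGeodesicAt_line hφ hΦ hr.1)
  have hev := eventually_line_mem hV ⟨hs, hse⟩
  have hx : ContDiffAt ℝ ∞ (fun r => e (Φ (line z r))) s := contDiffAt_comp_line hψs
  have hrescale : ContDiffAt ℝ ∞ (fun r => (r - b) • deriv (fun r => e (Φ (line z r))) r) s :=
    (contDiffAt_id.sub contDiffAt_const).smul (contDiffAt_deriv_of_smooth hx)
  refine LinearizedGeodesicEq.congr (.add
    (contDiffAt_comp_line (contDiffAt_fderiv_apply_const hψs w)) (hrescale.const_smul c)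
    (H.linearizedGeodesicEq_of_variation hV hψ ⟨hs, hse⟩ (hgeo z s ⟨hs, hse⟩).1.1
      (fun z r hr => (hgeo z r hr).2) w)
    (.const_smul c hrescale (H.linearizedGeodesicEq_rescaling hx (hgeo z s ⟨hs, hse⟩).1
      (hev.mono fun r hr => (hgeo z r hr).2)))) ?_
  exact hev.mono fun r hr => chartField_variationField he hΦ hr.1 hr.2 w c b

theorem isJacobiField_variationField (hφ : S.IsLightlikeChart f N φ)
    (hΦ : S.IsContinuation φ W Φ) (hI : IsOpen I) (hIW : ∀ s ∈ I, line z s ∈ W) (w : E4)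
    (c b : ℝ) : S.IsJacobiField (fun s => Φ (line z s)) I (variationField Φ z w c b) :=
  (isJacobiField_iff hI fun s hs => isGeodesicAt_line hφ hΦ (hIW s hs)).2
    ⟨contMDiffOn_variationField hΦ hIW w c b, fun _ he s hs hse =>
      linearizedGeodesicEq_variationField hφ hΦ he (hIW s hs) hse w c b⟩

/-- The momentum `g(γ', J)` of a Jacobi field is affine in the parameter, and it is constant near
`b` when `J` is a coordinate field. -/
theorem g_mfderiv_line (hφ : S.IsLightlikeChart f N φ) (hΦ : S.IsContinuation φ W Φ)
    (hI : IsOpen I) (hI' : I.OrdConnected) (hIW : ∀ s ∈ I, line z s ∈ W) (hb : b ∈ I)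
    (hbφ : line z b ∈ φ.target) (hs : s ∈ I) (w : E4) :
    S.g (coordVec Φ (line z s) 0) (coordVec Φ (line z s) 0) (mfderiv (𝓡 4) (𝓡 4) Φ (line z s) w)
      = w 1 := by
  have hfield (r : ℝ) (hr : line z r ∈ W) :
      S.g (velocity (fun r => Φ (line z r)) r) (velocity (fun r => Φ (line z r)) r)
        (variationField Φ z w 0 b r)
      = S.g (coordVec Φ (line z r) 0) (coordVec Φ (line z r) 0)
        (mfderiv (𝓡 4) (𝓡 4) Φ (line z r) w) := by
    rw [velocity_comp_line (hΦ.mdifferentiableAt hr), variationField, zero_mul, zero_smul, add_zero]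
  have hconst : (fun r => S.g (velocity (fun r => Φ (line z r)) r)
      (velocity (fun r => Φ (line z r)) r) (variationField Φ z w 0 b r)) =ᶠ[𝓝 b] fun _ => w 1 := by
    filter_upwards [eventually_line_mem φ.open_target hbφ] with r hr
    rw [hfield r (hΦ.target_subset hr), g_mfderiv_of_target hφ hΦ hr]
  have haffine := (isJacobiField_variationField hφ hΦ hI hIW w 0 b).affine hI hI'
    (fun s hs => isGeodesicAt_line hφ hΦ (hIW s hs)) hb hs
  have hslope : deriv (fun r => S.g (velocity (fun r => Φ (line z r)) r)
      (velocity (fun r => Φ (line z r)) r) (variationField Φ z w 0 b r)) b = 0 := by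
    rw [hconst.deriv_eq, deriv_const]
  refine (hfield s (hIW s hs)).symm.trans (haffine.trans ?_)
  rw [hslope, zero_mul, add_zero]
  exact hconst.self_of_nhds

end FinslerSpacetime

/-! ### The zeros of `Δ` -/

lemma exists_smul_eq_iff_exists_map_eq_zero {V : Type*} [AddCommGroup V] [Module ℝ V]
    {T : E4 →ₗ[ℝ] V} (h0 : T (basisVec 0) ≠ 0) (h1 : ∀ w, T w = 0 → w 1 = 0) :
    (∃ a b μ : ℝ, (a ≠ 0 ∨ b ≠ 0) ∧ a • T (basisVec 2) + b • T (basisVec 3) = μ • T (basisVec 0))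
      ↔ ∃ w ≠ 0, T w = 0 := by
  constructor
  · rintro ⟨a, b, μ, hab, h⟩
    refine ⟨a • basisVec 2 + b • basisVec 3 - μ • basisVec 0, fun hw => ?_, by simp [h]⟩
    have ha := congrArg (fun v : E4 => v 2) hw
    have hb := congrArg (fun v : E4 => v 3) hw
    simp only [basisVec_apply, PiLp.sub_apply, PiLp.add_apply, PiLp.smul_apply, PiLp.zero_apply]
      at ha hb
    simp_all
  · rintro ⟨w, hw, hTw⟩
    have hsum : w 0 • T (basisVec 0) + w 2 • T (basisVec 2) + w 3 • T (basisVec 3) = 0 := by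
      simpa [map_eq_sum_basisVec T w, Fin.sum_univ_four, h1 w hTw] using hTw
    refine ⟨w 2, w 3, -w 0, ?_, by rw [neg_smul, eq_neg_iff_add_eq_zero, ← hsum]; abel⟩
    by_contra! h23
    have hw0 : w 0 = 0 := by simpa [h23, h0] using hsum
    refine hw ?_
    ext i
    fin_cases i
    exacts [hw0, h1 w hTw, h23.1, h23.2]

namespace FinslerSpacetime

section TangentVectors

variable {M : Type*} [TopologicalSpace M] [ChartedSpace E4 M]
  {e φ : OpenPartialHomeomorph M E4} {b c : ℝ}

/-- The coordinate expression of the tangent vector `u` in the chart `e`, as a vector of `ℝ⁴`. -/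
abbrev chartVec (e : OpenPartialHomeomorph M E4) {q : M} (u : TangentSpace (𝓡 4) q) : E4 :=
  mfderiv (𝓡 4) (𝓡 4) e q u

lemma IsCurveIn.apply_zero {P : Set M} {q : M} {u : TangentSpace (𝓡 4) q} {α : ℝ → M}
    (hα : IsCurveIn P q u α) : α 0 = q :=
  congrArg (fun z : TangentBundle (𝓡 4) M => z.1) hα.2.2

lemma IsCurveIn.hasDerivAt_chart (he : e ∈ IsManifold.maximalAtlas (𝓡 4) ∞ M) {P : Set M} {q : M}
    (hq : q ∈ e.source) {u : TangentSpace (𝓡 4) q} {α : ℝ → M} (hα : IsCurveIn P q u α) :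
    HasDerivAt (fun r => e (α r)) (chartVec e u) 0 := by
  have hq0 : α 0 ∈ e.source := by rwa [hα.apply_zero]
  have hαd : MDifferentiableAt 𝓘(ℝ, ℝ) (𝓡 4) α 0 := hα.1.mdifferentiableAt (by simp)
  have hed := (mdifferentiable_of_mem_maximalAtlas he).mdifferentiableAt hq0
  have hvel : (liftTo e ⟨α 0, velocity α 0⟩).2 = (liftTo e ⟨q, u⟩).2 := by rw [hα.2.2]
  exact (hed.comp (0 : ℝ) hαd).differentiableAt.hasDerivAt.congr_deriv
    ((mfderiv_chart_velocity he hαd hq0).symm.trans hvel)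

lemma chartVec_of_tangentTo (hφ : φ ∈ IsManifold.maximalAtlas (𝓡 4) ∞ M) {q : M}
    (hq : q ∈ φ.source) {w : TangentSpace (𝓡 4) q} (hw : w ∈ tangentTo (slice φ b c) q) :
    chartVec φ w 0 = 0 ∧ chartVec φ w 1 = 0 := by
  obtain ⟨α, hα⟩ := hw
  have hcoord := hasDerivAt_euclidean.1 (hα.hasDerivAt_chart hφ hq)
  constructor
  · refine (hcoord 0).unique ((hasDerivAt_const (0 : ℝ) b).congr_of_eventuallyEq ?_)
    filter_upwards [hα.2.1] with r hr using hr.2.1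
  · refine (hcoord 1).unique ((hasDerivAt_const (0 : ℝ) c).congr_of_eventuallyEq ?_)
    filter_upwards [hα.2.1] with r hr using hr.2.2

end TangentVectors

variable {M : Type*} [TopologicalSpace M] [ChartedSpace E4 M] [IsManifold (𝓡 4) ∞ M]
  {S : FinslerSpacetime M} {φ : OpenPartialHomeomorph M E4} {W : Set E4} {Φ : E4 → M}
  {f : M → ℝ} {N : ∀ q : M, TangentSpace (𝓡 4) q} {x : E4} {b c : ℝ}

theorem delta_eq_zero_iff (hA : (⟨Φ x, coordVec Φ x 0⟩ : TangentBundle (𝓡 4) M) ∈ S.Abar)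
    (hg : ∀ w : E4, S.g (coordVec Φ x 0) (coordVec Φ x 0) (mfderiv (𝓡 4) (𝓡 4) Φ x w) = w 1) :
    S.Delta Φ x = 0 ↔ ∃ w : E4, w ≠ 0 ∧ mfderiv (𝓡 4) (𝓡 4) Φ x w = 0 := by
  obtain ⟨G, B, hB, hG⟩ := S.exists_bilinForm hA
  have hGw (w : E4) : G (coordVec Φ x 0) (mfderiv (𝓡 4) (𝓡 4) Φ x w) = w 1 :=
    (hG _ _).symm.trans (hg w)
  have hnull : G (coordVec Φ x 0) (coordVec Φ x 0) = 0 := (hGw _).trans (by simp [basisVec_apply])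
  have hX : G (coordVec Φ x 0) (coordVec Φ x 2) = 0 := (hGw _).trans (by simp [basisVec_apply])
  have hY : G (coordVec Φ x 0) (coordVec Φ x 3) = 0 := (hGw _).trans (by simp [basisVec_apply])
  simp only [Delta, Matrix.det_fin_two_of, gram, hG]
  rw [Real.sqrt_eq_zero (hB.gram_nonneg hA.2 hnull hX hY), hB.gram_eq_zero_iff hA.2 hnull hX hY]
  refine exists_smul_eq_iff_exists_map_eq_zero (T := (mfderiv (𝓡 4) (𝓡 4) Φ x).toLinearMap) hA.2
    fun w hw => ?_
  have hw' : mfderiv (𝓡 4) (𝓡 4) Φ x w = 0 := hw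
  rw [← hGw w, hw', map_zero]

/-! ### The lightlike chart -/

lemma chart_apply_target (hΦ : S.IsContinuation φ W Φ) (hx : x ∈ φ.target) : φ (Φ x) = x := by
  rw [hΦ.eq_symm x hx, φ.right_inv hx]

lemma eq_continuation_of_mem_source (hΦ : S.IsContinuation φ W Φ) {q : M} (hq : q ∈ φ.source) :
    Φ (φ q) = q := by
  rw [hΦ.eq_symm _ (φ.map_source hq), φ.left_inv hq]

lemma fderiv_chart_target (hΦ : S.IsContinuation φ W Φ) (hx : x ∈ φ.target) (v : E4) :
    fderiv ℝ (fun y => φ (Φ y)) x v = v := by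
  have hid : (fun y => φ (Φ y)) =ᶠ[𝓝 x] id :=
    Filter.eventually_of_mem (φ.open_target.mem_nhds hx) fun _ hy => chart_apply_target hΦ hy
  rw [hid.fderiv_eq, fderiv_id]
  rfl

lemma fderiv_fderiv_chart_target (hΦ : S.IsContinuation φ W Φ) (hx : x ∈ φ.target) (v w : E4) :
    fderiv ℝ (fun y => fderiv ℝ (fun y => φ (Φ y)) y v) x w = 0 := by
  have hconst : (fun y => fderiv ℝ (fun y => φ (Φ y)) y v) =ᶠ[𝓝 x] fun _ => v :=
    Filter.eventually_of_mem (φ.open_target.mem_nhds hx) fun _ hy => fderiv_chart_target hΦ hy v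
  rw [hconst.fderiv_eq, fderiv_fun_const]
  rfl

lemma chartVec_mfderiv_target (hφ : φ ∈ IsManifold.maximalAtlas (𝓡 4) ∞ M)
    (hΦ : S.IsContinuation φ W Φ) (hx : x ∈ φ.target) (v : E4) :
    chartVec φ (mfderiv (𝓡 4) (𝓡 4) Φ x v) = v :=
  (mfderiv_chart_comp hφ (hΦ.mdifferentiableAt (hΦ.target_subset hx))
    (map_mem_source_of_target hΦ hx) v).trans (fderiv_chart_target hΦ hx v)

lemma g_coordVec_of_target (hφ : S.IsLightlikeChart f N φ) (hΦ : S.IsContinuation φ W Φ)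
    (hx : x ∈ φ.target) (u : TangentSpace (𝓡 4) (Φ x)) :
    S.g (coordVec Φ x 0) (coordVec Φ x 0) u
      = chartVec φ u 1 := by
  obtain ⟨v, rfl⟩ := (mfderiv_bijective_of_target hφ.mem_atlas hΦ hx).2 u
  exact (g_mfderiv_of_target hφ hΦ hx v).trans
    (congrArg (fun w : E4 => w 1) (chartVec_mfderiv_target hφ.mem_atlas hΦ hx v)).symm

/-! ### Curves in the slices -/

lemma g_normal_of_tangentTo (hφ : S.IsLightlikeChart f N φ) (hΦ : S.IsContinuation φ W Φ)
    {q : M} (hq : q ∈ φ.source) {w : TangentSpace (𝓡 4) q}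
    (hw : w ∈ tangentTo (slice φ b c) q) : S.g (N q) (N q) w = 0 := by
  obtain ⟨x, hx, rfl⟩ : ∃ x ∈ φ.target, Φ x = q :=
    ⟨φ q, φ.map_source hq, eq_continuation_of_mem_source hΦ hq⟩
  rw [normal_eq hφ hΦ hx, g_coordVec_of_target hφ hΦ hx]
  exact (chartVec_of_tangentTo hφ.mem_atlas hq hw).2

lemma mfderiv_mem_tangentTo_slice (hΦ : S.IsContinuation φ W Φ) (hx : x ∈ φ.target) {v : E4}
    (h0 : v 0 = 0) (h1 : v 1 = 0) :
    mfderiv (𝓡 4) (𝓡 4) Φ x v ∈ tangentTo (slice φ (x 0) (x 1)) (Φ x) := by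
  have hray : HasDerivAt (fun t : ℝ => x + t • v) v 0 := by
    simpa using ((hasDerivAt_id (0 : ℝ)).smul_const v).const_add x
  have hx0 : x + (0 : ℝ) • v = x := by rw [zero_smul, add_zero]
  have hΦx : ContMDiffAt (𝓡 4) (𝓡 4) ∞ Φ (x + (0 : ℝ) • v) := by
    rw [hx0]
    exact hΦ.smooth.contMDiffAt (hΦ.isOpen.mem_nhds (hΦ.target_subset hx))
  refine ⟨fun t => Φ (x + t • v), hΦx.comp (0 : ℝ) ?_, ?_, ?_⟩
  · exact (show ContDiff ℝ ∞ fun t : ℝ => x + t • v by fun_prop).contDiffAt.contMDiffAt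
  · have hmem : ∀ᶠ t in 𝓝 (0 : ℝ), x + t • v ∈ φ.target :=
      hray.continuousAt.eventually (φ.open_target.mem_nhds (by
        change x + (0 : ℝ) • v ∈ φ.target
        rwa [hx0]))
    filter_upwards [hmem] with t ht
    refine ⟨map_mem_source_of_target hΦ ht, ?_⟩
    rw [chart_apply_target hΦ ht]
    simp [h0, h1]
  · rw [velocity_comp hray (hΦx.mdifferentiableAt (by simp))]
    change (⟨Φ (x + (0 : ℝ) • v), mfderiv (𝓡 4) (𝓡 4) Φ (x + (0 : ℝ) • v) v⟩ :
      TangentBundle (𝓡 4) M) = ⟨Φ x, mfderiv (𝓡 4) (𝓡 4) Φ x v⟩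
    rw [hx0]

end FinslerSpacetime

/-! ### Jacobi fields of the slices -/

lemma LocalFinsler.IsChartFinsler.covDeriv_eq_add {ℓ : E4 → E4 → ℝ} {U A : Set (E4 × E4)}
    (H : IsChartFinsler ℓ U A) {x y X Y : ℝ → E4} {s r : ℝ} (h : (x s, deriv x s) ∈ U)
    (hxy : y r = x s) (hY : Y r = deriv x s) (hX : deriv y r = X s) :
    covDeriv ℓ x (deriv x) X s = covDeriv ℓ y Y Y r + (deriv X s - deriv Y r) := by
  ext i
  have hsymm : ∑ j, ∑ k, christoffel ℓ (x s) (deriv x s) i j k * deriv x s j * X s k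
      = ∑ j, ∑ k, christoffel ℓ (x s) (deriv x s) i j k * X s j * deriv x s k := by
    rw [Finset.sum_comm]
    refine Finset.sum_congr rfl fun j _ => Finset.sum_congr rfl fun k _ => ?_
    rw [H.christoffel_symm h i k j]
    ring
  simp only [covDeriv, PiLp.add_apply, PiLp.sub_apply, hxy, hY, hX, hsymm]
  ring

namespace FinslerSpacetime

lemma line_apply_one (z : E4) (s : ℝ) : line z s 1 = z 1 := by simp [line, basisVec_apply]

lemma variationField_base {M : Type*} [TopologicalSpace M] [ChartedSpace E4 M] {Φ : E4 → M}
    (z w : E4) (c b : ℝ) :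
    variationField Φ z w c b b = mfderiv (𝓡 4) (𝓡 4) Φ (line z b) w := by
  rw [variationField, sub_self, mul_zero, zero_smul, add_zero]

variable {M : Type*} [TopologicalSpace M] [ChartedSpace E4 M] [IsManifold (𝓡 4) ∞ M]
  {S : FinslerSpacetime M} {e φ : OpenPartialHomeomorph M E4} {W : Set E4} {Φ : E4 → M}
  {f : M → ℝ} {N : ∀ q : M, TangentSpace (𝓡 4) q} {x z : E4} {I : Set ℝ} {b t : ℝ}

lemma chartVec_normal (hφ : S.IsLightlikeChart f N φ) (hΦ : S.IsContinuation φ W Φ)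
    (he : e ∈ IsManifold.maximalAtlas (𝓡 4) ∞ M) {q : M} (hq : q ∈ φ.source) (hqe : q ∈ e.source) :
    chartVec e (N q) = fderiv ℝ (fun y => e (Φ y)) (φ q) (basisVec 0) := by
  obtain ⟨x, hx, rfl⟩ : ∃ x ∈ φ.target, Φ x = q :=
    ⟨φ q, φ.map_source hq, eq_continuation_of_mem_source hΦ hq⟩
  rw [chart_apply_target hΦ hx, normal_eq hφ hΦ hx]
  exact mfderiv_chart_comp he (hΦ.mdifferentiableAt (hΦ.target_subset hx)) hqe _

lemma IsCurveIn.hasDerivAt_chartVec_normal (hφ : S.IsLightlikeChart f N φ)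
    (hΦ : S.IsContinuation φ W Φ) (he : e ∈ IsManifold.maximalAtlas (𝓡 4) ∞ M) {q : M}
    (hq : q ∈ φ.source) (hqe : q ∈ e.source) {b c : ℝ} {u : TangentSpace (𝓡 4) q} {α : ℝ → M}
    (hα : IsCurveIn (slice φ b c) q u α) :
    HasDerivAt (fun r => chartVec e (N (α r)))
      (fderiv ℝ (fun y => fderiv ℝ (fun y => e (Φ y)) y (basisVec 0)) (φ q) (chartVec φ u)) 0 := by
  have hqΦ : φ q ∈ W ∩ Φ ⁻¹' e.source :=
    ⟨hΦ.target_subset (φ.map_source hq),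
      by rwa [Set.mem_preimage, eq_continuation_of_mem_source hΦ hq]⟩
  have hψ : ContDiffAt ℝ ∞ (fun y => e (Φ y)) (φ q) :=
    (contDiffOn_chart_comp he hΦ.smooth).contDiffAt
      ((isOpen_chartDom hΦ.isOpen hΦ.smooth).mem_nhds hqΦ)
  have hcomp : HasDerivAt (fun r => fderiv ℝ (fun y => e (Φ y)) (φ (α r)) (basisVec 0))
      (fderiv ℝ (fun y => fderiv ℝ (fun y => e (Φ y)) y (basisVec 0)) (φ q) (chartVec φ u)) 0 :=
    HasFDerivAt.comp_hasDerivAt_of_eq (0 : ℝ)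
      ((contDiffAt_fderiv_apply_const hψ _).differentiableAt (by simp)).hasFDerivAt
      (hα.hasDerivAt_chart hφ.mem_atlas hq) (by rw [hα.apply_zero])
  refine hcomp.congr_of_eventuallyEq ?_
  filter_upwards [hα.2.1, hα.1.continuousAt.eventually
    (e.open_source.mem_nhds (by rwa [hα.apply_zero]))] with r hr hre
  exact chartVec_normal hφ hΦ he hr.1 hre

lemma fundTensor_deriv_line (hΦ : S.IsContinuation φ W Φ)
    (he : e ∈ IsManifold.maximalAtlas (𝓡 4) ∞ M) (hbW : line z b ∈ W)
    (hbe : Φ (line z b) ∈ e.source) (u w : TangentSpace (𝓡 4) (Φ (line z b))) :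
    fundTensor (S.coordL e (e (Φ (line z b)))) (deriv (fun r => e (Φ (line z r))) b)
      (chartVec e u) (chartVec e w) = S.g (coordVec Φ (line z b) 0) u w := by
  have hΦb := hΦ.mdifferentiableAt hbW
  rw [S.g_eq_fundTensor_coordL he hbe, ← velocity_comp_line hΦb]
  exact congrArg (fundTensor _ · _ _)
    (mfderiv_chart_velocity he (mdifferentiableAt_comp_line hΦb) hbe).symm

/-- The Christoffel terms of the two covariant derivatives agree, because `Γ` is symmetric. -/
lemma IsCurveIn.tangential_iff (hφ : S.IsLightlikeChart f N φ) (hΦ : S.IsContinuation φ W Φ)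
    (he : e ∈ IsManifold.maximalAtlas (𝓡 4) ∞ M) (hb : line z b ∈ φ.target)
    (hbe : Φ (line z b) ∈ e.source) {b' c : ℝ} {J : ∀ s, TangentSpace (𝓡 4) (Φ (line z s))}
    {α : ℝ → M} (hα : IsCurveIn (slice φ b' c) (Φ (line z b)) (J b) α)
    {d w : TangentSpace (𝓡 4) (Φ (line z b))}
    (hd : chartVec e d = deriv (chartField e (fun r => Φ (line z r)) J) b
      - fderiv ℝ (fun y => fderiv ℝ (fun y => e (Φ y)) y (basisVec 0)) (line z b)
        (chartVec φ (J b))) :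
    fundTensor (S.coordL e (e (Φ (line z b)))) (deriv (fun r => e (Φ (line z r))) b)
        (covDeriv (S.coordL e) (fun r => e (Φ (line z r))) (deriv fun r => e (Φ (line z r)))
          (chartField e (fun r => Φ (line z r)) J) b) (chartVec e w)
      = fundTensor (S.coordL e (e (Φ (line z b)))) (deriv (fun r => e (Φ (line z r))) b)
        (covDeriv (S.coordL e) (fun r => e (α r)) (fun r => chartVec e (N (α r)))
          (fun r => chartVec e (N (α r))) 0) (chartVec e w)
    ↔ S.g (coordVec Φ (line z b) 0) d w = 0 := by
  obtain ⟨U, A, H, hchart⟩ := S.exists_chart_geodesics he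
  have hbW := hΦ.target_subset hb
  have hbφ := map_mem_source_of_target hΦ hb
  have hU := (hchart (fun r => Φ (line z r)) b
    (mdifferentiableAt_comp_line (hΦ.mdifferentiableAt hbW)) hbe (isGeodesicAt_line hφ hΦ hbW)).1.1
  have hN := hα.hasDerivAt_chartVec_normal hφ hΦ he hbφ hbe
  have hN0 : chartVec e (N (α 0)) = deriv (fun r => e (Φ (line z r))) b := by
    rw [hα.apply_zero, chartVec_normal hφ hΦ he hbφ hbe, chart_apply_target hΦ hb]
    exact (deriv_comp_line (F := fun y => e (Φ y)) (isOpen_chartDom hΦ.isOpen hΦ.smooth)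
      (contDiffOn_chart_comp he hΦ.smooth) ⟨hbW, hbe⟩).symm
  rw [chart_apply_target hΦ hb] at hN
  have hcov := H.covDeriv_eq_add (x := fun r => e (Φ (line z r))) (y := fun r => e (α r))
    (X := chartField e (fun r => Φ (line z r)) J) (Y := fun r => chartVec e (N (α r))) hU
    (congrArg e hα.apply_zero) hN0 (hα.hasDerivAt_chart he hbe).deriv
  rw [hN.deriv, ← hd] at hcov
  rw [hcov, ← fundTensor_deriv_line hΦ he hbW hbe]
  simp only [H.smooth.fundTensor_eq_matrixForm H.isOpen_dom hU, map_add, LinearMap.add_apply,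
    add_eq_left]

lemma hasDerivAt_chartField_variationField (he : e ∈ IsManifold.maximalAtlas (𝓡 4) ∞ M)
    (hΦ : S.IsContinuation φ W Φ) (hb : line z b ∈ W) (hbe : Φ (line z b) ∈ e.source) (w : E4)
    (c : ℝ) :
    HasDerivAt (chartField e (fun r => Φ (line z r)) (variationField Φ z w c b))
      (fderiv ℝ (fun y => fderiv ℝ (fun y => e (Φ y)) y (basisVec 0)) (line z b) w
        + c • fderiv ℝ (fun y => e (Φ y)) (line z b) (basisVec 0)) b := by
  have hV := isOpen_chartDom (e := e) hΦ.isOpen hΦ.smooth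
  have hψ := contDiffOn_chart_comp he hΦ.smooth
  have hψb : ContDiffAt ℝ ∞ (fun y => e (Φ y)) (line z b) := hψ.contDiffAt (hV.mem_nhds ⟨hb, hbe⟩)
  have hfirst : HasDerivAt (fun r => fderiv ℝ (fun y => e (Φ y)) (line z r) w) _ b :=
    hasDerivAt_comp_line (contDiffAt_fderiv_apply_const hψb w)
  have hsecond : HasDerivAt (fun r => (r - b) • deriv (fun r => e (Φ (line z r))) r) _ b :=
    ((hasDerivAt_id b).sub_const b).smul (hasDerivAt_deriv_of_smooth (contDiffAt_comp_line hψb))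
  refine ((hfirst.add (hsecond.const_smul c)).congr_deriv ?_).congr_of_eventuallyEq ?_
  · rw [fderiv_fderiv_apply_comm (hψb.of_le (by norm_cast)) w,
      deriv_comp_line (F := fun y => e (Φ y)) hV hψ ⟨hb, hbe⟩]
    simp
  · filter_upwards [eventually_line_mem hV ⟨hb, hbe⟩] with r hr
      using chartField_variationField he hΦ hr.1 hr.2 w c b

theorem isSubmanifoldJacobiField_variationField (hφ : S.IsLightlikeChart f N φ)
    (hΦ : S.IsContinuation φ W Φ) (hI : IsOpen I) (hIW : ∀ s ∈ I, line z s ∈ W)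
    (hb : line z b ∈ φ.target) {w : E4} (hw0 : w 0 = 0) (hw1 : w 1 = 0) (c : ℝ) :
    S.IsSubmanifoldJacobiField (slice φ b (z 1)) N (fun s => Φ (line z s)) I b
      (variationField Φ z w c b) := by
  refine ⟨isJacobiField_variationField hφ hΦ hI hIW w c b, ?_, fun e he hbe α hα u hu => ?_⟩
  · simpa only [variationField_base, line_apply_zero, line_apply_one]
      using mfderiv_mem_tangentTo_slice hΦ hb hw0 hw1
  have hbW := hΦ.target_subset hb
  obtain ⟨G, B, -, hG⟩ := S.exists_bilinForm (coordVec_mem_Abar_of_target hφ hΦ hb)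
  refine (hα.tangential_iff hφ hΦ he hb hbe (d := c • coordVec Φ (line z b) 0) ?_).2 ?_
  · rw [(hasDerivAt_chartField_variationField he hΦ hbW hbe w c).deriv, variationField_base,
      chartVec_mfderiv_target hφ.mem_atlas hΦ hb, add_sub_cancel_left, chartVec, map_smul, coordVec,
      mfderiv_chart_comp he (hΦ.mdifferentiableAt hbW) hbe]
    rfl
  · have hnormal := g_normal_of_tangentTo hφ hΦ (map_mem_source_of_target hΦ hb) hu
    rw [normal_eq hφ hΦ hb, hG] at hnormal
    rw [hG, map_smul, LinearMap.smul_apply, hnormal, smul_zero]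

lemma eq_smul_basisVec_of_orthogonal (hφ : S.IsLightlikeChart f N φ)
    (hΦ : S.IsContinuation φ W Φ) (hx : x ∈ φ.target) {d : E4} (hd1 : d 1 = 0)
    (hd : ∀ v : E4, v 0 = 0 → v 1 = 0 → S.g (coordVec Φ x 0) (mfderiv (𝓡 4) (𝓡 4) Φ x d)
      (mfderiv (𝓡 4) (𝓡 4) Φ x v) = 0) : ∃ k : ℝ, d = k • basisVec 0 := by
  have hA := coordVec_mem_Abar_of_target hφ hΦ hx
  obtain ⟨G, B, hB, hG⟩ := S.exists_bilinForm hA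
  let T : E4 →ₗ[ℝ] TangentSpace (𝓡 4) (Φ x) := (mfderiv (𝓡 4) (𝓡 4) Φ x).toLinearMap
  have hG0 (w : E4) : G (T (basisVec 0)) (T w) = w 1 :=
    (hG _ _).symm.trans (g_mfderiv_of_target hφ hΦ hx w)
  -- `T d` is orthogonal to `∂₀`, `∂₂` and `∂₃`, and it is a combination of these vectors.
  have hnull : G (T d) (T d) = 0 := by
    have hT0 : G (T d) (T (basisVec 0)) = 0 := (hB.symm _ _).trans ((hG0 d).trans hd1)
    have hslice : G (T d) (T (d - d 0 • basisVec 0)) = 0 :=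
      (hG _ _).symm.trans (hd _ (by simp [basisVec_apply]) (by simp [basisVec_apply, hd1]))
    rwa [map_sub, map_smul, map_sub, map_smul, hT0, smul_zero, sub_zero] at hslice
  obtain ⟨k, hk⟩ := hB.eq_smul_of_null_orthogonal hA.2 ((hG0 _).trans (by simp [basisVec_apply]))
    ((hG0 d).trans hd1) hnull
  exact ⟨k, (mfderiv_bijective_of_target hφ.mem_atlas hΦ hx).1
    (hk.trans (map_smul T k (basisVec 0)).symm)⟩

lemma IsJacobiField.deriv_chartField_one_eq_zero (hφ : S.IsLightlikeChart f N φ)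
    (hΦ : S.IsContinuation φ W Φ) (hI : IsOpen I) (hI' : I.OrdConnected)
    (hIW : ∀ s ∈ I, line z s ∈ W) (hb : b ∈ I) (hbφ : line z b ∈ φ.target)
    {J : ∀ s, TangentSpace (𝓡 4) (Φ (line z s))}
    (hJ : S.IsJacobiField (fun s => Φ (line z s)) I J) (hJb : chartVec φ (J b) 1 = 0)
    (ht : t ∈ I) (htb : t ≠ b) (hJt : J t = 0) :
    deriv (chartField φ (fun s => Φ (line z s)) J) b 1 = 0 := by
  have hmomentum : (fun r => S.g (velocity (fun s => Φ (line z s)) r)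
      (velocity (fun s => Φ (line z s)) r) (J r)) =ᶠ[𝓝 b] fun r => chartVec φ (J r) 1 := by
    filter_upwards [eventually_line_mem φ.open_target hbφ] with r hr
    rw [velocity_comp_line (hΦ.mdifferentiableAt (hΦ.target_subset hr)),
      g_coordVec_of_target hφ hΦ hr]
  have hslope : deriv (fun r => chartVec φ (J r) 1) b
      = deriv (chartField φ (fun s => Φ (line z s)) J) b 1 :=
    (hasDerivAt_euclidean.1 (hasDerivAt_of_smooth (contDiffAt_chartField hφ.mem_atlas hI hJ.1 hb
      (map_mem_source_of_target hΦ hbφ))) 1).deriv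
  have hgeo (s : ℝ) (hs : s ∈ I) := isGeodesicAt_line hφ hΦ (hIW s hs)
  obtain ⟨G, B, -, hG⟩ := S.exists_bilinForm (hgeo t ht).1
  have haffine := hJ.affine hI hI' hgeo hb ht
  have hbase : S.g (velocity (fun s => Φ (line z s)) b) (velocity (fun s => Φ (line z s)) b) (J b)
      = 0 := hmomentum.self_of_nhds.trans hJb
  rw [hmomentum.deriv_eq, hslope, hbase, hG, hJt, map_zero, zero_add] at haffine
  exact (mul_eq_zero.1 haffine.symm).resolve_right (sub_ne_zero.2 htb)

lemma IsSubmanifoldJacobiField.exists_deriv_eq (hφ : S.IsLightlikeChart f N φ)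
    (hΦ : S.IsContinuation φ W Φ) (hI : IsOpen I) (hI' : I.OrdConnected)
    (hIW : ∀ s ∈ I, line z s ∈ W) (hb : b ∈ I) (hbφ : line z b ∈ φ.target)
    {J : ∀ s, TangentSpace (𝓡 4) (Φ (line z s))}
    (hJ : S.IsSubmanifoldJacobiField (slice φ b (z 1)) N (fun s => Φ (line z s)) I b J)
    (ht : t ∈ I) (htb : t ≠ b) (hJt : J t = 0) :
    ∃ k : ℝ, deriv (chartField φ (fun s => Φ (line z s)) J) b = k • basisVec 0 := by
  obtain ⟨hJac, ⟨α, hα⟩, htan⟩ := hJ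
  have hbs := map_mem_source_of_target hΦ hbφ
  have hJb := (chartVec_of_tangentTo hφ.mem_atlas hbs ⟨α, hα⟩).2
  refine eq_smul_basisVec_of_orthogonal hφ hΦ hbφ
    (hJac.deriv_chartField_one_eq_zero hφ hΦ hI hI' hIW hb hbφ hJb ht htb hJt) fun v hv0 hv1 => ?_
  have hv := mfderiv_mem_tangentTo_slice hΦ hbφ hv0 hv1
  rw [line_apply_zero, line_apply_one] at hv
  refine (hα.tangential_iff hφ hΦ hφ.mem_atlas hbφ hbs ?_).1 (htan φ hφ.mem_atlas hbs α hα _ hv)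
  rw [fderiv_fderiv_chart_target hΦ hbφ, sub_zero, chartVec_mfderiv_target hφ.mem_atlas hΦ hbφ]

theorem IsSubmanifoldJacobiField.eq_variationField (hφ : S.IsLightlikeChart f N φ)
    (hΦ : S.IsContinuation φ W Φ) (hI : IsOpen I) (hI' : I.OrdConnected)
    (hIW : ∀ s ∈ I, line z s ∈ W) (hb : b ∈ I) (hbφ : line z b ∈ φ.target)
    {J : ∀ s, TangentSpace (𝓡 4) (Φ (line z s))}
    (hJ : S.IsSubmanifoldJacobiField (slice φ b (z 1)) N (fun s => Φ (line z s)) I b J)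
    (ht : t ∈ I) (htb : t ≠ b) (hJt : J t = 0) :
    ∃ (w : E4) (c : ℝ), w 0 = 0 ∧ w 1 = 0 ∧ ∀ s ∈ I, J s = variationField Φ z w c b s := by
  obtain ⟨k, hk⟩ := hJ.exists_deriv_eq hφ hΦ hI hI' hIW hb hbφ ht htb hJt
  have hbs := map_mem_source_of_target hΦ hbφ
  obtain ⟨hw0, hw1⟩ := chartVec_of_tangentTo hφ.mem_atlas hbs hJ.2.1
  refine ⟨chartVec φ (J b), k, hw0, hw1, fun s hs => hJ.1.unique
    (isJacobiField_variationField hφ hΦ hI hIW _ k b) hI hI'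
    (fun s hs => isGeodesicAt_line hφ hΦ (hIW s hs)) hφ.mem_atlas hb hbs ?_ ?_ hs⟩
  · rw [chartField, chartField, variationField_base]
    exact (chartVec_mfderiv_target hφ.mem_atlas hΦ hbφ _).symm
  · rw [(hasDerivAt_chartField_variationField hφ.mem_atlas hΦ (hΦ.target_subset hbφ) hbs _ k).deriv,
      fderiv_fderiv_chart_target hΦ hbφ, fderiv_chart_target hΦ hbφ, zero_add, hk]

end FinslerSpacetime

/-! ### Focal points of the slices -/

namespace FinslerSpacetime

variable {M : Type*} [TopologicalSpace M] [ChartedSpace E4 M] [IsManifold (𝓡 4) ∞ M]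
  {S : FinslerSpacetime M} {φ : OpenPartialHomeomorph M E4} {W : Set E4} {Φ : E4 → M}
  {f : M → ℝ} {N : ∀ q : M, TangentSpace (𝓡 4) q} {z : E4} {I : Set ℝ} {b t : ℝ}

lemma isFocalPoint_line_iff (hφ : S.IsLightlikeChart f N φ) (hΦ : S.IsContinuation φ W Φ)
    (hIW : ∀ s ∈ I, line z s ∈ W) (hbφ : line z b ∈ φ.target) :
    S.IsFocalPoint (slice φ b (z 1)) N (fun s => Φ (line z s)) I b t ↔
      t ≠ b ∧ ∃ J : ∀ s, TangentSpace (𝓡 4) (Φ (line z s)),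
        S.IsSubmanifoldJacobiField (slice φ b (z 1)) N (fun s => Φ (line z s)) I b J
          ∧ (∃ s ∈ I, J s ≠ 0) ∧ J t = 0 := by
  refine ⟨fun h => h.2.2.2.2, fun h => ⟨fun s hs => isGeodesicAt_line hφ hΦ (hIW s hs), ?_, ?_,
    fun q hq w hw => g_normal_of_tangentTo hφ hΦ hq.1 hw, h⟩⟩
  · refine ⟨map_mem_source_of_target hΦ hbφ, ?_⟩
    rw [chart_apply_target hΦ hbφ, line_apply_zero, line_apply_one]
    exact ⟨rfl, rfl⟩
  · exact (velocity_comp_line (hΦ.mdifferentiableAt (hΦ.target_subset hbφ))).trans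
      (normal_eq hφ hΦ hbφ).symm

lemma IsFocalPoint.exists_mfderiv_line_eq_zero (hφ : S.IsLightlikeChart f N φ)
    (hΦ : S.IsContinuation φ W Φ) (hI : IsOpen I) (hI' : I.OrdConnected)
    (hIW : ∀ s ∈ I, line z s ∈ W) (hb : b ∈ I) (hbφ : line z b ∈ φ.target) (ht : t ∈ I)
    (h : S.IsFocalPoint (slice φ b (z 1)) N (fun s => Φ (line z s)) I b t) :
    ∃ w : E4, w ≠ 0 ∧ mfderiv (𝓡 4) (𝓡 4) Φ (line z t) w = 0 := by
  obtain ⟨htb, J, hJ, ⟨s, hs, hJs⟩, hJt⟩ := (isFocalPoint_line_iff hφ hΦ hIW hbφ).1 h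
  obtain ⟨w, c, hw0, -, hJw⟩ := hJ.eq_variationField hφ hΦ hI hI' hIW hb hbφ ht htb hJt
  refine ⟨w + (c * (t - b)) • basisVec 0, fun hzero => hJs ?_, (hJw t ht).symm.trans hJt⟩
  have hc : c = 0 := by
    have h0 : c * (t - b) = 0 := by
      simpa [basisVec_apply, hw0] using congrArg (fun v : E4 => v 0) hzero
    exact (mul_eq_zero.1 h0).resolve_right (sub_ne_zero.2 htb)
  have hw : w = 0 := by simpa [hc] using hzero
  rw [hJw s hs, variationField, hc, hw, zero_mul, zero_smul, add_zero]
  exact map_zero _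

lemma isFocalPoint_of_mfderiv_line_eq_zero (hφ : S.IsLightlikeChart f N φ)
    (hΦ : S.IsContinuation φ W Φ) (hI : IsOpen I) (hIW : ∀ s ∈ I, line z s ∈ W) (hb : b ∈ I)
    (hbφ : line z b ∈ φ.target) (ht : t ∈ I) {w : E4} (hw : w ≠ 0) (hw1 : w 1 = 0)
    (hker : mfderiv (𝓡 4) (𝓡 4) Φ (line z t) w = 0) :
    S.IsFocalPoint (slice φ b (z 1)) N (fun s => Φ (line z s)) I b t := by
  have hinj {x : E4} (hx : x ∈ φ.target) {v : E4} (hv : mfderiv (𝓡 4) (𝓡 4) Φ x v = 0) : v = 0 :=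
    (mfderiv_bijective_of_target hφ.mem_atlas hΦ hx).1 (hv.trans (map_zero _).symm)
  have htb : t ≠ b := fun htb => hw (hinj hbφ (htb ▸ hker))
  have hcancel : w 0 / (t - b) * (t - b) = w 0 := div_mul_cancel₀ _ (sub_ne_zero.2 htb)
  refine (isFocalPoint_line_iff hφ hΦ hIW hbφ).2
    ⟨htb, variationField Φ z (w - w 0 • basisVec 0) (w 0 / (t - b)) b,
      isSubmanifoldJacobiField_variationField hφ hΦ hI hIW hbφ (by simp [basisVec_apply])
        (by simp [basisVec_apply, hw1]) _, ⟨b, hb, fun hJb => ?_⟩, ?_⟩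
  · rw [variationField_base] at hJb
    have hparallel : w = w 0 • basisVec 0 := sub_eq_zero.1 (hinj hbφ hJb)
    have hsmul : w 0 • coordVec Φ (line z t) 0 = 0 :=
      (map_smul (mfderiv (𝓡 4) (𝓡 4) Φ (line z t)) (w 0) (basisVec 0)).symm.trans (hparallel ▸ hker)
    have hw0 : w 0 = 0 :=
      (smul_eq_zero.1 hsmul).resolve_right (coordVec_mem_Abar hφ hΦ (hIW t ht)).2
    exact hw (hparallel.trans (by rw [hw0, zero_smul]))
  · rw [variationField, hcancel, sub_add_cancel, hker]

end FinslerSpacetime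

end

theorem mainTheorem6_general {M : Type*} [TopologicalSpace M] [ChartedSpace E4 M]
    [IsManifold (𝓡 4) ∞ M] (S : FinslerSpacetime M)
    (f : M → ℝ) (N : ∀ q : M, TangentSpace (𝓡 4) q)
    (φ : OpenPartialHomeomorph M E4) (hφ : S.IsLightlikeChart f N φ)
    (W : Set E4) (Φ : E4 → M) (hΦ : S.IsContinuation φ W Φ) (b t : ℝ) (z : E4)
    (I : Set ℝ) (hI : IsOpen I) (hI' : I.OrdConnected) (hb : b ∈ I) (ht : t ∈ I)
    (hIW : ∀ s ∈ I, FinslerSpacetime.line z s ∈ W)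
    (hbφ : FinslerSpacetime.line z b ∈ φ.target) :
    S.IsFocalPoint (FinslerSpacetime.slice φ b (z 1)) N
        (fun s => Φ (FinslerSpacetime.line z s)) I b t
      ↔ S.Delta Φ (FinslerSpacetime.line z t) = 0 := by
  have hg := FinslerSpacetime.g_mfderiv_line hφ hΦ hI hI' hIW hb hbφ ht
  have hA := FinslerSpacetime.coordVec_mem_Abar hφ hΦ (hIW t ht)
  rw [FinslerSpacetime.delta_eq_zero_iff hA hg]
  refine ⟨FinslerSpacetime.IsFocalPoint.exists_mfderiv_line_eq_zero hφ hΦ hI hI' hIW hb hbφ ht, ?_⟩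
  rintro ⟨w, hw, hker⟩
  obtain ⟨G, B, -, hG⟩ := S.exists_bilinForm hA
  have hw1 : w 1 = 0 := by rw [← hg, hker, hG, map_zero]
  exact FinslerSpacetime.isFocalPoint_of_mfderiv_line_eq_zero hφ hΦ hI hIW hb hbφ ht hw hw1 hker

theorem mainTheorem6 {M : Type*} [TopologicalSpace M] [T2Space M] [SecondCountableTopology M]
    [ConnectedSpace M] [ChartedSpace E4 M] [IsManifold (𝓡 4) ∞ M]
    (S : FinslerSpacetime M)
    (f : M → ℝ) (N : ∀ q : M, TangentSpace (𝓡 4) q)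
    (φ : OpenPartialHomeomorph M E4) (hφ : S.IsLightlikeChart f N φ)
    (W : Set E4) (Φ : E4 → M) (hΦ : S.IsContinuation φ W Φ)
    (b c : ℝ) (z : E4) (hzc : z 1 = c)
    (I : Set ℝ) (hI : IsOpen I) (hI' : I.OrdConnected) (hb : b ∈ I) (hz : z 0 ∈ I)
    (hIW : ∀ s ∈ I, FinslerSpacetime.line z s ∈ W)
    (hbφ : FinslerSpacetime.line z b ∈ φ.target) :
    S.IsFocalPoint (FinslerSpacetime.slice φ b c) N
        (fun s => Φ (FinslerSpacetime.line z s)) I b (z 0)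
      ↔ S.Delta Φ z = 0 := by
  simpa only [hzc, FinslerSpacetime.line_self] using
    mainTheorem6_general S f N φ hφ W Φ hΦ b (z 0) z I hI hI' hb hz hIW hbφ
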